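/- Let $D=[0,1]^2$ with coordinates $(t,x)$ (time, space), let $\mathcal M(D)$ be the set of positive finite Radon measures on $D$ with the weak topology (convergence against continuous functions), and let $L^2=L^2([0,1])$ in the space variable. For $q\in L^2$ put $$\eta(q)(x)=\exp\Big(\int_0^x q\,du\Big),\qquad \varphi(q)(x)=\int_0^x\eta(q)\,dy,$$ $$Q=\Big\{q\in L^2:\ \int_0^1 q\,dx=0,\ \int_0^1\eta(q)\,dx=1\Big\},\qquad T_q^*Q=\Big\{p\in L^2:\ \int_0^1\eta(q)\,p\,dx=0,\ \int_0^1\eta(q)\,\varphi(q)\,p\,dx=0\Big\}.$$ Given $p_0,q_0\in L^2$, let $\mathcal C^0$ be the set of pairs $(p,q)\in H^1([0,1],L^2)\times H^2([0,1],L^2)$ with $q(t)\in Q$ and $p(t)\in T^*_{q(t)}Q$ for all $t\in[0,1]$, $\dot q=\eta(q)p$, and $q(0)=q_0$, $p(0)=p_0$. Given also $p_1,q_1\in L^2$, let $\mathcal C^{0,1}$ be the subset of those pairs with moreover $q(1)=q_1$, $p(1)=p_1$. (These sets are empty unless $q_i\in Q$ and $p_i\in T^*_{q_i}Q$.) Let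 $r(x,y)=\frac{y^2}{4x}$ if $x>0$, $r(0,0)=0$, and $r=+\infty$ otherwise. For $\mu\in\mathcal M(D)$, a finite signed measure $\sigma$ on $D$ and $f\in C^0(D)$ with $f>0$, let $$\mathrm{FR}_f(\mu,\sigma)=\int_D r\Big(\frac{d\mu}{d\lambda},\frac{d\sigma}{d\lambda}\Big) f\,d\lambda ,$$ for any finite positive measure $\lambda$ dominating $\mu$ and $|\sigma|$. We write $\mathrm{FR}(\mu,\partial_t\mu)\preccurlyeq\nu$ if the distributional time derivative $\partial_t\mu$ (tested against smooth functions on $D$ that vanish for $t$ near $0$ and $1$) is a finite signed measure $\sigma$ and $\mathrm{FR}_f(\mu,\sigma)\le\int_D f\,d\nu$ for all $f\in C^0(D)$ with $f>0$. The set $\mathcal C_R^0$ of relaxed curves consists of the $(p,q,\mu,\nu)$ with $(p,q)\in\mathcal C^0$ and $\mu,\nu\in\mathcal M(D)$ such that $$\mu\ge p^2\,dt\,dx,\qquad \nu\ge\dot p^2\,dt\,dx,\qquad \mathrm{FR}(\mu-p^2,\partial_t(\mu-p^2))\preccurlyeq\nu-\dot p^2,$$ and $\mu(0)=p(0)^2\,dx$,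 where $\mu=\mu(t)\,dt$ for a weakly continuous path $t\in[0,1]\mapsto\mu(t)$ of positive finite measures on $[0,1]$. The set $\mathcal C_R^{0,1}$ is defined in the same way, with $\mathcal C^{0,1}$ in place of $\mathcal C^0$ and the additional constraint $\mu(1)=p(1)^2\,dx$. **Proposition.** The sets $\mathcal C_R^0$ and $\mathcal C_R^{0,1}$ are closed in $H^1([0,1],L^2)\times H^2([0,1],L^2)\times\mathcal M(D)^2$ endowed with the product of the weak topologies. In particular they are closed in $\mathcal C^0\times\mathcal M(D)^2$, respectively $\mathcal C^{0,1}\times\mathcal M(D)^2$, for the weak topology. -/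

import Mathlib

open MeasureTheory Set Topology
open scoped ContDiff ENNReal unitInterval

noncomputable section

namespace RelaxedCubics

/-- The time-space square `[0,1]²`; the first coordinate is time `t`, the second is space `x`.
It carries the Lebesgue measure `dt dx`. -/
abbrev Square : Type := I × I

/-- The space `L²([0,1])` of functions of the space variable. -/
abbrev L2Space : Type := Lp ℝ 2 (volume : Measure I)

/-- The space `L²([0,1]²)`, identified as usual with `L²([0,1], L²([0,1]))`. -/
abbrev L2Square : Type := Lp ℝ 2 (volume : Measure Square)

/-! ### Test functions and the Sobolev spaces `H¹([0,1], L²)` and `H²([0,1], L²)` -/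

/-- Smooth compactly supported functions on `(0,1) × ℝ`, to be restricted to the square: they
vanish near the times `0` and `1`, with no restriction at the boundary in space. -/
def IsTimeTest (f : ℝ × ℝ → ℝ) : Prop :=
  ContDiff ℝ ∞ f ∧ HasCompactSupport f ∧ tsupport f ⊆ Ioo (0 : ℝ) 1 ×ˢ univ

/-- A point of the square as a point of the plane. -/
def toPlane (z : Square) : ℝ × ℝ := ((z.1 : ℝ), (z.2 : ℝ))

/-- The time derivative `∂ₜ f` of a function on the plane, at a point of the square. -/
def timeDeriv (f : ℝ × ℝ → ℝ) (z : Square) : ℝ := fderiv ℝ f (toPlane z) (1, 0)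

/-- `v` is the weak time derivative of `u`. -/
def IsWeakTimeDeriv (u v : L2Square) : Prop :=
  ∀ f : ℝ × ℝ → ℝ, IsTimeTest f →
    ∫ z : Square, u z * timeDeriv f z = - ∫ z : Square, v z * f (toPlane z)

theorem continuous_toPlane : Continuous toPlane := by
  unfold toPlane
  fun_prop

theorem IsTimeTest.continuous_comp {f : ℝ × ℝ → ℝ} (hf : IsTimeTest f) :
    Continuous fun z : Square => f (toPlane z) :=
  hf.1.continuous.comp continuous_toPlane

theorem IsTimeTest.continuous_timeDeriv {f : ℝ × ℝ → ℝ} (hf : IsTimeTest f) :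
    Continuous (timeDeriv f) := by
  have h : Continuous (fderiv ℝ f) := hf.1.continuous_fderiv (by simp)
  exact (h.comp continuous_toPlane).clm_apply continuous_const

theorem integrable_mul_continuous (u : L2Square) {g : Square → ℝ} (hg : Continuous g) :
    Integrable (fun z : Square => u z * g z) := by
  obtain ⟨C, hC⟩ := isCompact_univ.exists_bound_of_continuousOn hg.continuousOn
  exact ((Lp.memLp u).integrable one_le_two).mul_bdd hg.aestronglyMeasurable
    (Filter.Eventually.of_forall fun z => hC z (mem_univ z))

theorem integral_add_mul (u v : L2Square) {g : Square → ℝ} (hg : Continuous g) :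
    ∫ z : Square, (u + v : L2Square) z * g z
      = (∫ z : Square, u z * g z) + ∫ z : Square, v z * g z := by
  rw [← integral_add (integrable_mul_continuous u hg) (integrable_mul_continuous v hg)]
  refine integral_congr_ae ?_
  filter_upwards [Lp.coeFn_add u v] with z hz
  rw [hz, Pi.add_apply, add_mul]

theorem integral_smul_mul (c : ℝ) (u : L2Square) (g : Square → ℝ) :
    ∫ z : Square, (c • u : L2Square) z * g z = c * ∫ z : Square, u z * g z := by
  rw [← integral_const_mul]
  refine integral_congr_ae ?_
  filter_upwards [Lp.coeFn_smul c u] with z hz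
  rw [hz, Pi.smul_apply, smul_eq_mul, mul_assoc]

theorem integral_zero_mul (g : Square → ℝ) :
    ∫ z : Square, (0 : L2Square) z * g z = 0 := by
  simpa only [zero_smul, zero_mul] using integral_smul_mul 0 0 g

theorem IsWeakTimeDeriv.zero : IsWeakTimeDeriv 0 0 := by
  intro f _
  rw [integral_zero_mul, integral_zero_mul (fun z => f (toPlane z)), neg_zero]

theorem IsWeakTimeDeriv.add {u v u' v' : L2Square} (h : IsWeakTimeDeriv u v)
    (h' : IsWeakTimeDeriv u' v') : IsWeakTimeDeriv (u + u') (v + v') := by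
  intro f hf
  rw [integral_add_mul u u' hf.continuous_timeDeriv, integral_add_mul v v' hf.continuous_comp,
    h f hf, h' f hf, neg_add]

theorem IsWeakTimeDeriv.smul {u v : L2Square} (c : ℝ) (h : IsWeakTimeDeriv u v) :
    IsWeakTimeDeriv (c • u) (c • v) := by
  intro f hf
  rw [integral_smul_mul, integral_smul_mul c v (fun z => f (toPlane z)), h f hf, mul_neg]

/-- The Sobolev space `H¹([0,1], L²([0,1]))`: the pairs `(u, u̇)` of square integrable functions
such that `u̇` is the weak time derivative of `u`. Its norm is
`max (‖u‖, ‖u̇‖)`, which is equivalent to the Hilbert norm and so has the same weak topology. -/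
def H1 : Submodule ℝ (L2Square × L2Square) where
  carrier := {w | IsWeakTimeDeriv w.1 w.2}
  zero_mem' := IsWeakTimeDeriv.zero
  add_mem' h h' := h.add h'
  smul_mem' c _ h := h.smul c

/-- The Sobolev space `H²([0,1], L²([0,1]))`: the triples `(u, u̇, ü)` of square integrable
functions such that `u̇`, `ü` are the first two weak time derivatives of `u`. -/
def H2 : Submodule ℝ (L2Square × L2Square × L2Square) where
  carrier := {w | IsWeakTimeDeriv w.1 w.2.1 ∧ IsWeakTimeDeriv w.2.1 w.2.2}
  zero_mem' := ⟨IsWeakTimeDeriv.zero, IsWeakTimeDeriv.zero⟩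
  add_mem' h h' := ⟨h.1.add h'.1, h.2.add h'.2⟩
  smul_mem' c _ h := ⟨h.1.smul c, h.2.smul c⟩

/-- The element `u` of an `H¹` space. -/
def H1.fn (p : H1) : L2Square := p.1.1

/-- Its time derivative `u̇`. -/
def H1.dot (p : H1) : L2Square := p.1.2

/-- The element `u` of an `H²` space. -/
def H2.fn (q : H2) : L2Square := q.1.1

/-- Its time derivative `u̇`. -/
def H2.dot (q : H2) : L2Square := q.1.2.1

/-- `c` is the representative of `u` in `C⁰([0,1], L²([0,1]))`. It is unique, and it exists for
every element of `H¹([0,1], L²([0,1]))`; the values of `u` at given times are those of `c`. -/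
def IsContinuousRep (u : L2Square) (c : I → L2Space) : Prop :=
  Continuous c ∧ ∀ᵐ t : I, (c t : I → ℝ) =ᵐ[volume] fun x => u (t, x)

/-! ### The manifold of diffeomorphisms in the coordinate `q = ∂ₓ log ∂ₓ φ` -/

/-- `η(q)(x) = exp (∫₀ˣ q)`. -/
def eta (q : I → ℝ) (x : I) : ℝ := Real.exp (∫ u in Iic x, q u)

/-- `φ(q)(x) = ∫₀ˣ η(q)`. -/
def phi (q : I → ℝ) (x : I) : ℝ := ∫ y in Iic x, eta q y

/-- The submanifold `Q` of `L²([0,1])`. -/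
def Q : Set L2Space := {q | ∫ x, q x = 0 ∧ ∫ x, eta q x = 1}

/-- The cotangent space `T_q^*Q`, i.e. the range of the projection `π_q^*`: the elements of
`L²([0,1])` orthogonal to `1` and to `φ(q)` for the scalar product with weight `η(q)`
(equivalently, `η(q) p` is tangent to `Q` at `q`). -/
def cotangent (q : L2Space) : Set L2Space :=
  {p | ∫ x, eta q x * p x = 0 ∧ ∫ x, eta q x * (phi q x * p x) = 0}

/-! ### Curves -/

/-- `(p, q)` is a curve in `T^*Q` with `q̇ = η(q) p`, and `P`, `R` are the time-continuous
representatives of `p`, `q`. -/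
structure IsCurve (p : H1) (q : H2) (P R : I → L2Space) : Prop where
  rep_p : IsContinuousRep (H1.fn p) P
  rep_q : IsContinuousRep (H2.fn q) R
  mem_Q : ∀ t, R t ∈ Q
  mem_cotangent : ∀ t, P t ∈ cotangent (R t)
  ode : ∀ᵐ z : Square, H2.dot q z = eta (fun u => H2.fn q (z.1, u)) z.2 * H1.fn p z

/-- The set `𝒞⁰`: curves with initial conditions `p(0) = p₀`, `q(0) = q₀`. -/
def curves0 (p₀ q₀ : L2Space) : Set (H1 × H2) :=
  {c | ∃ P R : I → L2Space, IsCurve c.1 c.2 P R ∧ P 0 = p₀ ∧ R 0 = q₀}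

/-- The set `𝒞^{0,1}`: curves with prescribed values of `(p, q)` at times `0` and `1`. -/
def curves01 (p₀ q₀ p₁ q₁ : L2Space) : Set (H1 × H2) :=
  {c | ∃ P R : I → L2Space,
    IsCurve c.1 c.2 P R ∧ P 0 = p₀ ∧ R 0 = q₀ ∧ P 1 = p₁ ∧ R 1 = q₁}

/-! ### The Fisher-Rao functional -/

/-- The one-homogeneous convex function `r(x,y) = y² / (4x)` for `x > 0`, `r(0,0) = 0`, and
`r = +∞` elsewhere. -/
def rFun (x y : ℝ) : ℝ≥0∞ :=
  if 0 < x then ENNReal.ofReal (y ^ 2 / (4 * x)) else if x = 0 ∧ y = 0 then 0 else ⊤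

/-- The Fisher-Rao functional `FR_f(μ,τ) = ∫ r(dμ/dλ, dτ/dλ) f dλ`, with the dominating measure
`λ = μ + |τ|` (by homogeneity of `r` its choice does not matter). -/
def fisherRao (f : C(Square, ℝ)) (μ : Measure Square) (τ : SignedMeasure Square) : ℝ≥0∞ :=
  ∫⁻ z, rFun (μ.rnDeriv (μ + τ.totalVariation) z).toReal (τ.rnDeriv (μ + τ.totalVariation) z)
    * ENNReal.ofReal (f z) ∂(μ + τ.totalVariation)

/-- The integral of a function against a signed measure. -/
def signedIntegral (τ : SignedMeasure Square) (f : Square → ℝ) : ℝ :=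
  (∫ z, f z ∂τ.toJordanDecomposition.posPart) - ∫ z, f z ∂τ.toJordanDecomposition.negPart

/-- The distributional time derivative of `μ` is the signed measure `τ`. -/
def IsTimeDerivMeasure (μ : Measure Square) (τ : SignedMeasure Square) : Prop :=
  ∀ f : ℝ × ℝ → ℝ, IsTimeTest f →
    ∫ z, timeDeriv f z ∂μ = - signedIntegral τ fun z => f (toPlane z)

/-- `FR(μ, ∂ₜμ) ≼ ν`: the distribution `∂ₜμ` is a measure, and `FR_f(μ, ∂ₜμ) ≤ ⟨ν, f⟩` for all
continuous positive functions `f` on the square. -/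
def FisherRaoLE (μ ν : Measure Square) : Prop :=
  ∃ τ : SignedMeasure Square, IsTimeDerivMeasure μ τ ∧
    ∀ f : C(Square, ℝ), (∀ z, 0 < f z) → fisherRao f μ τ ≤ ∫⁻ z, ENNReal.ofReal (f z) ∂ν

/-! ### Relaxed curves -/

/-- The measure `u²`, with density `u²` with respect to the Lebesgue measure. -/
def sqMeasure {α : Type*} [MeasureSpace α] (u : α → ℝ) : Measure α :=
  (volume : Measure α).withDensity fun z => ENNReal.ofReal (u z ^ 2)

/-- `μ = μ(t) dt` for the weakly continuous path of measures `m : t ↦ μ(t)` on `[0,1]`.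
Such a path is unique. -/
def IsDisintegration (μ : Measure Square) (m : I → FiniteMeasure I) : Prop :=
  Continuous m ∧ ∀ f : C(Square, ℝ),
    ∫ z, f z ∂μ = ∫ t : I, ∫ x : I, f (t, x) ∂(m t : Measure I)

/-- The space in which relaxed curves live: `H¹ × H²`, with its weak topology, times two
copies of the positive finite Radon measures on the square, with the weak topology. -/
abbrev RelaxedSpace : Type :=
  WeakSpace ℝ H1 × WeakSpace ℝ H2 × FiniteMeasure Square × FiniteMeasure Square

/-- The component `p` of `(p, q, μ, ν)`. -/
def RelaxedSpace.p (w : RelaxedSpace) : H1 := (toWeakSpace ℝ H1).symm w.1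

/-- The component `q` of `(p, q, μ, ν)`. -/
def RelaxedSpace.q (w : RelaxedSpace) : H2 := (toWeakSpace ℝ H2).symm w.2.1

/-- The component `μ` of `(p, q, μ, ν)`. -/
def RelaxedSpace.μ (w : RelaxedSpace) : Measure Square := w.2.2.1

/-- The component `ν` of `(p, q, μ, ν)`. -/
def RelaxedSpace.ν (w : RelaxedSpace) : Measure Square := w.2.2.2

/-- The conditions `μ ≥ p²`, `ν ≥ ṗ²` and `FR(μ - p², ∂ₜ(μ - p²)) ≼ ν - ṗ²`. -/
structure IsRelaxation (p : H1) (μ ν : Measure Square) : Prop where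
  sq_le : sqMeasure (H1.fn p) ≤ μ
  sq_dot_le : sqMeasure (H1.dot p) ≤ ν
  fisherRao_le : FisherRaoLE (μ - sqMeasure (H1.fn p)) (ν - sqMeasure (H1.dot p))

/-- The set `𝒞_R⁰` of relaxed curves: `(p, q) ∈ 𝒞⁰` and `μ(0) = p(0)²`. -/
def relaxedCurves0 (p₀ q₀ : L2Space) : Set RelaxedSpace :=
  {w | (w.p, w.q) ∈ curves0 p₀ q₀ ∧ IsRelaxation w.p w.μ w.ν ∧
    ∃ m : I → FiniteMeasure I, IsDisintegration w.μ m ∧ (m 0 : Measure I) = sqMeasure p₀}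

/-- The set `𝒞_R^{0,1}` of relaxed curves with constraints at time `1`: `(p, q) ∈ 𝒞^{0,1}`,
`μ(0) = p(0)²` and `μ(1) = p(1)²`. -/
def relaxedCurves01 (p₀ q₀ p₁ q₁ : L2Space) : Set RelaxedSpace :=
  {w | (w.p, w.q) ∈ curves01 p₀ q₀ p₁ q₁ ∧ IsRelaxation w.p w.μ w.ν ∧
    ∃ m : I → FiniteMeasure I, IsDisintegration w.μ m ∧
      (m 0 : Measure I) = sqMeasure p₀ ∧ (m 1 : Measure I) = sqMeasure p₁}

end RelaxedCubics

end

noncomputable section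

namespace RelaxedCubics

open Filter

/-! ### Partial integration against weights in time -/

/-! Closedness is tested along an ultrafilter of relaxed curves converging to a point of the ambient
space, so compactness provides limits without extracting subsequences. The constraints `p² ≤ μ` and
`ṗ² ≤ ν`, together with the convergence of the masses of `μ` and `ν`, bound `p` and `ṗ` in `L²`
eventually along the ultrafilter. Four arguments then carry the proof.

Values in time: integration by parts writes `u(t)` as a bounded linear function of `(u, u̇)`
(`isContinuousRep_evalAt`), so evaluation at a fixed time is weakly continuous and the constraints
on `p` and `q` at the end times survive.

The relaxation constraint: the bound `FR(m, L) ≼ n` is equivalent to `L(gh) ≤ ∫ g² dm + ∫ h² dn` for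
all continuous `g`, `h` (`Dominates`), an inequality linear in `(m, n, L)` and therefore stable
under limits. The defects `μ - p²` need not converge to the defect of the limit, because the square
is not weakly continuous. But if `(p', μ')` is the limit, then `μ - p² + (p - p')²` does converge to
`μ' - p'²`, since the quadratic terms cancel (`tendsto_defect`). The added term satisfies its own
bound: `(p - p')²` has derivative `2 (p - p')(ṗ - ṗ')`, dominated by `(p - p')²` and `(ṗ - ṗ')²`
(`dominates_mulForm`). Summing and passing to the limit gives the dual inequality for the limiting
defects, and Riesz representation recovers a signed measure (`fisherRaoLE_of_dominates`).

The path `t ↦ μ(t)`: domination of `(μ, ν)` tested on approximate indicators of time intervals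
bounds the masses of `μ(t)` and makes `t ↦ ∫ h dμ(t)` Hölder-1/2, with constants depending only on
the masses of `μ`, `ν` and on the supremum of `|h|`. Compactness at each time and equicontinuity
produce the limiting path (`exists_limit_disintegration`), so its end values are kept.

The equation `q̇ = η(q) p`: a continuation argument bounds `q(t)` in `L²` uniformly in time
(`eventually_norm_flow_le`). Hence `(t,x) ↦ ∫₀ˣ q(t)` is equicontinuous and converges uniformly, so
`η(q)` does too, and its product with the weakly convergent `p` passes to the limit in the equation
and in the constraints defining `Q` and the cotangent space (`isCurve_of_tendsto`). -/

theorem real_inner_L2 {α : Type*} {m : MeasurableSpace α} {μ : Measure α} (f g : Lp ℝ 2 μ) :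
    inner ℝ f g = ∫ x, f x * g x ∂μ := by
  rw [L2.inner_def]
  exact integral_congr_ae (Eventually.of_forall fun x => mul_comm _ _)

theorem integrable_L2 {α : Type*} {m : MeasurableSpace α} {μ : Measure α} [IsFiniteMeasure μ]
    (f : Lp ℝ 2 μ) : Integrable f μ :=
  (Lp.memLp f).integrable one_le_two

theorem integrable_mul_L2 {α : Type*} {m : MeasurableSpace α} {μ : Measure α} (f g : Lp ℝ 2 μ) :
    Integrable (fun x => f x * g x) μ :=
  (Lp.memLp f).integrable_mul (Lp.memLp g)

theorem integrable_sq_L2 {α : Type*} {m : MeasurableSpace α} {μ : Measure α} (f : Lp ℝ 2 μ) :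
    Integrable (fun x => f x ^ 2) μ :=
  (Lp.memLp f).integrable_sq

theorem norm_sq_L2 {α : Type*} {m : MeasurableSpace α} {μ : Measure α} (f : Lp ℝ 2 μ) :
    ‖f‖ ^ 2 = ∫ x, f x ^ 2 ∂μ := by
  rw [← real_inner_self_eq_norm_sq, real_inner_L2]
  simp only [sq]

theorem integral_square {f : Square → ℝ} (hf : Integrable f) :
    ∫ z, f z = ∫ t, ∫ x, f (t, x) :=
  integral_prod f hf

theorem integral_square_symm {f : Square → ℝ} (hf : Integrable f) :
    ∫ z, f z = ∫ x, ∫ t, f (t, x) :=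
  integral_prod_symm f hf

theorem ae_fst {p : I → Prop} (h : ∀ᵐ t : I, p t) : ∀ᵐ z : Square, p z.1 :=
  Measure.quasiMeasurePreserving_fst.ae h

theorem ae_snd {p : I → Prop} (h : ∀ᵐ t : I, p t) : ∀ᵐ z : Square, p z.2 :=
  Measure.quasiMeasurePreserving_snd.ae h

theorem aestronglyMeasurable_fst {f : I → ℝ} (h : AEStronglyMeasurable f) :
    AEStronglyMeasurable fun z : Square => f z.1 :=
  h.comp_quasiMeasurePreserving Measure.quasiMeasurePreserving_fst

theorem aestronglyMeasurable_snd {f : I → ℝ} (h : AEStronglyMeasurable f) :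
    AEStronglyMeasurable fun z : Square => f z.2 :=
  h.comp_quasiMeasurePreserving Measure.quasiMeasurePreserving_snd

theorem memLp_tensor (k h : L2Space) : MemLp (fun z : Square => k z.1 * h z.2) 2 volume := by
  rw [memLp_two_iff_integrable_sq]
  · simp only [mul_pow]
    exact (integrable_sq_L2 k).mul_prod (integrable_sq_L2 h)
  · exact (aestronglyMeasurable_fst (Lp.aestronglyMeasurable k)).mul
      (aestronglyMeasurable_snd (Lp.aestronglyMeasurable h))

/-- The function `(s, x) ↦ k(s) h(x)`. -/
def tensor (k h : L2Space) : L2Square := (memLp_tensor k h).toLp _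

theorem coeFn_tensor (k h : L2Space) : tensor k h =ᵐ[volume] fun z => k z.1 * h z.2 :=
  (memLp_tensor k h).coeFn_toLp

theorem norm_tensor (k h : L2Space) : ‖tensor k h‖ = ‖k‖ * ‖h‖ := by
  rw [← sq_eq_sq₀ (norm_nonneg _) (by positivity), mul_pow, norm_sq_L2, norm_sq_L2, norm_sq_L2,
    ← integral_prod_mul (fun x => k x ^ 2) (fun x => h x ^ 2)]
  refine integral_congr_ae ?_
  filter_upwards [coeFn_tensor k h] with z hz
  rw [hz, mul_pow]

/-- The bilinear map `tensor`, as a continuous map. -/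
def tensorL : L2Space →L[ℝ] L2Space →L[ℝ] L2Square :=
  LinearMap.mkContinuous₂
    (LinearMap.mk₂ ℝ tensor
      (fun k k' h => by
        apply Lp.ext
        filter_upwards [coeFn_tensor (k + k') h, coeFn_tensor k h, coeFn_tensor k' h,
          ae_fst (Lp.coeFn_add k k'), Lp.coeFn_add (tensor k h) (tensor k' h)] with z h1 h2 h3 h4 h5
        rw [h1, h5, Pi.add_apply, h2, h3, h4, Pi.add_apply, add_mul])
      (fun c k h => by
        apply Lp.ext
        filter_upwards [coeFn_tensor (c • k) h, coeFn_tensor k h,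
          ae_fst (Lp.coeFn_smul c k), Lp.coeFn_smul c (tensor k h)] with z h1 h2 h4 h5
        rw [h1, h5, Pi.smul_apply, h2, h4, Pi.smul_apply, smul_mul_assoc])
      (fun k h h' => by
        apply Lp.ext
        filter_upwards [coeFn_tensor k (h + h'), coeFn_tensor k h, coeFn_tensor k h',
          ae_snd (Lp.coeFn_add h h'), Lp.coeFn_add (tensor k h) (tensor k h')] with z h1 h2 h3 h4 h5
        rw [h1, h5, Pi.add_apply, h2, h3, h4, Pi.add_apply, mul_add])
      (fun c k h => by
        apply Lp.ext
        filter_upwards [coeFn_tensor k (c • h), coeFn_tensor k h,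
          ae_snd (Lp.coeFn_smul c h), Lp.coeFn_smul c (tensor k h)] with z h1 h2 h4 h5
        rw [h1, h5, Pi.smul_apply, h2, h4, Pi.smul_apply, mul_smul_comm]))
    1 (fun k h => by simp [norm_tensor])

theorem tensorL_apply (k h : L2Space) : tensorL k h = tensor k h := rfl

/-- The average `x ↦ ∫ k(s) u(s,x) ds` of `u` with weight `k` in time. -/
def timeAvg (k : L2Space) : L2Square →L[ℝ] L2Space := (tensorL k).adjoint

theorem inner_timeAvg (k : L2Space) (u : L2Square) (h : L2Space) :
    inner ℝ (timeAvg k u) h = ∫ z : Square, u z * (k z.1 * h z.2) := by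
  rw [timeAvg, ContinuousLinearMap.adjoint_inner_left, tensorL_apply, real_inner_L2]
  refine integral_congr_ae ?_
  filter_upwards [coeFn_tensor k h] with z hz
  rw [hz]

theorem inner_timeAvg_tensor (k : L2Space) (u : L2Square) (h : L2Space) :
    inner ℝ (timeAvg k u) h = inner ℝ u (tensor k h) := by
  rw [timeAvg, ContinuousLinearMap.adjoint_inner_left, tensorL_apply]

theorem norm_timeAvg_le (k : L2Space) (u : L2Square) : ‖timeAvg k u‖ ≤ ‖k‖ * ‖u‖ := by
  refine (ContinuousLinearMap.le_opNorm _ _).trans ?_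
  gcongr
  rw [timeAvg, LinearIsometryEquiv.norm_map]
  exact ContinuousLinearMap.opNorm_le_bound _ (norm_nonneg _) fun h => by
    rw [tensorL_apply, norm_tensor]

theorem timeAvg_sub (k k' : L2Space) (u : L2Square) :
    timeAvg (k - k') u = timeAvg k u - timeAvg k' u := by
  simp [timeAvg]

theorem integrable_tensor_mul (k h : L2Space) (u : L2Square) :
    Integrable fun z : Square => u z * (k z.1 * h z.2) := by
  refine (integrable_mul_L2 u (tensor k h)).congr ?_
  filter_upwards [coeFn_tensor k h] with z hz
  rw [hz]

/-- The indicator function of `[0,t]`. -/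
def ind (t : I) : L2Space := indicatorConstLp 2 (measurableSet_Iic (a := t)) (measure_ne_top _ _) 1

theorem coeFn_ind (t : I) : ind t =ᵐ[volume] (Iic t).indicator fun _ => (1 : ℝ) :=
  indicatorConstLp_coeFn

theorem inner_ind (t : I) (h : L2Space) : inner ℝ (ind t) h = ∫ x in Iic t, h x :=
  L2.inner_indicatorConstLp_one _ _ _

theorem coeFn_ind_one : ind 1 =ᵐ[volume] fun _ => (1 : ℝ) := by
  filter_upwards [coeFn_ind 1] with x hx
  rw [hx, indicator_of_mem]
  exact x.2.2

/-- `timeAvg` is defined by duality, which makes its weak continuity immediate. Testing against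
indicators of measurable sets of `x` and applying Fubini identifies it pointwise. -/
theorem coeFn_timeAvg (k : L2Space) (u : L2Square) :
    timeAvg k u =ᵐ[volume] fun x => ∫ s, u (s, x) * k s := by
  have hint : Integrable fun z : Square => u z * (k z.1 * ind 1 z.2) := integrable_tensor_mul _ _ _
  have hint' : Integrable fun z : Square => u z * k z.1 := by
    refine hint.congr ?_
    filter_upwards [ae_snd coeFn_ind_one] with z hz
    rw [hz, mul_one]
  refine Integrable.ae_eq_of_forall_setIntegral_eq _ _ (integrable_L2 _)
    hint'.integral_prod_right ?_
  intro s hs _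
  rw [← L2.inner_indicatorConstLp_one (𝕜 := ℝ) hs (measure_ne_top _ _), real_inner_comm,
    inner_timeAvg, ← integral_indicator hs]
  have : ∀ᵐ z : Square, u z * (k z.1 * indicatorConstLp 2 hs (measure_ne_top volume s) (1 : ℝ) z.2) =
      s.indicator (fun _ => (1 : ℝ)) z.2 * (u z * k z.1) := by
    filter_upwards [ae_snd (indicatorConstLp_coeFn (p := 2) (hs := hs)
      (hμs := measure_ne_top volume s) (c := (1 : ℝ)))] with z hz
    rw [hz]; ring
  rw [integral_congr_ae this, integral_square_symm]
  · refine integral_congr_ae (Eventually.of_forall fun x => ?_)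
    simp only
    rw [integral_const_mul]
    by_cases hx : x ∈ s <;> simp [hx]
  · exact (integrable_tensor_mul k _ u).congr this

theorem inner_ind_ind {s t : I} (h : s ≤ t) : inner ℝ (ind s) (ind t) = (s : ℝ) := by
  have hst : Iic s ∩ Iic t = Iic s := inter_eq_left.2 (Iic_subset_Iic.2 h)
  rw [inner_ind, integral_congr_ae (ae_restrict_of_ae (coeFn_ind t)),
    setIntegral_indicator measurableSet_Iic, hst]
  simp [Measure.real, s.2.1]

/-- Origin of the Hölder-1/2 estimates for `q` in time and for its primitive in space. -/
theorem norm_ind_sub_sq (s t : I) : ‖ind t - ind s‖ ^ 2 = |(t : ℝ) - s| := by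
  wlog h : s ≤ t generalizing s t
  · rw [norm_sub_rev, abs_sub_comm, this t s (le_of_not_ge h)]
  rw [norm_sub_sq_real, ← real_inner_self_eq_norm_sq, ← real_inner_self_eq_norm_sq,
    inner_ind_ind le_rfl, inner_ind_ind le_rfl, real_inner_comm, inner_ind_ind h,
    abs_of_nonneg (sub_nonneg.2 (by exact_mod_cast h))]
  ring

theorem norm_ind_sub (s t : I) : ‖ind t - ind s‖ = √|(t : ℝ) - s| := by
  rw [← norm_ind_sub_sq, Real.sqrt_sq (norm_nonneg _)]

theorem norm_ind_le (t : I) : ‖ind t‖ ≤ 1 := by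
  have : ‖ind t‖ ^ 2 = t := by rw [← real_inner_self_eq_norm_sq, inner_ind_ind le_rfl]
  nlinarith [norm_nonneg (ind t), t.2.2]

theorem continuous_ind : Continuous ind := by
  rw [Metric.continuous_iff']
  intro s ε hε
  have : Tendsto (fun t : I => √|(t : ℝ) - s|) (𝓝 s) (𝓝 (√|(s : ℝ) - s|)) := by
    apply Continuous.tendsto
    fun_prop
  rw [sub_self, abs_zero, Real.sqrt_zero] at this
  filter_upwards [this.eventually_lt_const hε] with t ht
  rwa [dist_eq_norm, norm_ind_sub]

/-- The weight `s - 1` vanishes at time `1`, so integration by parts gives `u(0) = ∫ u ds + ∫ (s -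
1) u̇ ds`. This expresses the initial value through integrals only. -/
theorem memLp_sub_one : MemLp (fun s : I => (s : ℝ) - 1) 2 volume :=
  MemLp.of_bound (by fun_prop) 1 (Eventually.of_forall fun s => by
    rw [Real.norm_eq_abs, abs_le]; constructor <;> linarith [s.2.1, s.2.2])

/-- The function `s ↦ s - 1`. -/
def subOne : L2Space := memLp_sub_one.toLp _

theorem coeFn_subOne : subOne =ᵐ[volume] fun s : I => (s : ℝ) - 1 := memLp_sub_one.coeFn_toLp

theorem norm_subOne_le : ‖subOne‖ ≤ 1 := by
  have h : ‖subOne‖ ^ 2 ≤ ∫ _ : I, (1 : ℝ) := by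
    rw [norm_sq_L2]
    refine integral_mono_ae (integrable_sq_L2 _) (integrable_const _) ?_
    filter_upwards [coeFn_subOne] with s hs
    simp only [hs]
    nlinarith [s.2.1, s.2.2]
  simp only [integral_const, probReal_univ, one_smul] at h
  nlinarith [norm_nonneg subOne]

/-- The value at time `0` of the continuous representative of `u`, where `v` is the weak time
derivative of `u`. -/
def initVal (u v : L2Square) : L2Space := timeAvg (ind 1) u + timeAvg subOne v

/-- The value at time `t` of the continuous representative of `u`, where `v` is the weak time
derivative of `u`. -/
def evalAt (t : I) (u v : L2Square) : L2Space := initVal u v + timeAvg (ind t) v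

theorem evalAt_sub (s t : I) (u v : L2Square) :
    evalAt t u v - evalAt s u v = timeAvg (ind t - ind s) v := by
  rw [evalAt, evalAt, add_sub_add_left_eq_sub, timeAvg_sub]

theorem norm_evalAt_le (t : I) (u v : L2Square) : ‖evalAt t u v‖ ≤ ‖u‖ + 2 * ‖v‖ := by
  have h1 := (norm_timeAvg_le (ind 1) u).trans
    (mul_le_mul_of_nonneg_right (norm_ind_le 1) (norm_nonneg u))
  have h2 := (norm_timeAvg_le subOne v).trans
    (mul_le_mul_of_nonneg_right norm_subOne_le (norm_nonneg v))
  have h3 := (norm_timeAvg_le (ind t) v).trans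
    (mul_le_mul_of_nonneg_right (norm_ind_le t) (norm_nonneg v))
  have := norm_add₃_le (a := timeAvg (ind 1) u) (b := timeAvg subOne v) (c := timeAvg (ind t) v)
  rw [evalAt, initVal]
  linarith

theorem continuous_evalAt (u v : L2Square) : Continuous fun t => evalAt t u v := by
  unfold evalAt timeAvg
  have := continuous_ind
  have h2 : Continuous fun t => tensorL (ind t) := tensorL.continuous.comp this
  have h3 : Continuous fun t => (tensorL (ind t)).adjoint :=
    (ContinuousLinearMap.adjoint (𝕜 := ℝ) (E := L2Space) (F := L2Square)).continuous.comp h2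
  exact continuous_const.add (h3.clm_apply continuous_const)

/-- The pointwise primitive of `v` with value `a` at time `0`. -/
def timePrim (a : I → ℝ) (v : Square → ℝ) (z : Square) : ℝ := a z.2 + ∫ s in Iic z.1, v (s, z.2)

theorem coeFn_evalAt (t : I) (u v : L2Square) :
    evalAt t u v =ᵐ[volume] fun x => timePrim (initVal u v) v (t, x) := by
  filter_upwards [Lp.coeFn_add (initVal u v) (timeAvg (ind t) v), coeFn_timeAvg (ind t) v]
    with x h1 h2
  rw [evalAt, h1, Pi.add_apply, h2, timePrim]
  congr 1
  rw [← integral_indicator measurableSet_Iic]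
  refine integral_congr_ae ?_
  filter_upwards [coeFn_ind t] with s hs
  rw [hs]
  by_cases h : s ∈ Iic t <;> simp [h]

/-! ### Calculus on the unit interval -/

theorem integral_unitInterval (f : ℝ → ℝ) : ∫ t : I, f t = ∫ s in (0 : ℝ)..1, f s := by
  rw [unitInterval.volume_def, integral_subtype_comap measurableSet_Icc,
    integral_Icc_eq_integral_Ioc, intervalIntegral.integral_of_le zero_le_one]

/-- Extension of a function on `[0,1]` to the line. -/
def ext (v : I → ℝ) : ℝ → ℝ := IccExtend zero_le_one v

theorem ext_coe (v : I → ℝ) (t : I) : ext v t = v t := IccExtend_val _ _ t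

theorem ext_comp_coe (v : I → ℝ) : ext v ∘ ((↑) : I → ℝ) = v := funext (ext_coe v)

theorem integrableOn_ext {v : I → ℝ} (hv : Integrable v) : IntegrableOn (ext v) (Icc 0 1) := by
  rw [← ext_comp_coe v] at hv
  exact (unitInterval.measurePreserving_coe.integrable_comp_emb
    unitInterval.measurableEmbedding_coe).1 hv

theorem intervalIntegrable_ext {v : I → ℝ} (hv : Integrable v) :
    IntervalIntegrable (ext v) volume 0 1 := by
  rw [intervalIntegrable_iff_integrableOn_Icc_of_le zero_le_one]
  exact integrableOn_ext hv

theorem setIntegral_Iic (v : I → ℝ) (t : I) :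
    ∫ s in Iic t, v s = ∫ s in (0 : ℝ)..t, ext v s := by
  have h := unitInterval.measurePreserving_coe.setIntegral_image_emb
    unitInterval.measurableEmbedding_coe (ext v) (Iic t)
  rw [Measure.restrict_restrict_of_subset (image_subset_iff.2 fun s _ => s.2)] at h
  simp only [ext_coe] at h
  rw [← h, image_subtype_val_Icc_Iic, integral_Icc_eq_integral_Ioc,
    intervalIntegral.integral_of_le t.2.1]

theorem absolutelyContinuous_const_add_integral {V : ℝ → ℝ}
    (hV : IntervalIntegrable V volume 0 1) (a : ℝ) :
    AbsolutelyContinuousOnInterval (fun t => a + ∫ s in (0 : ℝ)..t, V s) 0 1 := by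
  refine AbsolutelyContinuousOnInterval.add (f := fun _ => a) ?_
    (hV.absolutelyContinuousOnInterval_intervalIntegral (by simp))
  exact (LipschitzWith.const a).lipschitzOnWith.absolutelyContinuousOnInterval

theorem ae_deriv_const_add_integral {V : ℝ → ℝ}
    (hV : IntervalIntegrable V volume 0 1) (a : ℝ) :
    ∀ᵐ t : ℝ, t ∈ uIcc (0 : ℝ) 1 → HasDerivAt (fun t => a + ∫ s in (0 : ℝ)..t, V s) (V t) t := by
  filter_upwards [hV.ae_hasDerivAt_integral] with t ht h
  exact (ht h 0 (by simp)).const_add a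

/-- Since `v` is only integrable, its primitive is differentiable only almost everywhere; the
integration by parts is the one for absolutely continuous functions. -/
theorem integral_deriv_mul_prim {v : I → ℝ} (hv : Integrable v) (a : ℝ) {g : ℝ → ℝ}
    (hg : ContDiff ℝ 1 g) :
    ∫ t : I, deriv g t * (a + ∫ s in Iic t, v s) =
      g 1 * (a + ∫ s, v s) - g 0 * a - ∫ t : I, g t * v t := by
  have hV := intervalIntegrable_ext hv
  have hW := absolutelyContinuous_const_add_integral hV a
  have hgA : AbsolutelyContinuousOnInterval g 0 1 :=
    hg.contDiffOn.absolutelyContinuousOnInterval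
  have h1 : ∫ s, v s = ∫ s in (0 : ℝ)..1, ext v s := by
    rw [← integral_unitInterval]; simp only [ext_coe]
  have h2 : ∫ t : I, g t * v t = ∫ s in (0 : ℝ)..1, g s * ext v s := by
    rw [← integral_unitInterval]; simp only [ext_coe]
  have key := hgA.integral_mul_deriv_eq_deriv_mul hW
  have h3 : ∫ t in (0 : ℝ)..1, g t * deriv (fun t => a + ∫ s in (0 : ℝ)..t, ext v s) t =
      ∫ s in (0 : ℝ)..1, g s * ext v s := by
    apply intervalIntegral.integral_congr_ae
    filter_upwards [ae_deriv_const_add_integral hV a] with t ht h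
    rw [(ht (uIoc_subset_uIcc h)).deriv]
  rw [h3] at key
  simp only [setIntegral_Iic]
  rw [integral_unitInterval (fun t => deriv g t * (a + ∫ s in (0 : ℝ)..t, ext v s)), h1, h2, key]
  simp

/-- The square of an absolutely continuous function is absolutely continuous, with derivative given
by the product rule almost everywhere. This is the one-dimensional form of `∂ₜ(u²) = 2 u u̇`. -/
theorem integral_deriv_mul_prim_sq {v : I → ℝ} (hv : Integrable v) (a : ℝ) {g : ℝ → ℝ}
    (hg : ContDiff ℝ 1 g) :
    ∫ t : I, deriv g t * (a + ∫ s in Iic t, v s) ^ 2 =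
      g 1 * (a + ∫ s, v s) ^ 2 - g 0 * a ^ 2
        - ∫ t : I, g t * (2 * (a + ∫ s in Iic t, v s) * v t) := by
  have hV := intervalIntegrable_ext hv
  have hW := absolutelyContinuous_const_add_integral hV a
  have hW2 := hW.fun_mul hW
  have hgA : AbsolutelyContinuousOnInterval g 0 1 :=
    hg.contDiffOn.absolutelyContinuousOnInterval
  have h1 : ∫ s, v s = ∫ s in (0 : ℝ)..1, ext v s := by
    rw [← integral_unitInterval]; simp only [ext_coe]
  have h2 : ∫ t : I, g t * (2 * (a + ∫ s in Iic t, v s) * v t) =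
      ∫ t in (0 : ℝ)..1, g t * (2 * (a + ∫ s in (0 : ℝ)..t, ext v s) * ext v t) := by
    rw [← integral_unitInterval]; simp only [ext_coe, setIntegral_Iic]
  have key := hgA.integral_mul_deriv_eq_deriv_mul hW2
  have h3 : ∫ t in (0 : ℝ)..1, g t * deriv (fun t => (a + ∫ s in (0 : ℝ)..t, ext v s) *
        (a + ∫ s in (0 : ℝ)..t, ext v s)) t =
      ∫ t in (0 : ℝ)..1, g t * (2 * (a + ∫ s in (0 : ℝ)..t, ext v s) * ext v t) := by
    apply intervalIntegral.integral_congr_ae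
    filter_upwards [ae_deriv_const_add_integral hV a] with t ht h
    have := ht (uIoc_subset_uIcc h)
    rw [(this.fun_mul this).deriv]
    ring
  rw [h3] at key
  rw [h2, key, h1]
  simp only [setIntegral_Iic]
  rw [integral_unitInterval (fun t => deriv g t * (a + ∫ s in (0 : ℝ)..t, ext v s) ^ 2)]
  simp [sq]

/-! ### Test functions of time and the du Bois-Reymond lemma. -/

/-- Smooth functions with compact support in `(0,1)`. -/
structure IsTest (θ : ℝ → ℝ) : Prop where
  smooth : ContDiff ℝ ∞ θ
  compact : HasCompactSupport θ
  supp : tsupport θ ⊆ Ioo 0 1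

theorem IsTest.eq_zero {θ : ℝ → ℝ} (h : IsTest θ) {t : ℝ} (ht : t ∉ Ioo (0 : ℝ) 1) : θ t = 0 :=
  image_eq_zero_of_notMem_tsupport fun h' => ht (h.supp h')

theorem IsTest.exists_Icc {θ : ℝ → ℝ} (h : IsTest θ) :
    ∃ a b, 0 < a ∧ b < 1 ∧ ∀ t, t ∉ Icc a b → θ t = 0 := by
  rcases (tsupport θ).eq_empty_or_nonempty with h0 | h0
  · refine ⟨1 / 2, 1 / 2, by norm_num, by norm_num, fun t _ =>
      image_eq_zero_of_notMem_tsupport (by simp [h0])⟩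
  · have hc : IsCompact (tsupport θ) := h.compact
    obtain ⟨a, ha, ha'⟩ := hc.exists_isLeast h0
    obtain ⟨b, hb, hb'⟩ := hc.exists_isGreatest h0
    exact ⟨a, b, (h.supp ha).1, (h.supp hb).2, fun t ht =>
      image_eq_zero_of_notMem_tsupport fun h' => ht ⟨ha' h', hb' h'⟩⟩

theorem isTest_of_Icc {θ : ℝ → ℝ} (h : ContDiff ℝ ∞ θ) {a b : ℝ} (ha : 0 < a) (hb : b < 1)
    (h0 : ∀ t, t ∉ Icc a b → θ t = 0) : IsTest θ := by
  have : tsupport θ ⊆ Icc a b :=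
    closure_minimal (fun t ht => by_contra fun h' => ht (h0 t h')) isClosed_Icc
  exact ⟨h, HasCompactSupport.of_support_subset_isCompact isCompact_Icc
    (subset_closure.trans this), this.trans (Icc_subset_Ioo ha hb)⟩

/-- The primitive starting at `0` vanishes to the left of the support, and the zero mean makes it
vanish to the right as well. -/
theorem IsTest.exists_prim {ψ : ℝ → ℝ} (h : IsTest ψ) (h0 : ∫ t in (0 : ℝ)..1, ψ t = 0) :
    ∃ θ, IsTest θ ∧ ∀ t, deriv θ t = ψ t := by
  obtain ⟨a, b, ha, hb, hab⟩ := h.exists_Icc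
  have hψ : Continuous ψ := h.smooth.continuous
  have hd : ∀ t, HasDerivAt (fun t => ∫ s in (0 : ℝ)..t, ψ s) (ψ t) t := fun t =>
    intervalIntegral.integral_hasDerivAt_right (hψ.intervalIntegrable _ _)
      (hψ.stronglyMeasurableAtFilter _ _) hψ.continuousAt
  have hd' : deriv (fun t => ∫ s in (0 : ℝ)..t, ψ s) = ψ := funext fun t => (hd t).deriv
  refine ⟨fun t => ∫ s in (0 : ℝ)..t, ψ s, isTest_of_Icc (a := a) (b := b) ?_ ha hb ?_,
    fun t => (hd t).deriv⟩
  · rw [contDiff_infty_iff_deriv, hd']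
    exact ⟨fun t => (hd t).differentiableAt, h.smooth⟩
  · intro t ht
    rw [mem_Icc, not_and_or, not_le, not_le] at ht
    rcases ht with ht | ht
    · rw [intervalIntegral.integral_congr (g := fun _ => 0)]
      · simp
      · intro s hs
        refine hab s fun hs' => ?_
        have := hs.2
        rw [le_max_iff] at this
        rcases this with h | h <;> linarith [hs'.1]
    · have : ∫ s in (1 : ℝ)..t, ψ s = 0 := by
        rw [intervalIntegral.integral_congr (g := fun _ => 0)]
        · simp
        · intro s hs
          refine hab s fun hs' => ?_
          have := hs.1
          rw [min_le_iff] at this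
          rcases this with h | h <;> linarith [hs'.2]
      rw [← intervalIntegral.integral_add_adjacent_intervals (b := 1)
        (hψ.intervalIntegrable _ _) (hψ.intervalIntegrable _ _), h0, this, add_zero]

theorem IsTest.sub_const_mul {ψ χ : ℝ → ℝ} (h : IsTest ψ) (h' : IsTest χ) (c : ℝ) :
    IsTest fun t => ψ t - c * χ t := by
  obtain ⟨a, b, ha, hb, hab⟩ := h.exists_Icc
  obtain ⟨a', b', ha', hb', hab'⟩ := h'.exists_Icc
  refine isTest_of_Icc (a := min a a') (b := max b b') ?_ (lt_min ha ha') (max_lt hb hb')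
    fun t ht => ?_
  · exact h.smooth.sub (contDiff_const.mul h'.smooth)
  · rw [mem_Icc, not_and_or, not_le, not_le, lt_min_iff, max_lt_iff] at ht
    rw [hab t fun h => ?_, hab' t fun h => ?_]
    · simp
    · rcases ht with ht | ht <;> linarith [h.1, h.2]
    · rcases ht with ht | ht <;> linarith [h.1, h.2]

theorem exists_isTest_integral_eq_one : ∃ χ, IsTest χ ∧ ∫ t in (0 : ℝ)..1, χ t = 1 := by
  let φ : ContDiffBump (1 / 2 : ℝ) := ⟨1 / 8, 1 / 4, by norm_num, by norm_num⟩
  have h0 : ∀ t, t ∉ Icc (1 / 4 : ℝ) (3 / 4) → φ.normed volume t = 0 := by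
    intro t ht
    refine image_eq_zero_of_notMem_tsupport fun h => ht ?_
    rw [φ.tsupport_normed_eq, Real.closedBall_eq_Icc] at h
    exact ⟨by have := h.1; norm_num [φ] at this ⊢; linarith,
      by have := h.2; norm_num [φ] at this ⊢; linarith⟩
  refine ⟨φ.normed volume, isTest_of_Icc φ.contDiff_normed (by norm_num) (by norm_num) h0, ?_⟩
  rw [intervalIntegral.integral_of_le zero_le_one, setIntegral_eq_integral_of_forall_compl_eq_zero,
    φ.integral_normed]
  intro t ht
  refine h0 t fun h => ht ⟨by linarith [h.1], by linarith [h.2]⟩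

theorem Integrable_mul_continuous_I {D : I → ℝ} (hD : Integrable D) {g : ℝ → ℝ}
    (hg : Continuous g) : Integrable fun t : I => D t * g t := by
  obtain ⟨C, hC⟩ := isCompact_univ.exists_bound_of_continuousOn
    (hg.comp continuous_subtype_val : Continuous fun t : I => g t).continuousOn
  exact hD.mul_bdd (by fun_prop) (Eventually.of_forall fun t => hC t (mem_univ t))

/-- **du Bois-Reymond's lemma** on the unit interval. -/
theorem ae_eq_const_of_integral_deriv {D : I → ℝ} (hD : Integrable D)
    (h : ∀ θ, IsTest θ → ∫ t : I, D t * deriv θ t = 0) : ∀ᵐ t, D t = ∫ s, D s := by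
  obtain ⟨χ, hχ, hχ1⟩ := exists_isTest_integral_eq_one
  set c := ∫ t : I, D t * χ t with hc
  have key : ∀ ψ, IsTest ψ → ∫ t : I, (D t - c) * ψ t = 0 := by
    intro ψ hψ
    set d := ∫ t in (0 : ℝ)..1, ψ t with hd
    -- Removing the multiple `d χ`, which has the same integral as `ψ`, leaves the derivative of a
    -- test function.
    obtain ⟨θ, hθ, hθ'⟩ := (hψ.sub_const_mul hχ d).exists_prim (by
      rw [intervalIntegral.integral_sub (hψ.smooth.continuous.intervalIntegrable _ _)
        ((hχ.smooth.continuous.const_mul d).intervalIntegrable _ _),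
        intervalIntegral.integral_const_mul, hχ1, mul_one, sub_self])
    have h1 := h θ hθ
    simp only [hθ'] at h1
    have e1 : ∀ t : I, D t * (ψ t - d * χ t) = D t * ψ t - d * (D t * χ t) := fun t => by ring
    have e2 : ∀ t : I, (D t - c) * ψ t = D t * ψ t - c * ψ t := fun t => by ring
    simp only [e1] at h1
    simp only [e2]
    have i1 := Integrable_mul_continuous_I hD hψ.smooth.continuous
    have i2 := Integrable_mul_continuous_I hD hχ.smooth.continuous
    have i3 := Integrable_mul_continuous_I (integrable_const c) hψ.smooth.continuous
    rw [integral_sub i1 (i2.const_mul d), integral_const_mul, ← hc] at h1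
    rw [integral_sub i1 i3, integral_const_mul, integral_unitInterval, ← hd]
    linarith
  -- The fundamental lemma of the calculus of variations is applied on the open interval `(0,1)` of
  -- the line, hence the extension of `D`.
  have hloc : LocallyIntegrableOn (fun s => ext D s - c) (Ioo 0 1) := by
    apply IntegrableOn.locallyIntegrableOn
    exact (integrableOn_ext hD).mono_set Ioo_subset_Icc_self |>.sub
      (integrableOn_const (by simp))
  have h0 := isOpen_Ioo.ae_eq_zero_of_integral_contDiff_smul_eq_zero hloc fun ψ h1 h2 h3 => by
    have := key ψ ⟨h1, h2, h3⟩
    simp only [← ext_coe D] at this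
    rw [integral_unitInterval (fun s => (ext D s - c) * ψ s),
      intervalIntegral.integral_of_le zero_le_one,
      setIntegral_eq_integral_of_forall_compl_eq_zero] at this
    · rw [← this]
      exact integral_congr_ae (Eventually.of_forall fun x => by simp [mul_comm])
    · intro t ht
      rw [IsTest.eq_zero ⟨h1, h2, h3⟩ fun h => ht ⟨h.1, h.2.le⟩, mul_zero]
  have h1 : ∀ᵐ x ∂(volume.restrict (Icc (0 : ℝ) 1)), ext D x - c = 0 := by
    rw [← Measure.restrict_congr_set (Ioo_ae_eq_Icc (a := (0 : ℝ)) (b := 1))]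
    rwa [ae_restrict_iff' measurableSet_Ioo]
  have h2 := unitInterval.measurePreserving_coe.quasiMeasurePreserving.ae h1
  simp only [ext_coe] at h2
  have h3 : ∫ s, D s = c := by
    rw [integral_congr_ae (g := fun _ => c) (h2.mono fun t ht => sub_eq_zero.1 ht)]
    simp
  rw [h3]
  exact h2.mono fun t ht => sub_eq_zero.1 ht

theorem integrable_setIntegral_Iic {v : I → ℝ} (hv : Integrable v) :
    Integrable fun t : I => ∫ s in Iic t, v s := by
  have hc : Continuous fun t : I => ∫ s in Iic t, v s := by
    simp only [setIntegral_Iic]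
    have := intervalIntegral.continuousOn_primitive_interval' (intervalIntegrable_ext hv)
      (left_mem_uIcc)
    rw [uIcc_of_le zero_le_one] at this
    exact continuousOn_iff_continuous_domRestrict.1 this
  exact hc.integrable_of_hasCompactSupport (HasCompactSupport.of_compactSpace _)

/-- The difference of `U` and the primitive of `V` has zero weak derivative, so it equals its mean.
-/
theorem ae_eq_prim_of_weakDeriv {U V : I → ℝ} (hU : Integrable U) (hV : Integrable V)
    (h : ∀ θ, IsTest θ → ∫ t : I, U t * deriv θ t = - ∫ t : I, V t * θ t) :
    ∀ᵐ t, U t = ((∫ s, U s) + ∫ s : I, V s * ((s : ℝ) - 1)) + ∫ s in Iic t, V s := by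
  have hW := integrable_setIntegral_Iic hV
  have h1 := ae_eq_const_of_integral_deriv (hU.sub hW) fun θ hθ => by
    have i := integral_deriv_mul_prim hV 0 (hθ.smooth.of_le (by simp))
    rw [hθ.eq_zero (by simp), hθ.eq_zero (t := 0) (by simp)] at i
    simp only [Pi.sub_apply, sub_mul]
    have hc : Continuous (deriv θ) := hθ.smooth.continuous_deriv (by simp)
    rw [integral_sub (Integrable_mul_continuous_I hU hc) (Integrable_mul_continuous_I hW hc),
      h θ hθ]
    simp only [zero_add, zero_mul, sub_zero, zero_sub, mul_comm] at i ⊢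
    rw [i]
    ring
  -- The mean of the primitive is computed by parts with the weight `s - 1`, which is where `subOne`
  -- comes from.
  have i := integral_deriv_mul_prim hV 0 (g := fun s => s - 1) (by fun_prop)
  simp only [deriv_sub_const, deriv_id'', one_mul, zero_add, sub_self, zero_mul, mul_zero,
    zero_sub] at i
  have e : ∫ s, (U - fun t => ∫ s in Iic t, V s) s =
      (∫ s, U s) + ∫ s : I, V s * ((s : ℝ) - 1) := by
    simp only [Pi.sub_apply]
    rw [integral_sub hU hW, i]
    simp [mul_comm]
  rw [e] at h1
  filter_upwards [h1] with t ht
  rw [← ht, Pi.sub_apply]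
  ring

/-! ### The continuous representative of an element of `H¹([0,1], L²)` -/

theorem hasDerivAt_timeDeriv {f : ℝ × ℝ → ℝ} (hf : ContDiff ℝ ∞ f) (z : Square) :
    HasDerivAt (fun s : ℝ => f (s, (z.2 : ℝ))) (timeDeriv f z) z.1 := by
  have h1 : HasFDerivAt f (fderiv ℝ f (toPlane z)) (toPlane z) :=
    (hf.differentiable (by simp)).differentiableAt.hasFDerivAt
  have h2 : HasDerivAt (fun s : ℝ => (s, (z.2 : ℝ))) (1, 0) (z.1 : ℝ) :=
    (hasDerivAt_id _).prodMk (hasDerivAt_const _ _)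
  exact h1.comp_hasDerivAt (z.1 : ℝ) h2

/-- A smooth cutoff function, equal to `1` on `[0,1]`. -/
def cutoff : ContDiffBump (0 : ℝ) := ⟨2, 3, by norm_num, by norm_num⟩

theorem cutoff_coe (x : I) : cutoff (x : ℝ) = 1 := by
  apply cutoff.one_of_mem_closedBall
  rw [Real.closedBall_eq_Icc]
  exact ⟨by have := x.2.1; norm_num [cutoff]; linarith, by have := x.2.2; norm_num [cutoff]; linarith⟩

/-- The test function `θ(t) P(x)`, cut off in space outside of the square. -/
def polyTest (θ : ℝ → ℝ) (P : Polynomial ℝ) (z : ℝ × ℝ) : ℝ := θ z.1 * (cutoff z.2 * P.eval z.2)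

/-- Cutting off in space gives compact support in the plane and changes nothing on the square.
Polynomials are enough in space, being dense in `C([0,1])` and in `L²`. -/
theorem isTimeTest_polyTest {θ : ℝ → ℝ} (h : IsTest θ) (P : Polynomial ℝ) :
    IsTimeTest (polyTest θ P) := by
  have hsub : Function.support (polyTest θ P) ⊆ tsupport θ ×ˢ tsupport cutoff := by
    intro z hz
    have hz' : θ z.1 * (cutoff z.2 * P.eval z.2) ≠ 0 := hz
    exact ⟨subset_closure fun h => hz' (by simp [h]), subset_closure fun h => hz' (by simp [h])⟩
  have hK : IsCompact (tsupport θ ×ˢ tsupport cutoff) :=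
    IsCompact.prod h.compact cutoff.hasCompactSupport
  refine ⟨?_, HasCompactSupport.of_support_subset_isCompact hK hsub, ?_⟩
  · have h1 : ContDiff ℝ ∞ fun z : ℝ × ℝ => θ z.1 := h.smooth.comp contDiff_fst
    have h2 : ContDiff ℝ ∞ fun z : ℝ × ℝ => cutoff z.2 := cutoff.contDiff.comp contDiff_snd
    have h3 : ContDiff ℝ ∞ fun z : ℝ × ℝ => P.eval z.2 :=
      by
      have := (P.contDiff_aeval (𝕜 := ℝ) ∞).comp (contDiff_snd (𝕜 := ℝ) (E := ℝ) (F := ℝ))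
      simpa [Polynomial.coe_aeval_eq_eval, Function.comp_def] using this
    exact h1.mul (h2.mul h3)
  · exact (closure_minimal hsub hK.isClosed).trans (prod_mono h.supp (subset_univ _))

theorem polyTest_toPlane (θ : ℝ → ℝ) (P : Polynomial ℝ) (z : Square) :
    polyTest θ P (toPlane z) = θ z.1 * P.eval (z.2 : ℝ) := by
  simp [polyTest, toPlane, cutoff_coe]

theorem timeDeriv_polyTest {θ : ℝ → ℝ} (h : IsTest θ) (P : Polynomial ℝ) (z : Square) :
    timeDeriv (polyTest θ P) z = deriv θ z.1 * P.eval (z.2 : ℝ) := by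
  refine (hasDerivAt_timeDeriv (isTimeTest_polyTest h P).1 z).unique ?_
  have h1 : HasDerivAt θ (deriv θ z.1) z.1 :=
    (h.smooth.differentiable (by simp)).differentiableAt.hasDerivAt
  have := h1.mul_const (P.eval (z.2 : ℝ))
  simpa [polyTest, cutoff_coe] using this

/-- A closed set of continuous functions on `[0,1]` containing the polynomials is everything. -/
theorem mem_of_polynomial {A : Set C(I, ℝ)} (hA : IsClosed A)
    (h : ∀ P : Polynomial ℝ, P.toContinuousMapOn I ∈ A) (f : C(I, ℝ)) : f ∈ A := by
  have hf : f ∈ (polynomialFunctions I).topologicalClosure := by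
    rw [polynomialFunctions_closure_eq_top]; trivial
  refine closure_minimal ?_ hA hf
  rintro _ ⟨P, _, rfl⟩
  exact h P

theorem eq_zero_of_polynomial {g : L2Space}
    (h : ∀ P : Polynomial ℝ, ∫ x, g x * P.eval (x : ℝ) = 0) : g = 0 := by
  have hd := ContinuousMap.toLp_denseRange ℝ (volume : Measure I) ℝ (p := 2) (by simp)
  have hin : ∀ f : C(I, ℝ), inner ℝ g (ContinuousMap.toLp 2 volume ℝ f) = 0 := by
    refine mem_of_polynomial (A := {f | inner ℝ g (ContinuousMap.toLp 2 volume ℝ f) = 0})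
      (isClosed_eq (by fun_prop) continuous_const) fun P => ?_
    refine (real_inner_L2 _ _).trans (Eq.trans ?_ (h P))
    refine integral_congr_ae ?_
    filter_upwards [ContinuousMap.coeFn_toLp (p := 2) (𝕜 := ℝ) volume (P.toContinuousMapOn I)]
      with x hx
    rw [hx]; rfl
  have : (fun f : L2Space => inner ℝ g f) = fun _ => 0 :=
    hd.equalizer (by fun_prop) continuous_const (funext hin)
  exact inner_self_eq_zero.1 (congrFun this g)

theorem integrable_slice_left (u : L2Square) : ∀ᵐ x, Integrable fun t => u (t, x) :=
  Integrable.prod_left_ae (integrable_L2 u)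

theorem memLp_slice (u : L2Square) : ∀ᵐ t, MemLp (fun x => u (t, x)) 2 := by
  have h : Integrable fun z : Square => u z ^ 2 := integrable_sq_L2 u
  filter_upwards [Integrable.prod_right_ae h] with t ht
  rw [memLp_two_iff_integrable_sq]
  · exact ht
  · exact ((Lp.stronglyMeasurable u).comp_measurable measurable_prodMk_left).aestronglyMeasurable

theorem ae_ae_square {p : Square → Prop} (h : ∀ᵐ z, p z) : ∀ᵐ t, ∀ᵐ x, p (t, x) :=
  Measure.ae_ae_of_ae_prod h

theorem ae_ae_square_symm {p : Square → Prop} (h : ∀ᵐ z, p z) : ∀ᵐ x, ∀ᵐ t, p (t, x) := by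
  have h' : ∀ᵐ z : Square, p z.swap :=
    (Measure.measurePreserving_swap (μ := (volume : Measure I))
      (ν := (volume : Measure I))).quasiMeasurePreserving.ae h
  exact ae_ae_square h'

theorem integral_mul_slice (k h : L2Space) (u : L2Square) :
    ∫ s, k s * ∫ x, u (s, x) * h x = inner ℝ (timeAvg k u) h := by
  rw [inner_timeAvg, integral_square (integrable_tensor_mul k h u)]
  refine integral_congr_ae (Eventually.of_forall fun s => ?_)
  simp only
  rw [← integral_const_mul]
  exact integral_congr_ae (Eventually.of_forall fun x => by ring)

/-- The right side has the form of the conclusion of `ae_eq_prim_of_weakDeriv` for the scalar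
functions `s ↦ ∫ u(s,x) h(x) dx` and `s ↦ ∫ v(s,x) h(x) dx`. -/
theorem inner_evalAt (t : I) (u v : L2Square) (h : L2Space) :
    inner ℝ (evalAt t u v) h =
      ((∫ s, ∫ x, u (s, x) * h x) + ∫ s : I, (∫ x, v (s, x) * h x) * ((s : ℝ) - 1)) +
        ∫ s in Iic t, ∫ x, v (s, x) * h x := by
  rw [evalAt, initVal, inner_add_left, inner_add_left, ← integral_mul_slice, ← integral_mul_slice,
    ← integral_mul_slice]
  refine congr_arg₂ _ (congr_arg₂ _ ?_ ?_) ?_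
  · refine integral_congr_ae ?_
    filter_upwards [coeFn_ind_one] with s hs
    rw [hs, one_mul]
  · refine integral_congr_ae ?_
    filter_upwards [coeFn_subOne] with s hs
    rw [hs, mul_comm]
  · rw [← integral_indicator measurableSet_Iic]
    refine integral_congr_ae ?_
    filter_upwards [coeFn_ind t] with s hs
    rw [hs]
    by_cases h : s ∈ Iic t <;> simp [h]

theorem integrable_mul_snd (u : L2Square) (h : L2Space) :
    Integrable fun z : Square => u z * h z.2 := by
  refine (integrable_tensor_mul (ind 1) h u).congr ?_
  filter_upwards [ae_fst coeFn_ind_one] with z hz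
  rw [hz, one_mul]

/-- Pairing with a fixed monomial in `x` reduces the claim to a scalar weak derivative. Only
countably many monomials are needed, so one null set of times serves for all of them, and the
moments determine an `L²` function. -/
theorem isContinuousRep_evalAt {u v : L2Square} (huv : IsWeakTimeDeriv u v) :
    IsContinuousRep u fun t => evalAt t u v := by
  refine ⟨continuous_evalAt u v, ?_⟩
  have hmon : ∀ n : ℕ, ∀ᵐ t, ∫ x : I, u (t, x) * (x : ℝ) ^ n =
      ∫ x : I, evalAt t u v x * (x : ℝ) ^ n := by
    intro n
    have hm : MemLp (fun x : I => (x : ℝ) ^ n) 2 volume :=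
      MemLp.of_bound (by fun_prop) 1 (Eventually.of_forall fun x => by
        rw [Real.norm_eq_abs, abs_of_nonneg (pow_nonneg x.2.1 _)]
        exact pow_le_one₀ x.2.1 x.2.2)
    set h : L2Space := hm.toLp _ with hh
    have hc : h =ᵐ[volume] fun x : I => (x : ℝ) ^ n := hm.coeFn_toLp
    have hcs : ∀ (w : I → ℝ), ∫ x, w x * h x = ∫ x : I, w x * (x : ℝ) ^ n := fun w =>
      integral_congr_ae (hc.mono fun x hx => by simp only [hx])
    have hU : Integrable fun t => ∫ x, u (t, x) * h x :=
      (integrable_mul_snd u h).integral_prod_left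
    have hV : Integrable fun t => ∫ x, v (t, x) * h x :=
      (integrable_mul_snd v h).integral_prod_left
    have key := ae_eq_prim_of_weakDeriv hU hV fun θ hθ => by
      have h1 := huv _ (isTimeTest_polyTest hθ (Polynomial.X ^ n))
      simp only [timeDeriv_polyTest hθ, polyTest_toPlane] at h1
      rw [integral_square, integral_square] at h1
      · simp only [hcs, ← integral_mul_const]
        simp only [Polynomial.eval_pow, Polynomial.eval_X] at h1
        simp only [mul_assoc, mul_comm ((_ : ℝ) ^ n)]
        exact h1
      · exact integrable_mul_continuous v (g := fun z => θ z.1 * (Polynomial.X ^ n).eval (z.2 : ℝ))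
          ((hθ.smooth.continuous.comp (by fun_prop)).mul
            ((Polynomial.continuous _).comp (by fun_prop)))
      · exact integrable_mul_continuous u
          (g := fun z => deriv θ z.1 * (Polynomial.X ^ n).eval (z.2 : ℝ))
          (((hθ.smooth.continuous_deriv (by simp)).comp (by fun_prop)).mul
            ((Polynomial.continuous _).comp (by fun_prop)))
    filter_upwards [key] with t ht
    rw [← inner_evalAt, real_inner_L2, hcs, hcs] at ht
    exact ht
  filter_upwards [ae_all_iff.2 hmon, memLp_slice u] with t ht hu
  have hz : evalAt t u v - hu.toLp _ = 0 := by
    apply eq_zero_of_polynomial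
    intro P
    have hi : ∀ (w : L2Space) (n : ℕ), Integrable fun x : I => w x * (x : ℝ) ^ n := fun w n => by
      have := Integrable_mul_continuous_I (integrable_L2 w) (continuous_pow n)
      exact this
    have hsub : ∀ n : ℕ, ∫ x : I, (evalAt t u v - hu.toLp _ : L2Space) x * (x : ℝ) ^ n = 0 := by
      intro n
      have e : ∀ᵐ x : I, (evalAt t u v - hu.toLp _ : L2Space) x * (x : ℝ) ^ n =
          evalAt t u v x * (x : ℝ) ^ n - hu.toLp _ x * (x : ℝ) ^ n := by
        filter_upwards [Lp.coeFn_sub (evalAt t u v) (hu.toLp _)] with x hx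
        rw [hx, Pi.sub_apply, sub_mul]
      rw [integral_congr_ae e, integral_sub (hi _ n) (hi _ n), ← ht n, sub_eq_zero]
      refine integral_congr_ae ?_
      filter_upwards [hu.coeFn_toLp] with x hx
      rw [hx]
    have e : ∀ x : I, (evalAt t u v - hu.toLp _ : L2Space) x * P.eval (x : ℝ) =
        ∑ n ∈ Finset.range (P.natDegree + 1),
          P.coeff n * ((evalAt t u v - hu.toLp _ : L2Space) x * (x : ℝ) ^ n) := fun x => by
      rw [Polynomial.eval_eq_sum_range, Finset.mul_sum]
      exact Finset.sum_congr rfl fun n _ => by ring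
    simp only [e]
    rw [integral_finsetSum _ fun n _ => (hi _ n).const_mul _]
    exact Finset.sum_eq_zero fun n _ => by rw [integral_const_mul, hsub n, mul_zero]
  rw [sub_eq_zero.1 hz]
  exact hu.coeFn_toLp

/-- Lebesgue measure charges every nonempty open subset of `[0,1]`, so continuous functions equal
almost everywhere are equal. This allows arbitrary representatives to be replaced by the explicit
`evalAt`. -/
theorem IsContinuousRep.unique {u : L2Square} {c c' : I → L2Space} (h : IsContinuousRep u c)
    (h' : IsContinuousRep u c') : c = c' := by
  have : (volume : Measure I).IsOpenPosMeasure := by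
    refine ⟨fun U hU hne h0 => ?_⟩
    obtain ⟨V, hV, rfl⟩ := isOpen_induced_iff.1 hU
    obtain ⟨x, hx⟩ := hne
    have hx1 : (x : ℝ) ∈ closure (Ioo (0 : ℝ) 1) := by
      rw [closure_Ioo zero_ne_one]; exact x.2
    obtain ⟨y, hyV, hy⟩ := mem_closure_iff.1 hx1 V hV hx
    rw [unitInterval.volume_apply, Subtype.image_preimage_coe] at h0
    have := (hV.inter isOpen_Ioo).measure_pos volume ⟨y, hyV, hy⟩
    refine this.ne' (measure_mono_null ?_ h0)
    rintro z ⟨hz, hz'⟩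
    exact ⟨Ioo_subset_Icc_self hz', hz⟩
  refine (Continuous.ae_eq_iff_eq volume h.1 h'.1).1 ?_
  filter_upwards [h.2, h'.2] with t h1 h2
  exact Lp.ext (h1.trans h2.symm)

theorem stronglyMeasurable_timePrim (a : L2Space) (v : L2Square) :
    StronglyMeasurable (timePrim a v) := by
  have hS : MeasurableSet {p : Square × I | p.2 ≤ p.1.1} :=
    measurableSet_le measurable_snd (measurable_fst.comp measurable_fst)
  have h1 : StronglyMeasurable fun p : Square × I =>
      {p : Square × I | p.2 ≤ p.1.1}.indicator (fun p => v (p.2, p.1.2)) p :=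
    ((Lp.stronglyMeasurable v).comp_measurable
      (measurable_snd.prodMk (measurable_snd.comp measurable_fst))).indicator hS
  have h2 := h1.integral_prod_right' (ν := (volume : Measure I))
  have h3 : (fun z : Square => ∫ s in Iic z.1, v (s, z.2)) = fun z => ∫ s : I,
      {p : Square × I | p.2 ≤ p.1.1}.indicator (fun p => v (p.2, p.1.2)) (z, s) := by
    funext z
    rw [← integral_indicator measurableSet_Iic]
    rfl
  refine ((Lp.stronglyMeasurable a).comp_measurable measurable_snd).add ?_
  rw [h3]
  exact h2

/-- The equality is known for almost every `x` at almost every `t`. Measurability of the agreement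
set turns this into an almost everywhere statement on the square, which can then be sliced at fixed
`x`. -/
theorem ae_eq_timePrim {u v : L2Square} (huv : IsWeakTimeDeriv u v) :
    ∀ᵐ z, u z = timePrim (initVal u v) v z := by
  have hm : MeasurableSet {z | u z = timePrim (initVal u v) v z} :=
    measurableSet_eq_fun (Lp.stronglyMeasurable u).measurable
      (stronglyMeasurable_timePrim _ _).measurable
  refine (Measure.ae_prod_mem_iff_ae_ae_mem hm).2 ?_
  filter_upwards [(isContinuousRep_evalAt huv).2] with t ht
  filter_upwards [ht, coeFn_evalAt t u v] with x h1 h2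
  rw [← h1, h2]

theorem integrable_sq_mul_continuous (u : L2Square) {g : Square → ℝ} (hg : Continuous g) :
    Integrable fun z : Square => g z * u z ^ 2 := by
  obtain ⟨C, hC⟩ := isCompact_univ.exists_bound_of_continuousOn hg.continuousOn
  exact (integrable_sq_L2 u).bdd_mul hg.aestronglyMeasurable
    (Eventually.of_forall fun z => hC z (mem_univ z))

theorem integrable_mul_mul_continuous (u v : L2Square) {g : Square → ℝ} (hg : Continuous g) :
    Integrable fun z : Square => g z * (2 * u z * v z) := by
  obtain ⟨C, hC⟩ := isCompact_univ.exists_bound_of_continuousOn hg.continuousOn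
  simp only [mul_assoc]
  exact ((integrable_mul_L2 u v).const_mul 2).bdd_mul hg.aestronglyMeasurable
    (Eventually.of_forall fun z => hC z (mem_univ z))

theorem IsTimeTest.apply_eq_zero {f : ℝ × ℝ → ℝ} (hf : IsTimeTest f) {t x : ℝ}
    (ht : t ∉ Ioo (0 : ℝ) 1) : f (t, x) = 0 :=
  image_eq_zero_of_notMem_tsupport fun h => ht (hf.2.2 h).1

/-- The weak time derivative of `u²` is `2 u u̇`. -/
theorem integral_timeDeriv_mul_sq {u v : L2Square} (huv : IsWeakTimeDeriv u v) {f : ℝ × ℝ → ℝ}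
    (hf : IsTimeTest f) :
    ∫ z, timeDeriv f z * u z ^ 2 = - ∫ z, f (toPlane z) * (2 * u z * v z) := by
  rw [integral_square_symm (integrable_sq_mul_continuous u hf.continuous_timeDeriv),
    integral_square_symm (integrable_mul_mul_continuous u v hf.continuous_comp), ← integral_neg]
  refine integral_congr_ae ?_
  -- For almost every `x`, the function `u(·,x)` agrees almost everywhere with a primitive of
  -- `v(·,x)`, so the scalar product rule applies line by line.
  filter_upwards [ae_ae_square_symm (ae_eq_timePrim huv), integrable_slice_left v] with x hx hv
  have hg : ContDiff ℝ 1 fun s : ℝ => f (s, (x : ℝ)) :=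
    (hf.1.of_le (by simp)).comp (contDiff_id.prodMk contDiff_const)
  have key := integral_deriv_mul_prim_sq hv (initVal u v x) hg
  rw [hf.apply_eq_zero (by simp), hf.apply_eq_zero (by simp)] at key
  simp only [zero_mul, sub_zero, zero_sub] at key
  have e1 : ∫ t : I, timeDeriv f (t, x) * u (t, x) ^ 2 = ∫ t : I, deriv (fun s : ℝ => f (s, (x : ℝ)))
      t * (initVal u v x + ∫ s in Iic t, v (s, x)) ^ 2 := by
    refine integral_congr_ae ?_
    filter_upwards [hx] with t ht
    rw [ht, timePrim, (hasDerivAt_timeDeriv hf.1 (t, x)).deriv]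
  rw [e1, key]
  congr 1
  refine integral_congr_ae ?_
  filter_upwards [hx] with t ht
  rw [ht, timePrim, toPlane]

/-! ### Duality for the Fisher-Rao functional -/

theorem integrable_of_continuous {X : Type*} [TopologicalSpace X] [CompactSpace X]
    [MeasurableSpace X] [OpensMeasurableSpace X] (m : Measure X) [IsFiniteMeasure m] {f : X → ℝ}
    (hf : Continuous f) : Integrable f m :=
  hf.integrable_of_hasCompactSupport (HasCompactSupport.of_compactSpace _)

theorem Integrable.mul_continuous {X : Type*} [TopologicalSpace X] [CompactSpace X]
    [MeasurableSpace X] [OpensMeasurableSpace X] {m : Measure X} {u f : X → ℝ}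
    (hu : Integrable u m) (hf : Continuous f) : Integrable (fun z => f z * u z) m := by
  obtain ⟨C, hC⟩ := isCompact_univ.exists_bound_of_continuousOn hf.continuousOn
  exact hu.bdd_mul hf.aestronglyMeasurable (Eventually.of_forall fun z => hC z (mem_univ z))

theorem signedIntegral_eq_rnDeriv {τ : SignedMeasure Square} {m : Measure Square}
    [IsFiniteMeasure m] (hτ : τ.totalVariation ≪ m) {f : Square → ℝ} (hf : Continuous f) :
    signedIntegral τ f = ∫ z, f z * τ.rnDeriv m z ∂m := by
  have hp : τ.toJordanDecomposition.posPart ≪ m :=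
    (Measure.absolutelyContinuous_of_le (Measure.le_add_right le_rfl)).trans hτ
  have hn : τ.toJordanDecomposition.negPart ≪ m :=
    (Measure.absolutelyContinuous_of_le (Measure.le_add_left le_rfl)).trans hτ
  rw [signedIntegral, ← integral_rnDeriv_smul hp, ← integral_rnDeriv_smul hn, ← integral_sub]
  · simp only [SignedMeasure.rnDeriv_def, smul_eq_mul]
    exact integral_congr_ae (Eventually.of_forall fun z => by ring)
  · simp only [smul_eq_mul]
    exact (Integrable.mul_continuous Measure.integrable_toReal_rnDeriv hf).congr
      (Eventually.of_forall fun z => mul_comm _ _)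
  · simp only [smul_eq_mul]
    exact (Integrable.mul_continuous Measure.integrable_toReal_rnDeriv hf).congr
      (Eventually.of_forall fun z => mul_comm _ _)

theorem signedIntegral_withDensity {m : Measure Square} [IsFiniteMeasure m] {y : Square → ℝ}
    (hy : Integrable y m) {f : Square → ℝ} (hf : Continuous f) :
    signedIntegral (m.withDensityᵥ y) f = ∫ z, f z * y z ∂m := by
  have hac : SignedMeasure.totalVariation (m.withDensityᵥ y) ≪ m := by
    have := Measure.withDensityᵥ_absolutelyContinuous m y
    rwa [SignedMeasure.absolutelyContinuous_ennreal_iff,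
      VectorMeasure.ennrealToMeasure_toENNRealVectorMeasure] at this
  have h := SignedMeasure.eq_rnDeriv (s := m.withDensityᵥ y) 0 y hy
    VectorMeasure.MutuallySingular.zero_left (zero_add _).symm
  rw [signedIntegral_eq_rnDeriv hac hf]
  refine integral_congr_ae ?_
  filter_upwards [h] with z hz
  rw [hz]

theorem signedIntegral_add (τ : SignedMeasure Square) {f g : Square → ℝ} (hf : Continuous f)
    (hg : Continuous g) :
    signedIntegral τ (fun z => f z + g z) = signedIntegral τ f + signedIntegral τ g := by
  rw [signedIntegral, signedIntegral, signedIntegral,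
    integral_add (integrable_of_continuous _ hf) (integrable_of_continuous _ hg),
    integral_add (integrable_of_continuous _ hf) (integrable_of_continuous _ hg)]
  ring

theorem signedIntegral_const_mul (τ : SignedMeasure Square) (c : ℝ) (f : Square → ℝ) :
    signedIntegral τ (fun z => c * f z) = c * signedIntegral τ f := by
  rw [signedIntegral, signedIntegral, integral_const_mul, integral_const_mul]
  ring

/-- The dual form of `FR(m, L) ≼ n` for a linear form `L` on continuous functions: the quadratic
form `∫ g² dm - L(gh) + ∫ h² dn` is nonnegative. -/
def Dominates (m n : Measure Square) (L : C(Square, ℝ) →ₗ[ℝ] ℝ) : Prop :=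
  ∀ g h : C(Square, ℝ), L (g * h) ≤ (∫ z, g z ^ 2 ∂m) + ∫ z, h z ^ 2 ∂n

/-- Integration against a signed measure, as a linear form. -/
def signedIntegralL (τ : SignedMeasure Square) : C(Square, ℝ) →ₗ[ℝ] ℝ where
  toFun f := signedIntegral τ f
  map_add' f g := signedIntegral_add τ f.continuous g.continuous
  map_smul' c f := signedIntegral_const_mul τ c f

theorem measurable_rFun : Measurable fun p : ℝ × ℝ => rFun p.1 p.2 := by
  unfold rFun
  refine Measurable.ite (measurableSet_lt measurable_const measurable_fst) (by fun_prop)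
    (Measurable.ite ?_ measurable_const measurable_const)
  exact (measurableSet_eq_fun measurable_fst measurable_const).inter
    (measurableSet_eq_fun measurable_snd measurable_const)

/-- Completing the square: for `x > 0` the difference of the two sides is `(2gx - hy)² / (4x)`. -/
theorem mul_le_add_rFun {x y : ℝ} (hr : rFun x y ≠ ⊤) (g h : ℝ) :
    g * h * y ≤ g ^ 2 * x + h ^ 2 * (rFun x y).toReal := by
  unfold rFun at hr ⊢
  split_ifs at hr ⊢ with h1 h2
  · rw [ENNReal.toReal_ofReal (by positivity)]
    have : g ^ 2 * x + h ^ 2 * (y ^ 2 / (4 * x)) - g * h * y =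
        (2 * g * x - h * y) ^ 2 / (4 * x) := by
      field_simp; ring
    have h3 : 0 ≤ (2 * g * x - h * y) ^ 2 / (4 * x) := by positivity
    linarith
  · simp [h2.1, h2.2]
  · exact absurd rfl hr

theorem dominates_of_fisherRao_le {m n : Measure Square} [IsFiniteMeasure m] [IsFiniteMeasure n]
    {τ : SignedMeasure Square}
    (hτ : ∀ f : C(Square, ℝ), (∀ z, 0 < f z) → fisherRao f m τ ≤ ∫⁻ z, ENNReal.ofReal (f z) ∂n) :
    Dominates m n (signedIntegralL τ) := by
  intro g h
  set l := m + τ.totalVariation with hl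
  have : IsFiniteMeasure l := by rw [hl]; infer_instance
  have : m.HaveLebesgueDecomposition l := Measure.haveLebesgueDecomposition_of_finiteMeasure
  have hm : m ≪ l := Measure.absolutelyContinuous_of_le (Measure.le_add_right le_rfl)
  have ht : τ.totalVariation ≪ l := Measure.absolutelyContinuous_of_le (Measure.le_add_left le_rfl)
  set x : Square → ℝ := fun z => (m.rnDeriv l z).toReal with hx
  set y : Square → ℝ := τ.rnDeriv l with hy
  have hyi : Integrable y l := SignedMeasure.integrable_rnDeriv _ _
  have hxi : Integrable x l := Measure.integrable_toReal_rnDeriv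
  have hxm : Measurable x := (Measure.measurable_rnDeriv _ _).ennreal_toReal
  have hym : Measurable y := SignedMeasure.measurable_rnDeriv _ _
  have hrm : Measurable fun z => rFun (x z) (y z) := measurable_rFun.comp (hxm.prodMk hym)
  have e1 : signedIntegralL τ (g * h) = ∫ z, g z * h z * y z ∂l :=
    signedIntegral_eq_rnDeriv ht (g * h).continuous
  have e2 : ∫ z, g z ^ 2 ∂m = ∫ z, g z ^ 2 * x z ∂l := by
    rw [← integral_rnDeriv_smul hm]
    exact integral_congr_ae (Eventually.of_forall fun z => mul_comm _ _)
  have key : ∀ ε : ℝ, 0 < ε → signedIntegralL τ (g * h) ≤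
      (∫ z, g z ^ 2 ∂m) + ((∫ z, h z ^ 2 ∂n) + ε * n.real univ) := by
    intro ε hε
    -- The hypothesis concerns strictly positive weights only, while `h²` may vanish; `ε` is sent to
    -- `0` at the end.
    let f : C(Square, ℝ) := ⟨fun z => h z ^ 2 + ε, by fun_prop⟩
    have hf : ∀ z, 0 < f z := fun z => add_pos_of_nonneg_of_pos (sq_nonneg (h z)) hε
    have hfi : Integrable f n := integrable_of_continuous n f.continuous
    have hb := hτ f hf
    rw [← ofReal_integral_eq_lintegral_ofReal hfi (Eventually.of_forall fun z => (hf z).le)] at hb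
    have hFm : Measurable fun z => rFun (x z) (y z) * ENNReal.ofReal (f z) :=
      hrm.mul (by fun_prop)
    have htop : ∫⁻ z, rFun (x z) (y z) * ENNReal.ofReal (f z) ∂l ≠ ⊤ :=
      ne_top_of_le_ne_top ENNReal.ofReal_ne_top hb
    have hlt := ae_lt_top hFm htop
    have hRi := integrable_toReal_of_lintegral_ne_top hFm.aemeasurable htop
    have hR : ∫ z, (rFun (x z) (y z) * ENNReal.ofReal (f z)).toReal ∂l ≤ ∫ z, f z ∂n := by
      rw [integral_toReal hFm.aemeasurable hlt]
      exact ENNReal.toReal_le_of_le_ofReal (integral_nonneg fun z => (hf z).le) hb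
    have hfn : ∫ z, f z ∂n = (∫ z, h z ^ 2 ∂n) + ε * n.real univ := by
      have : ∫ z, f z ∂n = ∫ z, (h z ^ 2 + ε) ∂n := rfl
      rw [this, integral_add (integrable_of_continuous n (by fun_prop)) (integrable_const _)]
      simp [mul_comm]
    rw [← hfn]
    refine le_trans ?_ (add_le_add le_rfl hR)
    have hi2 : Integrable (fun z => g z ^ 2 * x z) l :=
      Integrable.mul_continuous hxi (g.continuous.pow 2)
    rw [e1, e2, ← integral_add hi2 hRi]
    refine integral_mono_ae (Integrable.mul_continuous hyi (g.continuous.mul h.continuous))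
      (hi2.add hRi) ?_
    filter_upwards [hlt] with z hz
    have hne : rFun (x z) (y z) ≠ ⊤ := by
      intro h
      rw [h, ENNReal.top_mul (by simpa using hf z)] at hz
      exact lt_irrefl _ hz
    refine (mul_le_add_rFun hne (g z) (h z)).trans ?_
    rw [ENNReal.toReal_mul, ENNReal.toReal_ofReal (hf z).le, mul_comm (ENNReal.toReal _)]
    have h1 : h z ^ 2 ≤ f z := le_add_of_nonneg_right hε.le
    gcongr
  have hlim : Tendsto (fun ε : ℝ => (∫ z, g z ^ 2 ∂m) + ((∫ z, h z ^ 2 ∂n) + ε * n.real univ))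
      (𝓝[>] 0) (𝓝 ((∫ z, g z ^ 2 ∂m) + ((∫ z, h z ^ 2 ∂n) + 0 * n.real univ))) := by
    refine Tendsto.mono_left (Continuous.tendsto ?_ 0) nhdsWithin_le_nhds
    fun_prop
  rw [zero_mul, add_zero] at hlim
  exact ge_of_tendsto hlim (eventually_mem_nhdsWithin.mono fun ε hε => key ε hε)

/-- Replacing `g` by `a g` gives a quadratic polynomial in `a` that is nonnegative everywhere, so
its discriminant is nonpositive. -/
theorem Dominates.sq_le {m n : Measure Square} {L : C(Square, ℝ) →ₗ[ℝ] ℝ}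
    (h : Dominates m n L) (g k : C(Square, ℝ)) :
    L (g * k) ^ 2 ≤ 4 * (∫ z, g z ^ 2 ∂m) * ∫ z, k z ^ 2 ∂n := by
  have := discrim_le_zero (a := ∫ z, g z ^ 2 ∂m) (b := - L (g * k)) (c := ∫ z, k z ^ 2 ∂n)
    fun a => by
      have := h (a • g) k
      simp only [ContinuousMap.coe_smul, Pi.smul_apply, smul_eq_mul, mul_pow,
        smul_mul_assoc, map_smul, integral_const_mul] at this
      nlinarith
  unfold discrim at this
  linarith

/-- A dominated linear form is given by a density in `L²(m)`. -/
theorem Dominates.exists_density {m n : Measure Square} [IsFiniteMeasure m] [IsFiniteMeasure n]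
    {L : C(Square, ℝ) →ₗ[ℝ] ℝ} (h : Dominates m n L) :
    ∃ y : Lp ℝ 2 m, (∀ g : C(Square, ℝ), L g = ∫ z, g z * y z ∂m) ∧
      ∀ f : C(Square, ℝ), (∀ z, 0 < f z) →
        ∫⁻ z, ENNReal.ofReal (y z ^ 2 / 4) * ENNReal.ofReal (f z) ∂m ≤
          ∫⁻ z, ENNReal.ofReal (f z) ∂n := by
  let e : C(Square, ℝ) →ₗ[ℝ] Lp ℝ 2 m := (ContinuousMap.toLp 2 m ℝ).toLinearMap
  have he : ∀ g : C(Square, ℝ), e g =ᵐ[m] g := fun g => ContinuousMap.coeFn_toLp m g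
  have hd : DenseRange e := ContinuousMap.toLp_denseRange ℝ m ℝ (p := 2) (by simp)
  have hnorm : ∀ g : C(Square, ℝ), ‖e g‖ ^ 2 = ∫ z, g z ^ 2 ∂m := fun g => by
    rw [norm_sq_L2]
    exact integral_congr_ae ((he g).mono fun z hz => by simp only [hz])
  -- Taking the second function equal to `1` shows that `L` is bounded for the `L²(m)` norm on the
  -- dense image of `C(D)`. It therefore extends and has a Riesz representative.
  have hb : ∀ g, ‖L g‖ ≤ 2 * √(n.real univ) * ‖e g‖ := fun g => by
    have h1 := h.sq_le g 1
    simp only [mul_one, ← hnorm, ContinuousMap.one_apply, one_pow, integral_const, smul_eq_mul]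
      at h1
    apply abs_le_of_sq_le_sq _ (by positivity)
    rw [mul_pow, mul_pow, Real.sq_sqrt measureReal_nonneg]
    linarith
  set l := L.extendOfNorm e with hl
  have hle : ∀ g, l (e g) = L g := LinearMap.extendOfNorm_eq hd ⟨_, hb⟩
  set y := (InnerProductSpace.toDual ℝ (Lp ℝ 2 m)).symm l with hy
  have hLy : ∀ g, L g = inner ℝ y (e g) := fun g => by
    rw [hy, InnerProductSpace.toDual_symm_apply, hle]
  have hint : ∀ (w : Lp ℝ 2 m) (g : C(Square, ℝ)),
      inner ℝ w (e g) = ∫ z, g z * w z ∂m := fun w g => by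
    rw [real_inner_L2]
    exact integral_congr_ae ((he g).mono fun z hz => by simp only [hz, mul_comm])
  refine ⟨y, fun g => by rw [hLy, hint], fun f hf => ?_⟩
  -- Choosing `h = √f` in the dual inequality turns `∫ h² dn` into `∫ f dn`.
  let s : C(Square, ℝ) := ⟨fun z => √(f z), by fun_prop⟩
  have hs : ∀ z, s z ^ 2 = f z := fun z => Real.sq_sqrt (hf z).le
  have hYm : MemLp (fun z => s z * y z) 2 m := by
    refine (memLp_two_iff_integrable_sq
      (s.continuous.aestronglyMeasurable.mul (Lp.aestronglyMeasurable y))).2 ?_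
    simp only [Pi.mul_apply, mul_pow]
    exact Integrable.mul_continuous (integrable_sq_L2 y) (s.continuous.pow 2)
  set Y := hYm.toLp _ with hY
  have hYc : Y =ᵐ[m] fun z => s z * y z := hYm.coeFn_toLp
  set N := ∫ z, f z ∂n with hN
  have h1 : ∀ G : Lp ℝ 2 m, inner ℝ Y G ≤ ‖G‖ ^ 2 + N := by
    intro G
    refine hd.induction_on (p := fun G => inner ℝ Y G ≤ ‖G‖ ^ 2 + N) G
      (isClosed_le (by fun_prop) (by fun_prop)) fun g => ?_
    have h2 := h g s
    simp only [hs] at h2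
    rw [hnorm, hint]
    refine le_trans (le_of_eq ?_) h2
    rw [hLy, hint]
    refine integral_congr_ae (hYc.mono fun z hz => ?_)
    simp only [hz, ContinuousMap.mul_apply]
    ring
  -- The choice `G = Y/2` maximizes `⟨Y, G⟩ - ‖G‖²`, with value `‖Y‖² / 4`; this is the origin of
  -- the factor `1/4` in `r`.
  have h2 := h1 ((1 / 2 : ℝ) • Y)
  rw [inner_smul_right, real_inner_self_eq_norm_sq, norm_smul, mul_pow] at h2
  norm_num at h2
  have h3 : ∫ z, y z ^ 2 / 4 * f z ∂m ≤ N := by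
    have : ∫ z, y z ^ 2 / 4 * f z ∂m = ‖Y‖ ^ 2 / 4 := by
      rw [norm_sq_L2, ← integral_div]
      refine integral_congr_ae (hYc.mono fun z hz => ?_)
      simp only [hz, mul_pow, hs]
      ring
    rw [this]; linarith
  have h4 : Integrable (fun z => y z ^ 2 / 4 * f z) m :=
    (Integrable.mul_continuous ((integrable_sq_L2 y).div_const 4) f.continuous).congr
      (Eventually.of_forall fun z => mul_comm _ _)
  have h5 := ENNReal.ofReal_le_ofReal h3
  rw [ofReal_integral_eq_lintegral_ofReal h4
    (Eventually.of_forall fun z => mul_nonneg (by positivity) (hf z).le), hN,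
    ofReal_integral_eq_lintegral_ofReal (integrable_of_continuous n f.continuous)
    (Eventually.of_forall fun z => (hf z).le)] at h5
  refine le_trans (le_of_eq (lintegral_congr fun z => ?_)) h5
  rw [ENNReal.ofReal_mul (by positivity)]

/-- By homogeneity: if `X` is the density of `m` with respect to the dominating measure, then that
of `y m` is `X y`, and `r(X, X y) = X y² / 4`. -/
theorem fisherRao_withDensity_le {m : Measure Square} [IsFiniteMeasure m] {y : Square → ℝ}
    (hm : Measurable y) (hy : Integrable y m) (f : C(Square, ℝ)) :
    fisherRao f m (m.withDensityᵥ y) ≤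
      ∫⁻ z, ENNReal.ofReal (y z ^ 2 / 4) * ENNReal.ofReal (f z) ∂m := by
  set τ : SignedMeasure Square := m.withDensityᵥ y with hτ
  rw [fisherRao]
  set l := m + τ.totalVariation with hl
  have : IsFiniteMeasure l := by rw [hl]; infer_instance
  have : m.HaveLebesgueDecomposition l := Measure.haveLebesgueDecomposition_of_finiteMeasure
  have hml : m ≪ l := Measure.absolutelyContinuous_of_le (Measure.le_add_right le_rfl)
  have hw : l.withDensity (m.rnDeriv l) = m := Measure.withDensity_rnDeriv_eq m l hml
  have hlt : ∀ᵐ z ∂l, m.rnDeriv l z < ⊤ := Measure.rnDeriv_lt_top m l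
  have hi : Integrable (fun z => (m.rnDeriv l z).toReal • y z) l := by
    rw [integrable_rnDeriv_smul_iff hml]; exact hy
  have hd : τ = 0 + l.withDensityᵥ fun z => (m.rnDeriv l z).toReal • y z := by
    rw [withDensityᵥ_smul_eq_withDensityᵥ_withDensity'
      (Measure.measurable_rnDeriv _ _).aemeasurable hlt hi, hw, zero_add]
  have hr := SignedMeasure.eq_rnDeriv (s := τ) 0 _ hi VectorMeasure.MutuallySingular.zero_left hd
  have hmeas : Measurable fun z => ENNReal.ofReal (y z ^ 2 / 4) * ENNReal.ofReal (f z) := by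
    have := f.continuous.measurable
    fun_prop
  rw [← lintegral_rnDeriv_mul hml hmeas.aemeasurable]
  refine lintegral_mono_ae ?_
  filter_upwards [hlt, hr] with z h1 h2
  rw [← h2, ← mul_assoc]
  gcongr
  set X := m.rnDeriv l z
  unfold rFun
  split_ifs with h3 h4
  · rw [← ENNReal.ofReal_toReal h1.ne, ENNReal.toReal_ofReal h3.le,
      ← ENNReal.ofReal_mul h3.le, smul_eq_mul]
    refine le_of_eq (congrArg _ ?_)
    field_simp
  · simp
  · have h5 : X.toReal = 0 := le_antisymm (not_lt.1 h3) ENNReal.toReal_nonneg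
    exact absurd ⟨h5, by simp [h5]⟩ h4

theorem fisherRaoLE_of_dominates {m n : Measure Square} [IsFiniteMeasure m] [IsFiniteMeasure n]
    {L : C(Square, ℝ) →ₗ[ℝ] ℝ} (h : Dominates m n L)
    (hL : ∀ (f : ℝ × ℝ → ℝ) (hf : IsTimeTest f),
      ∫ z, timeDeriv f z ∂m = - L ⟨fun z => f (toPlane z), hf.continuous_comp⟩) :
    FisherRaoLE m n := by
  obtain ⟨y, hy, hle⟩ := h.exists_density
  refine ⟨m.withDensityᵥ y, fun f hf => ?_, fun f hf => ?_⟩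
  · rw [hL f hf, hy, signedIntegral_withDensity (integrable_L2 y) hf.continuous_comp]
    rfl
  · exact (fisherRao_withDensity_le (Lp.stronglyMeasurable y).measurable (integrable_L2 y) f).trans
      (hle f hf)

theorem FisherRaoLE.exists_dominates {m n : Measure Square} [IsFiniteMeasure m]
    [IsFiniteMeasure n] (h : FisherRaoLE m n) :
    ∃ L : C(Square, ℝ) →ₗ[ℝ] ℝ, Dominates m n L ∧ ∀ (f : ℝ × ℝ → ℝ) (hf : IsTimeTest f),
      ∫ z, timeDeriv f z ∂m = - L ⟨fun z => f (toPlane z), hf.continuous_comp⟩ := by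
  obtain ⟨τ, h1, h2⟩ := h
  exact ⟨signedIntegralL τ, dominates_of_fisherRao_le h2, fun f hf => h1 f hf⟩

/-! ### The measure `u²`, its time derivative, and sums of dominated forms. -/

theorem integral_sqMeasure {α : Type*} [MeasureSpace α] {u : α → ℝ} (hu : AEMeasurable u)
    (f : α → ℝ) : ∫ z, f z ∂(sqMeasure u) = ∫ z, f z * u z ^ 2 := by
  rw [sqMeasure, integral_withDensity_eq_integral_toReal_smul₀ (by fun_prop) (by simp)]
  refine integral_congr_ae (Eventually.of_forall fun z => ?_)
  simp only [smul_eq_mul]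
  rw [ENNReal.toReal_ofReal (sq_nonneg _), mul_comm]

theorem aemeasurable_L2 {α : Type*} {m : MeasurableSpace α} {μ : Measure α} (u : Lp ℝ 2 μ) :
    AEMeasurable u μ :=
  (Lp.stronglyMeasurable u).measurable.aemeasurable

instance isFiniteMeasure_sqMeasure {α : Type*} [MeasureSpace α]
    (u : Lp ℝ 2 (volume : Measure α)) : IsFiniteMeasure (sqMeasure u) :=
  isFiniteMeasure_withDensity_ofReal (integrable_sq_L2 u).2

/-- Integration against `2 u v`, as a linear form. -/
def mulForm (u v : L2Square) : C(Square, ℝ) →ₗ[ℝ] ℝ where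
  toFun f := ∫ z, f z * (2 * u z * v z)
  map_add' f g := by
    rw [← integral_add (integrable_mul_mul_continuous u v f.continuous)
      (integrable_mul_mul_continuous u v g.continuous)]
    exact integral_congr_ae (Eventually.of_forall fun z => add_mul _ _ _)
  map_smul' c f := by
    rw [RingHom.id_apply, smul_eq_mul, ← integral_const_mul]
    exact integral_congr_ae (Eventually.of_forall fun z => mul_assoc _ _ _)

/-- Pointwise, this is `(g u - h v)² ≥ 0`. -/
theorem dominates_mulForm (u v : L2Square) :
    Dominates (sqMeasure u) (sqMeasure v) (mulForm u v) := by
  intro g h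
  rw [integral_sqMeasure (aemeasurable_L2 u), integral_sqMeasure (aemeasurable_L2 v),
    ← integral_add (integrable_sq_mul_continuous u (g := fun z => g z ^ 2) (by fun_prop))
      (integrable_sq_mul_continuous v (g := fun z => h z ^ 2) (by fun_prop))]
  refine integral_mono (integrable_mul_mul_continuous u v (g * h).continuous)
    ((integrable_sq_mul_continuous u (g.continuous.pow 2)).add
      (integrable_sq_mul_continuous v (h.continuous.pow 2))) fun z => ?_
  simp only [ContinuousMap.mul_apply]
  nlinarith [sq_nonneg (g z * u z - h z * v z)]

theorem integral_timeDeriv_sqMeasure {u v : L2Square} (huv : IsWeakTimeDeriv u v)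
    (f : ℝ × ℝ → ℝ) (hf : IsTimeTest f) :
    ∫ z, timeDeriv f z ∂(sqMeasure u) =
      - mulForm u v ⟨fun z => f (toPlane z), hf.continuous_comp⟩ := by
  rw [integral_sqMeasure (aemeasurable_L2 u), integral_timeDeriv_mul_sq huv hf]
  rfl

/-- Joint subadditivity of the Fisher-Rao functional, which is immediate in dual form. -/
theorem Dominates.add {m n m' n' : Measure Square} [IsFiniteMeasure m] [IsFiniteMeasure n]
    [IsFiniteMeasure m'] [IsFiniteMeasure n'] {L L' : C(Square, ℝ) →ₗ[ℝ] ℝ}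
    (h : Dominates m n L) (h' : Dominates m' n' L') : Dominates (m + m') (n + n') (L + L') := by
  intro g k
  have hg : Continuous fun z => g z ^ 2 := by fun_prop
  have hk : Continuous fun z => k z ^ 2 := by fun_prop
  rw [integral_add_measure (integrable_of_continuous _ hg) (integrable_of_continuous _ hg),
    integral_add_measure (integrable_of_continuous _ hk) (integrable_of_continuous _ hk)]
  have h1 := h g k
  have h2 := h' g k
  rw [LinearMap.add_apply]
  linarith

/-! ### Limits of dominated forms and of defect measures -/

theorem exists_tendsto_of_eventually_abs_le {X : Type*} (U : Ultrafilter X) {F : X → ℝ} {C : ℝ}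
    (h : ∀ᶠ x in (U : Filter X), |F x| ≤ C) : ∃ c, Tendsto F U (𝓝 c) := by
  have hK : IsCompact (Icc (-C) C) := isCompact_Icc
  obtain ⟨c, _, hc⟩ := hK.ultrafilter_le_nhds (U.map F) (by
    rw [le_principal_iff]
    exact h.mono fun x hx => abs_le.1 hx)
  exact ⟨c, hc⟩

/-- Domination tested on `(±g, 1)` bounds `L x g` eventually, so it converges along the ultrafilter.
Linearity and the dual inequality then pass to the limit pointwise. -/
theorem exists_limit_form {X : Type*} (U : Ultrafilter X) {m n : X → Measure Square}
    {L : X → C(Square, ℝ) →ₗ[ℝ] ℝ} {m' n' : Measure Square}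
    (hdom : ∀ᶠ x in (U : Filter X), Dominates (m x) (n x) (L x))
    (hm : ∀ f : C(Square, ℝ), Tendsto (fun x => ∫ z, f z ∂(m x)) U (𝓝 (∫ z, f z ∂m')))
    (hn : ∀ f : C(Square, ℝ), Tendsto (fun x => ∫ z, f z ∂(n x)) U (𝓝 (∫ z, f z ∂n'))) :
    ∃ L' : C(Square, ℝ) →ₗ[ℝ] ℝ, Dominates m' n' L' ∧
      ∀ g, Tendsto (fun x => L x g) U (𝓝 (L' g)) := by
  have hlim : ∀ g, ∃ c, Tendsto (fun x => L x g) U (𝓝 c) := by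
    intro g
    have h1 := (hm (g ^ 2)).eventually_lt_const (lt_add_one _)
    have h2 := (hn 1).eventually_lt_const (lt_add_one _)
    refine exists_tendsto_of_eventually_abs_le U
      (C := ((∫ z, (g ^ 2) z ∂m') + 1) + ((∫ z, (1 : C(Square, ℝ)) z ∂n') + 1)) ?_
    filter_upwards [h1, h2, hdom] with x h1 h2 h3
    have h4 := h3 g 1
    have h5 := h3 (-g) 1
    simp only [mul_one, map_neg, ContinuousMap.coe_neg, Pi.neg_apply, even_two, Even.neg_pow,
      ContinuousMap.one_apply, one_pow, ContinuousMap.coe_pow, Pi.pow_apply] at *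
    rw [abs_le]
    constructor <;> linarith
  choose L' hL' using hlim
  refine ⟨⟨⟨L', fun f g => ?_⟩, fun c f => ?_⟩, fun g h => ?_, hL'⟩
  · refine tendsto_nhds_unique (hL' (f + g)) ?_
    simpa only [map_add] using (hL' f).add (hL' g)
  · refine tendsto_nhds_unique (hL' (c • f)) ?_
    simpa only [map_smul, RingHom.id_apply] using (hL' f).const_smul c
  · refine le_of_tendsto_of_tendsto (hL' (g * h)) ((hm (g ^ 2)).add (hn (h ^ 2))) ?_
    filter_upwards [hdom] with x hx
    exact hx g h

theorem integral_sub_measure {κ μ : Measure Square} [IsFiniteMeasure κ] [IsFiniteMeasure μ]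
    (h : κ ≤ μ) {f : Square → ℝ} (hf : Continuous f) :
    ∫ z, f z ∂(μ - κ) = (∫ z, f z ∂μ) - ∫ z, f z ∂κ := by
  have := integral_add_measure (integrable_of_continuous (μ - κ) hf)
    (integrable_of_continuous κ hf)
  rw [Measure.sub_add_cancel_of_le h] at this
  linarith

/-- Thickened indicators give the inequality on closed sets, and inner regularity by closed sets
extends it to measurable ones. -/
theorem measure_le_of_integral_le {κ μ : Measure Square} [IsFiniteMeasure κ] [IsFiniteMeasure μ]
    (h : ∀ f : C(Square, ℝ), (∀ z, 0 ≤ f z) → ∫ z, f z ∂κ ≤ ∫ z, f z ∂μ) : κ ≤ μ := by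
  have hcl : ∀ F : Set Square, IsClosed F → κ F ≤ μ F := by
    intro F hF
    have h1 := tendsto_lintegral_thickenedIndicator_of_isClosed μ hF
      (δs := fun n : ℕ => 1 / ((n : ℝ) + 1)) (fun n => Nat.one_div_pos_of_nat)
      tendsto_one_div_add_atTop_nhds_zero_nat
    refine ge_of_tendsto' h1 fun n => ?_
    set φ := thickenedIndicator (δ := 1 / ((n : ℝ) + 1)) Nat.one_div_pos_of_nat F with hφ
    let f : C(Square, ℝ) := ⟨fun z => (φ z : ℝ), by fun_prop⟩
    have h2 := h f fun z => (φ z).2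
    have e : ∀ m : Measure Square, IsFiniteMeasure m →
        ∫⁻ z, (φ z : ℝ≥0∞) ∂m = ENNReal.ofReal (∫ z, f z ∂m) := fun m _ => by
      rw [ofReal_integral_eq_lintegral_ofReal (integrable_of_continuous m f.continuous)
        (Eventually.of_forall fun z => (φ z).2)]
      refine lintegral_congr fun z => ?_
      simp [f]
    refine (measure_le_lintegral_thickenedIndicator κ hF.measurableSet
      (Nat.one_div_pos_of_nat (n := n))).trans ?_
    rw [e κ inferInstance, e μ inferInstance]
    exact ENNReal.ofReal_le_ofReal h2
  refine Measure.le_iff.2 fun s hs => ?_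
  rw [hs.measure_eq_iSup_isClosed_of_ne_top (measure_ne_top κ s)]
  exact iSup₂_le fun K hK => iSup_le fun hKc => (hcl K hKc).trans (measure_mono hK)

theorem memLp_continuous_mul {α : Type*} [MeasureSpace α] [TopologicalSpace α] [CompactSpace α]
    [OpensMeasurableSpace α] (f : C(α, ℝ)) (u : Lp ℝ 2 (volume : Measure α)) :
    MemLp (fun z => f z * u z) 2 volume := by
  refine MemLp.of_le_mul (c := ‖f‖) (Lp.memLp u)
    (f.continuous.aestronglyMeasurable.mul (Lp.aestronglyMeasurable u))
    (Eventually.of_forall fun z => ?_)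
  rw [norm_mul]
  gcongr
  exact f.norm_coe_le_norm z

/-- If `u_x ⇀ u` weakly in `L²`, `u_x² ≤ μ_x` and `μ_x ⇀ μ`, then `u² ≤ μ` and
`μ_x - u_x² + (u_x - u)² ⇀ μ - u²`. -/
theorem tendsto_defect {X : Type*} (l : Filter X) [l.NeBot] {u : X → L2Square} {u' : L2Square}
    {μ : X → Measure Square} {μ' : Measure Square} [∀ x, IsFiniteMeasure (μ x)]
    [IsFiniteMeasure μ']
    (hu : ∀ v, Tendsto (fun x => inner ℝ v (u x)) l (𝓝 (inner ℝ v u')))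
    (hμ : ∀ f : C(Square, ℝ), Tendsto (fun x => ∫ z, f z ∂(μ x)) l (𝓝 (∫ z, f z ∂μ')))
    (hle : ∀ᶠ x in l, sqMeasure (u x) ≤ μ x) :
    sqMeasure u' ≤ μ' ∧ ∀ f : C(Square, ℝ),
      Tendsto (fun x => ∫ z, f z ∂(μ x - sqMeasure (u x) + sqMeasure (u x - u'))) l
        (𝓝 (∫ z, f z ∂(μ' - sqMeasure u'))) := by
  have key : ∀ f : C(Square, ℝ),
      Tendsto (fun x => ∫ z, f z ∂(μ x - sqMeasure (u x) + sqMeasure (u x - u'))) l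
        (𝓝 ((∫ z, f z ∂μ') - ∫ z, f z ∂(sqMeasure u'))) := by
    intro f
    set v := (memLp_continuous_mul f u').toLp _ with hv
    have hvc : v =ᵐ[volume] fun z => f z * u' z := (memLp_continuous_mul f u').coeFn_toLp
    have h1 : inner ℝ v u' = ∫ z, f z * u' z ^ 2 := by
      rw [real_inner_L2]
      exact integral_congr_ae (hvc.mono fun z hz => by simp only [hz]; ring)
    -- The term quadratic in `u x` will cancel the one in `μ x - sqMeasure (u x)`. What remains is
    -- linear in `u x`, so weak convergence suffices.
    have h2 : ∀ x, ∫ z, f z * (u x - u' : L2Square) z ^ 2 =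
        (∫ z, f z * u x z ^ 2) - 2 * inner ℝ v (u x) + ∫ z, f z * u' z ^ 2 := fun x => by
      have i1 := integrable_sq_mul_continuous (u x) f.continuous
      have i2 := (integrable_mul_L2 v (u x)).const_mul 2
      have i3 := integrable_sq_mul_continuous u' f.continuous
      have i4 : Integrable fun z => f z * u x z ^ 2 - 2 * (v z * u x z) := i1.sub i2
      rw [real_inner_L2, ← integral_const_mul, ← integral_sub i1 i2, ← integral_add i4 i3]
      refine integral_congr_ae ?_
      filter_upwards [hvc, Lp.coeFn_sub (u x) u'] with z h3 h4
      rw [h3, h4, Pi.sub_apply]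
      ring
    have h5 : Tendsto (fun x => (∫ z, f z ∂(μ x)) - 2 * inner ℝ v (u x) + ∫ z, f z * u' z ^ 2) l
        (𝓝 ((∫ z, f z ∂μ') - 2 * inner ℝ v u' + ∫ z, f z * u' z ^ 2)) :=
      ((hμ f).sub ((hu v).const_mul 2)).add_const _
    have h6 : (∫ z, f z ∂μ') - ∫ z, f z ∂(sqMeasure u') =
        (∫ z, f z ∂μ') - 2 * inner ℝ v u' + ∫ z, f z * u' z ^ 2 := by
      rw [integral_sqMeasure (aemeasurable_L2 u'), h1]; ring
    rw [h6]
    refine h5.congr' ?_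
    filter_upwards [hle] with x hx
    rw [integral_add_measure (integrable_of_continuous _ f.continuous)
      (integrable_of_continuous _ f.continuous), integral_sub_measure hx f.continuous,
      integral_sqMeasure (aemeasurable_L2 (u x)), integral_sqMeasure (aemeasurable_L2 _), h2]
    ring
  -- The corrected defects are positive measures, hence so is their limit.
  have hle' : sqMeasure u' ≤ μ' := measure_le_of_integral_le fun f hf =>
    sub_nonneg.1 (ge_of_tendsto' (key f) fun x => integral_nonneg hf)
  refine ⟨hle', fun f => ?_⟩
  rw [integral_sub_measure hle' f.continuous]
  exact key f

theorem IsWeakTimeDeriv.sub {u v u' v' : L2Square} (h : IsWeakTimeDeriv u v)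
    (h' : IsWeakTimeDeriv u' v') : IsWeakTimeDeriv (u - u') (v - v') := by
  have := h.add (h'.smul (-1))
  simpa only [neg_smul, one_smul, ← sub_eq_add_neg] using this

/-- The relaxation constraint is stable under weak convergence. -/
theorem isRelaxation_of_tendsto {X : Type*} (U : Ultrafilter X) {p : X → H1} {p' : H1}
    {μ ν : X → Measure Square} {μ' ν' : Measure Square} [∀ x, IsFiniteMeasure (μ x)]
    [∀ x, IsFiniteMeasure (ν x)] [IsFiniteMeasure μ'] [IsFiniteMeasure ν']
    (hp : ∀ v, Tendsto (fun x => inner ℝ v (H1.fn (p x))) U (𝓝 (inner ℝ v (H1.fn p'))))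
    (hp' : ∀ v, Tendsto (fun x => inner ℝ v (H1.dot (p x))) U (𝓝 (inner ℝ v (H1.dot p'))))
    (hμ : ∀ f : C(Square, ℝ), Tendsto (fun x => ∫ z, f z ∂(μ x)) U (𝓝 (∫ z, f z ∂μ')))
    (hν : ∀ f : C(Square, ℝ), Tendsto (fun x => ∫ z, f z ∂(ν x)) U (𝓝 (∫ z, f z ∂ν')))
    (h : ∀ᶠ x in (U : Filter X), IsRelaxation (p x) (μ x) (ν x)) : IsRelaxation p' μ' ν' := by
  obtain ⟨h1, h2⟩ := tendsto_defect (U : Filter X) hp hμ (h.mono fun x hx => hx.sq_le)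
  obtain ⟨h3, h4⟩ := tendsto_defect (U : Filter X) hp' hν (h.mono fun x hx => hx.sq_dot_le)
  obtain ⟨L, hL⟩ := (h.mono fun x hx => hx.fisherRao_le.exists_dominates).choice
  -- The correction `(p x - p')²` comes with its own derivative `mulForm`, so that the corrected
  -- forms are dominated by measures converging to the defects of the limit.
  obtain ⟨L', hd, hlim⟩ := exists_limit_form U
    (L := fun x => L x + mulForm (H1.fn (p x) - H1.fn p') (H1.dot (p x) - H1.dot p'))
    (hL.mono fun x hx => hx.1.add (dominates_mulForm _ _)) h2 h4
  refine ⟨h1, h3, fisherRaoLE_of_dominates hd fun f hf => ?_⟩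
  refine tendsto_nhds_unique (h2 ⟨timeDeriv f, hf.continuous_timeDeriv⟩) ?_
  refine (hlim ⟨fun z => f (toPlane z), hf.continuous_comp⟩).neg.congr' ?_
  filter_upwards [hL] with x hx
  have hw : IsWeakTimeDeriv (H1.fn (p x) - H1.fn p') (H1.dot (p x) - H1.dot p') :=
    IsWeakTimeDeriv.sub (p x).2 p'.2
  have hc := hf.continuous_timeDeriv
  rw [ContinuousMap.coe_mk, integral_add_measure (integrable_of_continuous _ hc)
    (integrable_of_continuous _ hc), hx.2 f hf, integral_timeDeriv_sqMeasure hw f hf,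
    LinearMap.add_apply]
  ring

/-- The Fisher-Rao bound for `(μ, ν)` itself. -/
theorem IsRelaxation.exists_dominates {p : H1} {μ ν : Measure Square} [IsFiniteMeasure μ]
    [IsFiniteMeasure ν] (h : IsRelaxation p μ ν) :
    ∃ L : C(Square, ℝ) →ₗ[ℝ] ℝ, Dominates μ ν L ∧ ∀ (f : ℝ × ℝ → ℝ) (hf : IsTimeTest f),
      ∫ z, timeDeriv f z ∂μ = - L ⟨fun z => f (toPlane z), hf.continuous_comp⟩ := by
  obtain ⟨L, h1, h2⟩ := h.fisherRao_le.exists_dominates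
  -- Adding back `p²` and `ṗ²` gives a bound on the full measures, whose masses are controlled.
  have h3 := h1.add (dominates_mulForm (H1.fn p) (H1.dot p))
  rw [Measure.sub_add_cancel_of_le h.sq_le, Measure.sub_add_cancel_of_le h.sq_dot_le] at h3
  refine ⟨_, h3, fun f hf => ?_⟩
  have h4 := h2 f hf
  rw [integral_sub_measure h.sq_le hf.continuous_timeDeriv,
    integral_timeDeriv_sqMeasure (u := H1.fn p) (v := H1.dot p) p.2 f hf] at h4
  rw [LinearMap.add_apply]
  linarith

/-! ### Equicontinuity of disintegrations -/

/-- Pointwise convergence of an eventually equicontinuous family is uniform. -/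
theorem eventually_forall_abs_sub_le {X Y : Type*} [PseudoMetricSpace Y] [CompactSpace Y]
    {l : Filter X} [l.NeBot] {F : X → Y → ℝ} {F' : Y → ℝ}
    (heq : ∀ ε > 0, ∃ δ > 0, ∀ᶠ x in l, ∀ y y', dist y y' < δ → |F x y - F x y'| ≤ ε)
    (hlim : ∀ y, Tendsto (fun x => F x y) l (𝓝 (F' y))) {ε : ℝ} (hε : 0 < ε) :
    ∀ᶠ x in l, ∀ y, |F x y - F' y| ≤ ε := by
  obtain ⟨δ, hδ, h1⟩ := heq (ε / 3) (by positivity)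
  have h2 : ∀ y y', dist y y' < δ → |F' y - F' y'| ≤ ε / 3 := fun y y' hy =>
    le_of_tendsto ((hlim y).sub (hlim y')).abs (h1.mono fun x hx => hx y y' hy)
  obtain ⟨t, -, ht, hcov⟩ := Metric.totallyBounded_iff.1
    (isCompact_univ (X := Y)).totallyBounded δ hδ |>.imp fun t ht =>
      (⟨trivial, ht.1, ht.2⟩ : True ∧ t.Finite ∧ univ ⊆ ⋃ y ∈ t, Metric.ball y δ)
  have h3 : ∀ᶠ x in l, ∀ y ∈ t, |F x y - F' y| ≤ ε / 3 := by
    rw [ht.eventually_all]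
    intro y _
    have := (hlim y).sub_const (F' y) |>.abs
    rw [sub_self, abs_zero] at this
    exact this.eventually_le_const (by positivity)
  filter_upwards [h1, h3] with x hx1 hx3 y
  obtain ⟨c, hc, hyc⟩ := mem_iUnion₂.1 (hcov (mem_univ y))
  have e1 := hx1 y c hyc
  have e2 := hx3 c hc
  have e3 := h2 y c hyc
  rw [abs_le] at *
  constructor <;> linarith

theorem continuous_integral_continuousMap {X : Type*} [TopologicalSpace X] [CompactSpace X]
    [MeasurableSpace X] [OpensMeasurableSpace X] (m : Measure X) [IsFiniteMeasure m] :
    Continuous fun f : C(X, ℝ) => ∫ z, f z ∂m := by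
  refine LipschitzWith.continuous (K := (m.real univ).toNNReal)
    (LipschitzWith.of_dist_le_mul fun f g => ?_)
  rw [Real.dist_eq, ← integral_sub (integrable_of_continuous m f.continuous)
    (integrable_of_continuous m g.continuous), ← Real.norm_eq_abs,
    Real.coe_toNNReal _ measureReal_nonneg, mul_comm]
  refine norm_integral_le_of_norm_le_const (Eventually.of_forall fun z => ?_)
  rw [← dist_eq_norm]
  exact ContinuousMap.dist_apply_le_dist z

/-- For polynomial `h`, this is the discriminant inequality applied to the product of `θ(t)` and
`h(x)`. Both sides are continuous in `h`, so density of polynomials gives the rest. -/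
theorem Dominates.sq_integral_deriv_le {μ ν : Measure Square} [IsFiniteMeasure μ]
    [IsFiniteMeasure ν] {L : C(Square, ℝ) →ₗ[ℝ] ℝ} (hd : Dominates μ ν L)
    (hL : ∀ (f : ℝ × ℝ → ℝ) (hf : IsTimeTest f),
      ∫ z, timeDeriv f z ∂μ = - L ⟨fun z => f (toPlane z), hf.continuous_comp⟩)
    {θ : ℝ → ℝ} (hθ : IsTest θ) (h : C(I, ℝ)) :
    (∫ z, deriv θ z.1 * h z.2 ∂μ) ^ 2 ≤ 4 * (∫ z, θ z.1 ^ 2 ∂μ) * ∫ z, h z.2 ^ 2 ∂ν := by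
  have hc : Continuous θ := hθ.smooth.continuous
  have hc' : Continuous (deriv θ) := hθ.smooth.continuous_deriv (by simp)
  let s : C(Square, I) := ⟨Prod.snd, continuous_snd⟩
  let T : C(Square, ℝ) := ⟨fun z => deriv θ z.1, by fun_prop⟩
  have hcomp : Continuous fun h : C(I, ℝ) => h.comp s := ContinuousMap.continuous_precomp s
  have c1 : Continuous fun h : C(I, ℝ) => ∫ z, deriv θ z.1 * h z.2 ∂μ :=
    (continuous_integral_continuousMap μ).comp (continuous_const.mul hcomp : Continuous fun h : C(I, ℝ) =>
      T * h.comp s)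
  have c2 : Continuous fun h : C(I, ℝ) => ∫ z, h z.2 ^ 2 ∂ν :=
    (continuous_integral_continuousMap ν).comp (hcomp.pow 2)
  refine mem_of_polynomial (A := {h | (∫ z, deriv θ z.1 * h z.2 ∂μ) ^ 2 ≤
    4 * (∫ z, θ z.1 ^ 2 ∂μ) * ∫ z, h z.2 ^ 2 ∂ν})
    (isClosed_le (c1.pow 2) (continuous_const.mul c2)) (fun P => ?_) h
  have h1 := hL _ (isTimeTest_polyTest hθ P)
  simp only [timeDeriv_polyTest hθ, polyTest_toPlane] at h1
  have h2 := hd.sq_le ⟨fun z => θ z.1, by fun_prop⟩ ((P.toContinuousMapOn I).comp s)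
  rw [← neg_sq] at h2
  exact le_trans (le_of_eq (congrArg (· ^ 2) h1)) h2

/-! ### Smooth approximations of indicators of time intervals. -/

/-- A smooth monotone transition from `0` to `1` on `[c - δ, c]`. -/
def step (c δ τ : ℝ) : ℝ := Real.smoothTransition ((τ - c) / δ + 1)

theorem contDiff_step (c δ : ℝ) : ContDiff ℝ ∞ (step c δ) := by
  unfold step
  exact Real.smoothTransition.contDiff.comp (by fun_prop)

theorem step_eq_zero {c δ τ : ℝ} (hδ : 0 < δ) (h : τ ≤ c - δ) : step c δ τ = 0 := by
  apply Real.smoothTransition.zero_of_nonpos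
  have : (τ - c) / δ ≤ -1 := by rw [div_le_iff₀ hδ]; linarith
  linarith

theorem step_eq_one {c δ τ : ℝ} (hδ : 0 < δ) (h : c ≤ τ) : step c δ τ = 1 := by
  apply Real.smoothTransition.one_of_one_le
  have : 0 ≤ (τ - c) / δ := div_nonneg (by linarith) hδ.le
  linarith

theorem step_mono {c δ τ τ' : ℝ} (hδ : 0 < δ) (h : τ ≤ τ') : step c δ τ ≤ step c δ τ' := by
  apply Real.smoothTransition.monotone
  gcongr

theorem step_anti {c c' δ τ : ℝ} (hδ : 0 < δ) (h : c ≤ c') : step c' δ τ ≤ step c δ τ := by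
  apply Real.smoothTransition.monotone
  gcongr

/-- The derivative of the transition is nonnegative, has mass `1`, and vanishes outside `[c - δ,
c]`: it is an approximate Dirac mass at `c`. -/
theorem abs_integral_deriv_step_sub_le {c δ ε : ℝ} (hδ : 0 < δ) (hc : δ < c) (hc1 : c < 1)
    {F : ℝ → ℝ} (hF : Continuous F) (hFc : ∀ x, |x - c| ≤ δ → |F x - F c| ≤ ε) :
    |(∫ τ in (0 : ℝ)..1, deriv (step c δ) τ * F τ) - F c| ≤ ε := by
  have hd : Continuous (deriv (step c δ)) := (contDiff_step c δ).continuous_deriv (by simp)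
  have h1 : ∫ τ in (0 : ℝ)..1, deriv (step c δ) τ = 1 := by
    rw [intervalIntegral.integral_deriv_eq_sub
      (fun x _ => ((contDiff_step c δ).differentiable (by simp)).differentiableAt)
      (hd.intervalIntegrable _ _), step_eq_one hδ hc1.le, step_eq_zero hδ (by linarith), sub_zero]
  have h2 : (∫ τ in (0 : ℝ)..1, deriv (step c δ) τ * F τ) - F c =
      ∫ τ in (0 : ℝ)..1, deriv (step c δ) τ * (F τ - F c) := by
    simp only [mul_sub]
    rw [intervalIntegral.integral_sub ((hd.fun_mul hF).intervalIntegrable _ _)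
      ((hd.fun_mul continuous_const).intervalIntegrable _ _), intervalIntegral.integral_mul_const, h1,
      one_mul]
  have h0 : ∀ τ, 0 ≤ deriv (step c δ) τ := fun τ =>
    (show Monotone (step c δ) from fun _ _ h => step_mono hδ h).deriv_nonneg
  rw [h2, ← Real.norm_eq_abs]
  refine (intervalIntegral.norm_integral_le_of_norm_le zero_le_one (g := fun τ =>
    deriv (step c δ) τ * ε) (Eventually.of_forall fun τ _ => ?_)
    ((hd.fun_mul continuous_const).intervalIntegrable _ _)).trans (le_of_eq ?_)
  · rw [norm_mul, Real.norm_eq_abs, Real.norm_eq_abs, abs_of_nonneg (h0 τ)]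
    by_cases hτ : |τ - c| ≤ δ
    · exact mul_le_mul_of_nonneg_left (hFc τ hτ) (h0 τ)
    · have : deriv (step c δ) τ = 0 := by
        rw [abs_le, not_and_or, not_le, not_le] at hτ
        rcases hτ with h | h
        · have : step c δ =ᶠ[𝓝 τ] fun _ => 0 := by
            filter_upwards [Iio_mem_nhds (show τ < c - δ by linarith)] with x hx
            exact step_eq_zero hδ (le_of_lt hx)
          rw [this.deriv_eq, deriv_const]
        · have : step c δ =ᶠ[𝓝 τ] fun _ => 1 := by
            filter_upwards [Ioi_mem_nhds (show c < τ by linarith)] with x hx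
            exact step_eq_one hδ (le_of_lt hx)
          rw [this.deriv_eq, deriv_const]
      rw [this]; simp
  · rw [intervalIntegral.integral_mul_const, h1, one_mul]

theorem continuous_ext {F : I → ℝ} (hF : Continuous F) : Continuous (ext F) :=
  hF.Icc_extend'

/-- The difference of the transitions at `s` and `t` approximates the indicator of `[s,t]`, and its
derivative approximates `δ_s - δ_t`. -/
theorem exists_isTest_integral_deriv {s t : I} (hs : (0 : ℝ) < s) (hst : s ≤ t) (ht : (t : ℝ) < 1)
    {F : I → ℝ} (hF : Continuous F) {ε : ℝ} (hε : 0 < ε) :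
    ∃ θ, IsTest θ ∧ (∀ τ, 0 ≤ θ τ ∧ θ τ ≤ 1) ∧ (∀ τ, τ ∉ Icc ((s : ℝ) - ε) t → θ τ = 0) ∧
      |(∫ τ : I, deriv θ τ * F τ) - (F s - F t)| ≤ 2 * ε := by
  have hst' : (s : ℝ) ≤ t := hst
  have hE := continuous_ext hF
  have hδ : ∀ c : ℝ, ∃ δ > 0, ∀ x, |x - c| ≤ δ → |ext F x - ext F c| ≤ ε := fun c => by
    obtain ⟨δ, h1, h2⟩ := Metric.continuous_iff.1 hE c ε hε
    exact ⟨δ / 2, by positivity, fun x hx => (h2 x (by rw [Real.dist_eq]; linarith)).le⟩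
  obtain ⟨δ₁, h1, h1'⟩ := hδ s
  obtain ⟨δ₂, h2, h2'⟩ := hδ t
  -- The bound `s / 2` keeps the support away from time `0`, and `ε` keeps it in `[s - ε, t]`.
  set δ := min (min δ₁ δ₂) (min ε (s / 2)) with hd
  have hδ0 : 0 < δ := by positivity
  have d1 : δ ≤ δ₁ := (min_le_left _ _).trans (min_le_left _ _)
  have d2 : δ ≤ δ₂ := (min_le_left _ _).trans (min_le_right _ _)
  have d3 : δ ≤ ε := (min_le_right _ _).trans (min_le_left _ _)
  have d4 : δ ≤ s / 2 := (min_le_right _ _).trans (min_le_right _ _)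
  have hz : ∀ τ, τ ∉ Icc ((s : ℝ) - δ) t → step s δ τ - step t δ τ = 0 := by
    intro τ hτ
    rw [mem_Icc, not_and_or, not_le, not_le] at hτ
    rcases hτ with h | h
    · rw [step_eq_zero hδ0 h.le, step_eq_zero hδ0 (by linarith), sub_zero]
    · rw [step_eq_one hδ0 h.le, step_eq_one hδ0 (by linarith), sub_self]
  refine ⟨fun τ => step s δ τ - step t δ τ, isTest_of_Icc
    ((contDiff_step _ _).sub (contDiff_step _ _)) (by linarith) ht hz, fun τ => ⟨?_, ?_⟩,
    fun τ hτ => hz τ fun h => hτ ⟨by linarith [h.1], h.2⟩, ?_⟩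
  · exact sub_nonneg.2 (step_anti hδ0 hst')
  · have e1 : step s δ τ ≤ 1 := Real.smoothTransition.le_one _
    have e2 : 0 ≤ step t δ τ := Real.smoothTransition.nonneg _
    linarith
  · have e1 := abs_integral_deriv_step_sub_le hδ0 (c := s) (by linarith) (by linarith) hE
      fun x hx => h1' x (hx.trans d1)
    have e2 := abs_integral_deriv_step_sub_le hδ0 (c := t) (by linarith) ht hE
      fun x hx => h2' x (hx.trans d2)
    have e3 : ∫ τ : I, deriv (fun τ => step s δ τ - step t δ τ) τ * F τ =
        (∫ τ in (0 : ℝ)..1, deriv (step s δ) τ * ext F τ) -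
          ∫ τ in (0 : ℝ)..1, deriv (step t δ) τ * ext F τ := by
      have hc : ∀ c, Continuous (deriv (step c δ)) := fun c =>
        (contDiff_step c δ).continuous_deriv (by simp)
      rw [← intervalIntegral.integral_sub (((hc s).fun_mul hE).intervalIntegrable _ _)
        (((hc t).fun_mul hE).intervalIntegrable _ _), ← integral_unitInterval]
      refine integral_congr_ae (Eventually.of_forall fun τ => ?_)
      simp only [ext_coe]
      rw [deriv_fun_sub ((contDiff_step _ _).differentiable (by simp)).differentiableAt
        ((contDiff_step _ _).differentiable (by simp)).differentiableAt]
      ring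
    rw [e3]
    rw [ext_coe] at e1 e2
    rw [abs_le] at *
    constructor <;> linarith

/-! ### Limits of disintegrations -/

theorem continuous_integral_path {m : I → FiniteMeasure I} (hm : Continuous m) (h : C(I, ℝ)) :
    Continuous fun t => ∫ x, h x ∂(m t : Measure I) :=
  continuous_iff_continuousAt.2 fun t =>
    FiniteMeasure.tendsto_iff_forall_integral_tendsto.1 (hm.tendsto t)
      (BoundedContinuousFunction.mkOfCompact h)

theorem IsDisintegration.integral_mul {μ : Measure Square} {m : I → FiniteMeasure I}
    (hm : IsDisintegration μ m) {c : ℝ → ℝ} (hc : Continuous c) (h : C(I, ℝ)) :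
    ∫ z, c z.1 * h z.2 ∂μ = ∫ t : I, c t * ∫ x, h x ∂(m t : Measure I) := by
  refine (hm.2 ⟨fun z => c z.1 * h z.2, by fun_prop⟩).trans
    (integral_congr_ae (Eventually.of_forall fun t => ?_))
  simp only [ContinuousMap.coe_mk]
  rw [integral_const_mul]

theorem dense_Ioo_unitInterval : Dense {t : I | (0 : ℝ) < t ∧ (t : ℝ) < 1} := by
  intro x
  rw [mem_closure_iff]
  intro U hU hx
  obtain ⟨V, hV, rfl⟩ := isOpen_induced_iff.1 hU
  have hx1 : (x : ℝ) ∈ closure (Ioo (0 : ℝ) 1) := by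
    rw [closure_Ioo zero_ne_one]; exact x.2
  obtain ⟨y, hyV, hy⟩ := mem_closure_iff.1 hx1 V hV hx
  exact ⟨⟨y, Ioo_subset_Icc_self hy⟩, hyV, hy⟩

/-- Test functions vanish near times `0` and `1`, so estimates are first obtained at interior times
and then extended by continuity. -/
theorem sq_sub_le_of_interior {F : I → ℝ} (hF : Continuous F) {A C : ℝ}
    (h : ∀ s t : I, (0 : ℝ) < s → s ≤ t → (t : ℝ) < 1 →
      (F s - F t) ^ 2 ≤ A + C * |(t : ℝ) - s|) (s t : I) :
    (F s - F t) ^ 2 ≤ A + C * |(t : ℝ) - s| := by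
  have hcl : IsClosed {p : I × I | (F p.1 - F p.2) ^ 2 ≤ A + C * |(p.2 : ℝ) - p.1|} :=
    isClosed_le (by fun_prop) (by fun_prop)
  have hd := dense_Ioo_unitInterval.prod dense_Ioo_unitInterval
  refine (hcl.closure_subset_iff.2 ?_) (hd (s, t))
  rintro ⟨s, t⟩ ⟨hs, ht⟩
  rcases le_total s t with hst | hst
  · exact h s t hs.1 hst ht.2
  · have := h t s ht.1 hst hs.2
    rw [abs_sub_comm] at this
    change (F s - F t) ^ 2 ≤ _
    rw [← neg_sub, neg_sq]
    exact this

/-- The bound on `∫ θ² dμ` is left as a parameter because it is used twice: first with the total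
mass of `μ`, then with a multiple of `t - s + ε`. -/
theorem sq_sub_le_of_test_bound {μ ν : Measure Square} [IsFiniteMeasure μ] [IsFiniteMeasure ν]
    {L : C(Square, ℝ) →ₗ[ℝ] ℝ} (hd : Dominates μ ν L)
    (hL : ∀ (f : ℝ × ℝ → ℝ) (hf : IsTimeTest f),
      ∫ z, timeDeriv f z ∂μ = - L ⟨fun z => f (toPlane z), hf.continuous_comp⟩)
    {m : I → FiniteMeasure I} (hm : IsDisintegration μ m)
    {s t : I} (hs : (0 : ℝ) < s) (hst : s ≤ t) (ht : (t : ℝ) < 1)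
    {a c : ℝ} (hA : ∀ ε > 0, ∀ θ, IsTest θ → (∀ τ, 0 ≤ θ τ ∧ θ τ ≤ 1) →
      (∀ τ, τ ∉ Icc ((s : ℝ) - ε) t → θ τ = 0) → ∫ z, θ z.1 ^ 2 ∂μ ≤ a + c * ε) (h : C(I, ℝ)) :
    ((∫ x, h x ∂(m s : Measure I)) - ∫ x, h x ∂(m t : Measure I)) ^ 2 ≤
      4 * a * ∫ z, h z.2 ^ 2 ∂ν := by
  set F : I → ℝ := fun t => ∫ x, h x ∂(m t : Measure I) with hFdef
  have hF : Continuous F := continuous_integral_path hm.1 h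
  set B := ∫ z, h z.2 ^ 2 ∂ν
  have hB : 0 ≤ B := integral_nonneg fun z => sq_nonneg _
  have key : ∀ ε > 0, |F s - F t| ≤ 2 * ε + √(4 * (a + c * ε) * B) := by
    intro ε hε
    obtain ⟨θ, h1, h2, h3, h4⟩ := exists_isTest_integral_deriv hs hst ht hF hε
    have h5 := hd.sq_integral_deriv_le hL h1 h
    rw [hm.integral_mul (h1.smooth.continuous_deriv (by simp)) h] at h5
    have h6 : |∫ τ : I, deriv θ τ * F τ| ≤ √(4 * (a + c * ε) * B) := by
      apply Real.abs_le_sqrt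
      refine h5.trans ?_
      have := hA ε hε θ h1 h2 h3
      gcongr
    have := abs_sub_abs_le_abs_sub (F s - F t) (∫ τ : I, deriv θ τ * F τ)
    rw [abs_sub_comm (F s - F t)] at this
    linarith
  have hlim : Tendsto (fun ε : ℝ => 2 * ε + √(4 * (a + c * ε) * B)) (𝓝[>] 0)
      (𝓝 (2 * 0 + √(4 * (a + c * 0) * B))) :=
    (Continuous.tendsto (by fun_prop) 0).mono_left nhdsWithin_le_nhds
  have h7 := ge_of_tendsto hlim (eventually_mem_nhdsWithin.mono fun ε hε => key ε hε)
  simp only [mul_zero, zero_add, add_zero] at h7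
  have ha : 0 ≤ a := by
    have hl : Tendsto (fun ε : ℝ => a + c * ε) (𝓝[>] 0) (𝓝 (a + c * 0)) :=
      (Continuous.tendsto (by fun_prop) 0).mono_left nhdsWithin_le_nhds
    rw [mul_zero, add_zero] at hl
    refine ge_of_tendsto hl (eventually_mem_nhdsWithin.mono fun ε hε => ?_)
    obtain ⟨θ, h1, h2, h3, -⟩ := exists_isTest_integral_deriv hs hst ht hF hε
    exact (integral_nonneg fun z => sq_nonneg _).trans (hA ε hε θ h1 h2 h3)
  calc (F s - F t) ^ 2 = |F s - F t| ^ 2 := (sq_abs _).symm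
    _ ≤ √(4 * a * B) ^ 2 := by gcongr
    _ = 4 * a * B := Real.sq_sqrt (by positivity)

/-- The crude bound `θ² ≤ 1` shows that the masses at two times differ by at most `2 √(μ(D) ν(D)) ≤
μ(D) + ν(D)`. Their average over time is `μ(D)`. -/
theorem mass_path_le {μ ν : Measure Square} [IsFiniteMeasure μ] [IsFiniteMeasure ν]
    {L : C(Square, ℝ) →ₗ[ℝ] ℝ} (hd : Dominates μ ν L)
    (hL : ∀ (f : ℝ × ℝ → ℝ) (hf : IsTimeTest f),
      ∫ z, timeDeriv f z ∂μ = - L ⟨fun z => f (toPlane z), hf.continuous_comp⟩)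
    {m : I → FiniteMeasure I} (hm : IsDisintegration μ m)
    (t : I) :
    (m t : Measure I).real univ ≤ 2 * μ.real univ + ν.real univ := by
  set M : I → ℝ := fun t => ∫ x, (1 : C(I, ℝ)) x ∂(m t : Measure I) with hM
  have hMm : ∀ t, M t = (m t : Measure I).real univ := fun t => by simp [hM]
  have hMc : Continuous M := continuous_integral_path hm.1 1
  have h1 : ∀ s t : I, (M s - M t) ^ 2 ≤ 4 * μ.real univ * ν.real univ + 0 * |(t : ℝ) - s| := by
    refine sq_sub_le_of_interior hMc fun s t hs hst ht => ?_
    have := sq_sub_le_of_test_bound hd hL hm hs hst ht (a := μ.real univ) (c := 0)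
      (fun ε _ θ hθ h0 _ => by
        have : ∫ z, θ z.1 ^ 2 ∂μ ≤ ∫ _, (1 : ℝ) ∂μ := by
          refine integral_mono (integrable_of_continuous μ ?_) (integrable_const _) fun z => ?_
          · have := hθ.smooth.continuous
            fun_prop
          · exact pow_le_one₀ (h0 _).1 (h0 _).2
        simpa using this) 1
    simpa [hM] using this
  have h2 : ∀ s, M t - (μ.real univ + ν.real univ) ≤ M s := fun s => by
    have h3 := h1 s t
    have ha : 0 ≤ μ.real univ := measureReal_nonneg
    have hb : 0 ≤ ν.real univ := measureReal_nonneg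
    have h4 : |M s - M t| ≤ μ.real univ + ν.real univ :=
      abs_le_of_sq_le_sq (by nlinarith [sq_nonneg (μ.real univ - ν.real univ)]) (by positivity)
    linarith [(abs_le.1 h4).1]
  have h3 : ∫ s, M s = μ.real univ := by
    have := hm.2 1
    simp only [ContinuousMap.one_apply, integral_const, smul_eq_mul, mul_one] at this
    rw [this]
    exact integral_congr_ae (Eventually.of_forall fun s => hMm s)
  have h4 : ∫ _ : I, (M t - (μ.real univ + ν.real univ)) ≤ ∫ s, M s :=
    integral_mono (integrable_const _) (integrable_of_continuous _ hMc) h2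
  rw [h3] at h4
  simp only [integral_const, probReal_univ, one_smul] at h4
  rw [← hMm]
  linarith

/-- Bootstrap: once the masses are at most `K`, a test function supported in `[s - ε, t]` satisfies
`∫ θ² dμ ≤ K (t - s + ε)`, which supplies the factor `t - s`. -/
theorem sq_sub_integral_path_le {μ ν : Measure Square} [IsFiniteMeasure μ] [IsFiniteMeasure ν]
    {L : C(Square, ℝ) →ₗ[ℝ] ℝ} (hd : Dominates μ ν L)
    (hL : ∀ (f : ℝ × ℝ → ℝ) (hf : IsTimeTest f),
      ∫ z, timeDeriv f z ∂μ = - L ⟨fun z => f (toPlane z), hf.continuous_comp⟩)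
    {m : I → FiniteMeasure I} (hm : IsDisintegration μ m)
    (h : C(I, ℝ)) (s t : I) :
    ((∫ x, h x ∂(m s : Measure I)) - ∫ x, h x ∂(m t : Measure I)) ^ 2 ≤
      4 * (2 * μ.real univ + ν.real univ) * (∫ z, h z.2 ^ 2 ∂ν) * |(t : ℝ) - s| := by
  set K := 2 * μ.real univ + ν.real univ with hK
  have hK0 : 0 ≤ K := by positivity
  have := sq_sub_le_of_interior (continuous_integral_path hm.1 h) (A := 0)
    (C := 4 * K * (∫ z, h z.2 ^ 2 ∂ν)) (fun s t hs hst ht => ?_) s t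
  · rwa [zero_add] at this
  have h1 := sq_sub_le_of_test_bound hd hL hm hs hst ht (a := K * ((t : ℝ) - s)) (c := K)
    (fun ε hε θ hθ h0 hsupp => ?_) h
  · rw [abs_of_nonneg (sub_nonneg.2 (show (s : ℝ) ≤ t from hst)), zero_add]
    refine h1.trans (le_of_eq (by ring))
  have hc := hθ.smooth.continuous
  have h2 := hm.integral_mul (c := fun τ => θ τ ^ 2) (by fun_prop) 1
  simp only [ContinuousMap.one_apply, mul_one] at h2
  rw [h2]
  set S : Set I := (↑) ⁻¹' Icc ((s : ℝ) - ε) t with hS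
  have hSm : MeasurableSet S := measurableSet_Icc.preimage measurable_subtype_coe
  have hvol : volume.real S ≤ (t : ℝ) - s + ε := by
    have hst' : (s : ℝ) ≤ t := hst
    refine ENNReal.toReal_le_of_le_ofReal (by linarith) ?_
    rw [hS, unitInterval.measurePreserving_coe.measure_preimage
      measurableSet_Icc.nullMeasurableSet]
    refine (Measure.restrict_apply_le _ _).trans ?_
    rw [Real.volume_Icc]
    exact ENNReal.ofReal_le_ofReal (by linarith)
  have h3 : ∫ τ : I, θ τ ^ 2 * ∫ _, (1 : ℝ) ∂(m τ : Measure I) ≤ ∫ τ, S.indicator (fun _ => K) τ := by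
    refine integral_mono (integrable_of_continuous _ ?_)
      ((integrable_const K).indicator hSm) fun τ => ?_
    · have := continuous_integral_path hm.1 1
      simp only [ContinuousMap.one_apply] at this
      fun_prop
    · have hM : ∫ _, (1 : ℝ) ∂(m τ : Measure I) ≤ K := by
        simpa using mass_path_le hd hL hm τ
      have hM0 : 0 ≤ ∫ _, (1 : ℝ) ∂(m τ : Measure I) := integral_nonneg fun _ => zero_le_one
      by_cases hτ : τ ∈ S
      · rw [indicator_of_mem hτ]
        have := pow_le_one₀ (n := 2) (h0 τ).1 (h0 τ).2
        nlinarith [sq_nonneg (θ τ)]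
      · rw [indicator_of_notMem hτ, hsupp _ hτ]
        simp
  refine h3.trans ?_
  rw [integral_indicator hSm, setIntegral_const, smul_eq_mul]
  nlinarith

theorem abs_integral_le_norm_mul {X : Type*} [TopologicalSpace X] [CompactSpace X]
    [MeasurableSpace X] [OpensMeasurableSpace X] (m : Measure X) [IsFiniteMeasure m]
    (f : C(X, ℝ)) : |∫ z, f z ∂m| ≤ ‖f‖ * m.real univ := by
  rw [← Real.norm_eq_abs]
  exact norm_integral_le_of_norm_le_const (Eventually.of_forall fun z => f.norm_coe_le_norm z)

/-- The slice `f(t, ·)`. -/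
def sliceMap (f : C(Square, ℝ)) (t : I) : C(I, ℝ) := ⟨fun x => f (t, x), by fun_prop⟩

theorem norm_sliceMap_le (f : C(Square, ℝ)) (t : I) : ‖sliceMap f t‖ ≤ ‖f‖ :=
  (ContinuousMap.norm_le _ (norm_nonneg _)).2 fun x => f.norm_coe_le_norm (t, x)

/-- The uniform mass bound gives a limit at each time by compactness, and the uniform Hölder bound
survives in the limit and makes it weakly continuous. Integrals of slices then converge uniformly in
time, which preserves the disintegration identity. -/
theorem exists_limit_disintegration {X : Type*} (U : Ultrafilter X) {μ ν : X → Measure Square}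
    {μ' : Measure Square} [∀ x, IsFiniteMeasure (μ x)] [∀ x, IsFiniteMeasure (ν x)]
    [IsFiniteMeasure μ']
    (hμ : ∀ f : C(Square, ℝ), Tendsto (fun x => ∫ z, f z ∂(μ x)) U (𝓝 (∫ z, f z ∂μ')))
    {C : ℝ} (hC : ∀ᶠ x in (U : Filter X), (μ x).real univ ≤ C ∧ (ν x).real univ ≤ C)
    (hdom : ∀ᶠ x in (U : Filter X), ∃ L : C(Square, ℝ) →ₗ[ℝ] ℝ, Dominates (μ x) (ν x) L ∧
      ∀ (f : ℝ × ℝ → ℝ) (hf : IsTimeTest f),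
        ∫ z, timeDeriv f z ∂(μ x) = - L ⟨fun z => f (toPlane z), hf.continuous_comp⟩)
    {m : X → I → FiniteMeasure I} (hm : ∀ᶠ x in (U : Filter X), IsDisintegration (μ x) (m x)) :
    ∃ m' : I → FiniteMeasure I, IsDisintegration μ' m' ∧
      ∀ t, Tendsto (fun x => m x t) U (𝓝 (m' t)) := by
  have hC0 : 0 ≤ C := by
    obtain ⟨x, hx⟩ := hC.exists
    exact measureReal_nonneg.trans hx.1
  have hmass : ∀ᶠ x in (U : Filter X), ∀ t, (m x t : Measure I).real univ ≤ 3 * C := by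
    filter_upwards [hC, hdom, hm] with x h1 ⟨L, h2, h3⟩ h4 t
    exact (mass_path_le h2 h3 h4 t).trans (by linarith)
  have hhol : ∀ᶠ x in (U : Filter X), ∀ (h : C(I, ℝ)) (s t : I),
      ((∫ y, h y ∂(m x s : Measure I)) - ∫ y, h y ∂(m x t : Measure I)) ^ 2 ≤
        12 * C ^ 2 * ‖h‖ ^ 2 * |(t : ℝ) - s| := by
    filter_upwards [hC, hdom, hm] with x h1 ⟨L, h2, h3⟩ h4 h s t
    refine (sq_sub_integral_path_le h2 h3 h4 h s t).trans ?_
    have h5 : ∫ z, h z.2 ^ 2 ∂(ν x) ≤ ‖h‖ ^ 2 * C := by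
      refine (le_abs_self _).trans ((abs_integral_le_norm_mul (ν x)
        ⟨fun z => h z.2 ^ 2, by fun_prop⟩).trans ?_)
      refine mul_le_mul ((ContinuousMap.norm_le _ (by positivity)).2 fun z => ?_) h1.2
        measureReal_nonneg (by positivity)
      simp only [ContinuousMap.coe_mk, norm_pow]
      gcongr
      exact h.norm_coe_le_norm _
    have h6 : 0 ≤ ∫ z, h z.2 ^ 2 ∂(ν x) := integral_nonneg fun z => sq_nonneg _
    calc 4 * (2 * (μ x).real univ + (ν x).real univ) * (∫ z, h z.2 ^ 2 ∂(ν x)) * |(t : ℝ) - s|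
        ≤ 4 * (2 * C + C) * (‖h‖ ^ 2 * C) * |(t : ℝ) - s| := by
          gcongr
          · exact h1.1
          · exact h1.2
      _ = _ := by ring
  have hlim : ∀ t, ∃ n : FiniteMeasure I, n.mass ≤ (3 * C).toNNReal ∧
      Tendsto (fun x => m x t) U (𝓝 n) := by
    intro t
    obtain ⟨n, hn, hn'⟩ := (isCompact_setOfPred_finiteMeasure_le_of_compactSpace I
      (3 * C).toNNReal).ultrafilter_le_nhds (U.map fun x => m x t) (by
        rw [le_principal_iff]
        refine hmass.mono fun x hx => ?_
        have := hx t
        rw [measureReal_def] at this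
        change (m x t).mass ≤ (3 * C).toNNReal
        exact NNReal.le_toNNReal_of_coe_le this)
    exact ⟨n, hn, hn'⟩
  choose m' hm'mass hm' using hlim
  have hint : ∀ (h : C(I, ℝ)) (t : I), Tendsto (fun x => ∫ y, h y ∂(m x t : Measure I)) U
      (𝓝 (∫ y, h y ∂(m' t : Measure I))) := fun h t =>
    FiniteMeasure.tendsto_iff_forall_integral_tendsto.1 (hm' t)
      (BoundedContinuousFunction.mkOfCompact h)
  have hhol' : ∀ (h : C(I, ℝ)) (s t : I),
      ((∫ y, h y ∂(m' s : Measure I)) - ∫ y, h y ∂(m' t : Measure I)) ^ 2 ≤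
        12 * C ^ 2 * ‖h‖ ^ 2 * |(t : ℝ) - s| := fun h s t =>
    le_of_tendsto (((hint h s).sub (hint h t)).pow 2) (hhol.mono fun x hx => hx h s t)
  have hcont : Continuous m' := by
    refine continuous_iff_continuousAt.2 fun t => ?_
    refine FiniteMeasure.tendsto_iff_forall_integral_tendsto.2 fun f => ?_
    have h0 : Tendsto (fun s : I => √(12 * C ^ 2 * ‖f.toContinuousMap‖ ^ 2 * |(t : ℝ) - s|)) (𝓝 t)
        (𝓝 (√(12 * C ^ 2 * ‖f.toContinuousMap‖ ^ 2 * |(t : ℝ) - t|))) :=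
      Continuous.tendsto (by fun_prop) t
    rw [sub_self, abs_zero, mul_zero, Real.sqrt_zero] at h0
    rw [tendsto_iff_dist_tendsto_zero]
    refine squeeze_zero (fun _ => dist_nonneg) (fun s => ?_) h0
    rw [Real.dist_eq]
    exact Real.abs_le_sqrt (hhol' f.toContinuousMap s t)
  refine ⟨m', ⟨hcont, fun f => ?_⟩, hm'⟩
  set G : X → I → ℝ := fun x t => ∫ y, sliceMap f t y ∂(m x t : Measure I) with hG
  set G' : I → ℝ := fun t => ∫ y, sliceMap f t y ∂(m' t : Measure I) with hG'
  -- The modulus `δ` depends on `f` and `C` only, so it serves both for the approximating paths and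
  -- for their limit. The change of the slice and the change of the measure each contribute `ε / 2`.
  have hequi : ∀ ε > 0, ∃ δ > 0, ∀ n : I → FiniteMeasure I,
      (∀ t, (n t : Measure I).real univ ≤ 3 * C) →
      (∀ (h : C(I, ℝ)) (s t : I),
        ((∫ y, h y ∂(n s : Measure I)) - ∫ y, h y ∂(n t : Measure I)) ^ 2 ≤
          12 * C ^ 2 * ‖h‖ ^ 2 * |(t : ℝ) - s|) →
      ∀ s t, dist s t < δ →
        |(∫ y, sliceMap f s y ∂(n s : Measure I)) - ∫ y, sliceMap f t y ∂(n t : Measure I)| ≤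
          ε := by
    intro ε hε
    obtain ⟨δ₁, hδ₁, h1⟩ := Metric.uniformContinuous_iff.1
      (CompactSpace.uniformContinuous_of_continuous f.continuous) (ε / 2 / (3 * C + 1))
      (by positivity)
    have hK : 0 < 12 * C ^ 2 * ‖f‖ ^ 2 + 1 := by positivity
    refine ⟨min δ₁ ((ε / 2) ^ 2 / (12 * C ^ 2 * ‖f‖ ^ 2 + 1)), by positivity,
      fun n hn hn' s t hst => ?_⟩
    have h2 : |∫ y, (sliceMap f s - sliceMap f t) y ∂(n s : Measure I)| ≤ ε / 2 := by
      refine (abs_integral_le_norm_mul (n s : Measure I) _).trans ?_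
      have h3 : ‖sliceMap f s - sliceMap f t‖ ≤ ε / 2 / (3 * C + 1) := by
        refine (ContinuousMap.norm_le _ (by positivity)).2 fun y => ?_
        have : dist ((s, y) : Square) (t, y) < δ₁ := by
          rw [Prod.dist_eq, dist_self]
          exact max_lt (hst.trans_le (min_le_left _ _)) hδ₁
        exact (dist_eq_norm (f (s, y)) (f (t, y))).symm.trans_le (h1 this).le
      calc _ ≤ ε / 2 / (3 * C + 1) * (3 * C + 1) :=
            mul_le_mul h3 ((hn s).trans (by linarith)) measureReal_nonneg (by positivity)
        _ = ε / 2 := by field_simp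
    have h4 : |(∫ y, sliceMap f t y ∂(n s : Measure I)) -
        ∫ y, sliceMap f t y ∂(n t : Measure I)| ≤ ε / 2 := by
      refine abs_le_of_sq_le_sq ((hn' _ s t).trans ?_) (by positivity)
      have h5 : |(t : ℝ) - s| ≤ (ε / 2) ^ 2 / (12 * C ^ 2 * ‖f‖ ^ 2 + 1) := by
        rw [abs_sub_comm]
        exact hst.le.trans (min_le_right _ _)
      calc _ ≤ (12 * C ^ 2 * ‖f‖ ^ 2 + 1) * ((ε / 2) ^ 2 / (12 * C ^ 2 * ‖f‖ ^ 2 + 1)) := by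
            refine mul_le_mul ?_ h5 (abs_nonneg _) hK.le
            have := norm_sliceMap_le f t
            have : 12 * C ^ 2 * ‖sliceMap f t‖ ^ 2 ≤ 12 * C ^ 2 * ‖f‖ ^ 2 := by gcongr
            linarith
        _ = _ := by field_simp
    have h6 : (∫ y, sliceMap f s y ∂(n s : Measure I)) - ∫ y, sliceMap f t y ∂(n t : Measure I) =
        (∫ y, (sliceMap f s - sliceMap f t) y ∂(n s : Measure I)) +
        ((∫ y, sliceMap f t y ∂(n s : Measure I)) -
          ∫ y, sliceMap f t y ∂(n t : Measure I)) := by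
      simp only [ContinuousMap.sub_apply]
      rw [integral_sub (integrable_of_continuous _ (sliceMap f s).continuous)
        (integrable_of_continuous _ (sliceMap f t).continuous)]
      ring
    rw [h6]
    exact (abs_add_le _ _).trans (by linarith)
  have hcontG : ∀ n : I → FiniteMeasure I, (∀ t, (n t : Measure I).real univ ≤ 3 * C) →
      (∀ (h : C(I, ℝ)) (s t : I),
        ((∫ y, h y ∂(n s : Measure I)) - ∫ y, h y ∂(n t : Measure I)) ^ 2 ≤
          12 * C ^ 2 * ‖h‖ ^ 2 * |(t : ℝ) - s|) →
      Continuous fun t => ∫ y, sliceMap f t y ∂(n t : Measure I) := by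
    intro n hn hn'
    refine Metric.continuous_iff.2 fun t ε hε => ?_
    obtain ⟨δ, hδ, h⟩ := hequi (ε / 2) (by positivity)
    exact ⟨δ, hδ, fun s hs => (h n hn hn' s t hs).trans_lt (by linarith)⟩
  have hG'c : Continuous G' := hcontG m' (fun t => by
    have := hm'mass t
    exact (NNReal.coe_le_coe.2 this).trans (Real.coe_toNNReal _ (by positivity)).le) hhol'
  have hGlim : ∀ t, Tendsto (fun x => G x t) U (𝓝 (G' t)) := fun t => hint _ t
  have hunif : ∀ ε > 0, ∀ᶠ x in (U : Filter X), ∀ t, |G x t - G' t| ≤ ε := by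
    refine fun ε hε => eventually_forall_abs_sub_le (fun ε hε => ?_) hGlim hε
    obtain ⟨δ, hδ, h⟩ := hequi ε hε
    refine ⟨δ, hδ, ?_⟩
    filter_upwards [hmass, hhol] with x h1 h2
    exact h (m x) h1 h2
  refine tendsto_nhds_unique (hμ f) (Metric.tendsto_nhds.2 fun ε hε => ?_)
  filter_upwards [hunif (ε / 2) (by positivity), hm, hmass, hhol] with x h1 h2 h3 h4
  have h5 : ∫ z, f z ∂(μ x) = ∫ t, G x t := h2.2 f
  rw [h5, Real.dist_eq]
  change |(∫ t, G x t) - ∫ t, G' t| < ε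
  rw [← integral_sub (integrable_of_continuous _ (hcontG (m x) h3 h4))
    (integrable_of_continuous _ hG'c), ← Real.norm_eq_abs]
  refine (norm_integral_le_of_norm_le_const (Eventually.of_forall h1)).trans_lt ?_
  simp only [probReal_univ, mul_one]
  linarith

/-! ### Stability of the equation `q̇ = η(q) p` -/

theorem eta_L2 (r : L2Space) (x : I) : eta r x = Real.exp (inner ℝ (ind x) r) := by
  rw [eta, inner_ind]

/-- `R` is a primitive in time of `v`, and `v = η(R) p`. -/
structure IsFlow (p v : L2Square) (R : I → L2Space) : Prop where
  sub_eq : ∀ s t, R t - R s = timeAvg (ind t - ind s) v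
  ode : ∀ᵐ z : Square, v z = Real.exp (inner ℝ (ind z.2) (R z.1)) * p z

theorem IsFlow.continuous {p v : L2Square} {R : I → L2Space} (h : IsFlow p v R) :
    Continuous R := by
  have : R = fun t => R 0 + timeAvg (ind t - ind 0) v := by
    funext t
    rw [← h.sub_eq 0 t]
    abel
  rw [this]
  refine continuous_const.add ?_
  simp only [timeAvg_sub]
  refine Continuous.sub ?_ continuous_const
  have h1 := continuous_evalAt (0 : L2Square) v
  have h2 : (fun t => timeAvg (ind t) v) = fun t => evalAt t 0 v - initVal 0 v := by
    funext t
    rw [evalAt]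
    abel
  rw [h2]
  exact h1.sub continuous_const

theorem abs_inner_ind_le (x : I) (r : L2Space) : |inner ℝ (ind x) r| ≤ ‖r‖ :=
  (abs_real_inner_le_norm _ _).trans
    (mul_le_of_le_one_left (norm_nonneg _) (norm_ind_le x))

theorem coeFn_ind_sub {s t : I} (hst : s ≤ t) :
    (ind t - ind s : L2Space) =ᵐ[volume] (Ioc s t).indicator fun _ => (1 : ℝ) := by
  filter_upwards [Lp.coeFn_sub (ind t) (ind s), coeFn_ind t, coeFn_ind s] with x h1 h2 h3
  rw [h1, Pi.sub_apply, h2, h3]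
  by_cases hs : x ≤ s
  · simp [indicator, hs, hs.trans hst, not_lt.2 hs]
  · simp [indicator, hs, not_le.1 hs]

/-- On the time slab, `|v| ≤ exp(B) |p|`, and duality with Cauchy-Schwarz gives the square root of
the length. The bound is required only before time `t`, as suits an argument at a first exit time.
-/
theorem IsFlow.norm_sub_le {p v : L2Square} {R : I → L2Space} (h : IsFlow p v R) {s t : I}
    (hst : s ≤ t) {B : ℝ} (hB : ∀ τ, s ≤ τ → τ < t → ∀ x, inner ℝ (ind x) (R τ) ≤ B) :
    ‖R t - R s‖ ≤ Real.exp B * ‖p‖ * √((t : ℝ) - s) := by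
  have hk : ‖ind t - ind s‖ = √((t : ℝ) - s) := by
    rw [norm_ind_sub, abs_of_nonneg (sub_nonneg.2 (show (s : ℝ) ≤ t from hst))]
  rw [← hk]
  have key : ∀ g : L2Space, |inner ℝ (R t - R s) g| ≤
      Real.exp B * ‖p‖ * ‖ind t - ind s‖ * ‖g‖ := by
    intro g
    rw [h.sub_eq, inner_timeAvg_tensor, real_inner_L2]
    have h1 : ∀ᵐ z : Square, ‖v z * tensor (ind t - ind s) g z‖ ≤
        Real.exp B * ((|p| : L2Square) z * (|tensor (ind t - ind s) g| : L2Square) z) := by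
      have hne : ∀ᵐ τ : I, τ ≠ t := compl_mem_ae_iff.2 (measure_singleton t)
      filter_upwards [h.ode, coeFn_tensor (ind t - ind s) g, Lp.coeFn_abs p,
        Lp.coeFn_abs (tensor (ind t - ind s) g), ae_fst (coeFn_ind_sub hst), ae_fst hne]
        with z h1 h2 h3 h4 h5 h6
      rw [h3, h4, h2, h5, norm_mul, Real.norm_eq_abs, Real.norm_eq_abs]
      by_cases hz : z.1 ∈ Ioc s t
      · rw [h1, abs_mul, abs_of_pos (Real.exp_pos _), ← mul_assoc]
        gcongr
        exact hB _ hz.1.le (lt_of_le_of_ne hz.2 h6) _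
      · simp [hz]
    rw [← Real.norm_eq_abs]
    refine (norm_integral_le_integral_norm _).trans ?_
    refine (integral_mono_ae (integrable_mul_L2 _ _).norm
      ((integrable_mul_L2 _ _).const_mul _) h1).trans ?_
    rw [integral_const_mul, ← real_inner_L2, mul_assoc, mul_assoc]
    gcongr
    refine (real_inner_le_norm _ _).trans ?_
    rw [norm_abs_eq_norm, norm_abs_eq_norm, norm_tensor]
  have h2 := key (R t - R s)
  rw [real_inner_self_eq_norm_sq, abs_of_nonneg (sq_nonneg _), sq] at h2
  rcases (norm_nonneg (R t - R s)).eq_or_lt' with h0 | h0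
  · rw [h0]; positivity
  · exact le_of_mul_le_mul_right h2 h0

/-- Continuation argument: before the first time at which the displacement reaches `1`, the exponent
is at most `B + 1`, and then the previous estimate keeps the displacement below `1`. -/
theorem IsFlow.norm_sub_le_one {p v : L2Square} {R : I → L2Space} (h : IsFlow p v R) {T : I}
    {B δ : ℝ} (hB : ∀ x, inner ℝ (ind x) (R T) ≤ B) (hδ : Real.exp (B + 1) * ‖p‖ * √δ < 1)
    {t : I} (hTt : T ≤ t) (ht : (t : ℝ) ≤ T + δ) : ‖R t - R T‖ ≤ 1 := by
  by_contra! hcon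
  have hc := h.continuous
  set S : Set I := {τ | T ≤ τ ∧ 1 ≤ ‖R τ - R T‖} with hS
  have hcl : IsClosed S := (isClosed_le continuous_const continuous_id).inter
    (isClosed_le continuous_const (hc.sub continuous_const).norm)
  obtain ⟨t₀, ht₀, hmin⟩ := hcl.isCompact.exists_isLeast ⟨t, hTt, hcon.le⟩
  have h1 := h.norm_sub_le ht₀.1 (B := B + 1) fun τ h1 h2 x => by
    have h3 : ‖R τ - R T‖ < 1 := by
      by_contra! h4
      exact absurd (hmin ⟨h1, h4⟩) (not_le.2 h2)
    have h4 := abs_inner_ind_le x (R τ - R T)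
    rw [inner_sub_right] at h4
    linarith [le_abs_self (inner ℝ (ind x) (R τ) - inner ℝ (ind x) (R T)), hB x]
  have h2 : (t₀ : ℝ) ≤ t := hmin ⟨hTt, hcon.le⟩
  have h3 : √((t₀ : ℝ) - T) ≤ √δ := Real.sqrt_le_sqrt (by linarith)
  have h4 : Real.exp (B + 1) * ‖p‖ * √((t₀ : ℝ) - T) ≤ Real.exp (B + 1) * ‖p‖ * √δ := by gcongr
  linarith [ht₀.2]

theorem abs_inner_ind_sub_le (x y : I) (r : L2Space) :
    |inner ℝ (ind x) r - inner ℝ (ind y) r| ≤ √(dist x y) * ‖r‖ := by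
  rw [← inner_sub_left]
  refine (abs_real_inner_le_norm _ _).trans ?_
  rw [norm_ind_sub]
  rfl

theorem sqrt_mul_le_of_lt {a C ε : ℝ} (hC : 0 ≤ C) (hε : 0 < ε) (h : a < (ε / (C + 1)) ^ 2) :
    √a * C ≤ ε := by
  have h1 : √a ≤ ε / (C + 1) := by
    refine (Real.sqrt_le_sqrt h.le).trans ?_
    rw [Real.sqrt_sq (by positivity)]
  calc √a * C ≤ ε / (C + 1) * (C + 1) := by gcongr; linarith
    _ = ε := by field_simp

/-- Weak convergence along an ultrafilter gives no norm bound, so time is covered by steps of fixed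
length. A norm bound at the start of a step makes the primitives in space converge uniformly there.
The exponent is then controlled by the limit `R'`, not by the accumulated bound, so the step length
does not shrink. -/
theorem eventually_norm_flow_le {X : Type*} (U : Ultrafilter X) {p v : X → L2Square}
    {R : X → I → L2Space} {R' : I → L2Space} (hR' : Continuous R') {C₀ K : ℝ}
    (hflow : ∀ᶠ x in (U : Filter X), IsFlow (p x) (v x) (R x))
    (h0 : ∀ᶠ x in (U : Filter X), ‖R x 0‖ ≤ C₀) (hK : ∀ᶠ x in (U : Filter X), ‖p x‖ ≤ K)
    (hR : ∀ t h, Tendsto (fun x => inner ℝ h (R x t)) U (𝓝 (inner ℝ h (R' t)))) :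
    ∃ C, ∀ᶠ x in (U : Filter X), ∀ t, ‖R x t‖ ≤ C := by
  have hK0 : 0 ≤ K := by
    obtain ⟨x, hx⟩ := hK.exists
    exact (norm_nonneg _).trans hx
  obtain ⟨M, hM⟩ := isCompact_univ.exists_bound_of_continuousOn hR'.continuousOn
  -- One unit accounts for the distance to the limit at the start of a step, the other for the
  -- displacement allowed during it.
  set A := Real.exp (M + 1 + 1) * K with hA
  have hA0 : 0 ≤ A := by positivity
  set δ := (1 / (A + 1)) ^ 2 with hδ
  have hδ0 : 0 < δ := by positivity
  have hAδ : A * √δ < 1 := by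
    rw [hδ, Real.sqrt_sq (by positivity), mul_one_div, div_lt_one (by positivity)]
    linarith
  have hind : ∀ k : ℕ, ∃ C, ∀ᶠ x in (U : Filter X), ∀ t : I, (t : ℝ) ≤ k * δ → ‖R x t‖ ≤ C := by
    intro k
    induction k with
    | zero =>
      refine ⟨C₀, h0.mono fun x hx t ht => ?_⟩
      have : t = 0 := Subtype.ext (le_antisymm (by simpa using ht) t.2.1)
      rwa [this]
    | succ k ih =>
      obtain ⟨C, hC⟩ := ih
      have hkδ : 0 ≤ k * δ := by positivity
      -- The truncation at `1` is harmless: if some `t` lies beyond `k * δ`, then `T` equals `k *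
      -- δ`.
      let T : I := ⟨min (k * δ) 1, le_min hkδ zero_le_one, min_le_right _ _⟩
      have hTk : (T : ℝ) ≤ k * δ := min_le_left _ _
      have hC0 : 0 ≤ C := by
        obtain ⟨x, hx⟩ := hC.exists
        exact (norm_nonneg _).trans (hx T hTk)
      have hunif : ∀ᶠ x in (U : Filter X), ∀ y,
          |inner ℝ (ind y) (R x T) - inner ℝ (ind y) (R' T)| ≤ 1 := by
        refine eventually_forall_abs_sub_le (fun ε hε => ?_) (fun y => hR T (ind y)) one_pos
        refine ⟨(ε / (C + 1)) ^ 2, by positivity, hC.mono fun x hx y y' hy => ?_⟩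
        refine (abs_inner_ind_sub_le y y' _).trans ?_
        refine le_trans ?_ (sqrt_mul_le_of_lt hC0 hε hy)
        gcongr
        exact hx T hTk
      refine ⟨C + 1, ?_⟩
      filter_upwards [hC, hunif, hflow, hK] with x h1 h2 h3 h4 t ht
      by_cases htk : (t : ℝ) ≤ k * δ
      · linarith [h1 t htk]
      have hTeq : (T : ℝ) = k * δ := min_eq_left ((not_le.1 htk).le.trans t.2.2)
      have h5 : ‖R x t - R x T‖ ≤ 1 := by
        refine h3.norm_sub_le_one (B := M + 1) (δ := δ) (fun y => ?_) ?_ ?_ ?_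
        · have h6 := (abs_inner_ind_le y (R' T)).trans (hM T trivial)
          linarith [(abs_le.1 h6).2, (abs_le.1 (h2 y)).2]
        · refine lt_of_le_of_lt ?_ hAδ
          rw [hA]
          gcongr
        · change (T : ℝ) ≤ t
          rw [hTeq]
          exact (not_le.1 htk).le
        · rw [hTeq]
          push_cast at ht
          linarith
      have h6 := norm_add_le (R x t - R x T) (R x T)
      rw [sub_add_cancel] at h6
      linarith [h1 T hTk]
  obtain ⟨k, hk⟩ := exists_nat_ge (1 / δ)
  obtain ⟨C, hC⟩ := hind k
  refine ⟨C, hC.mono fun x hx t => hx t (t.2.2.trans ?_)⟩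
  rwa [div_le_iff₀ hδ0] at hk

/-- The function `(t,x) ↦ ∫₀ˣ R(t)`. -/
def logEta (R : I → L2Space) (hR : Continuous R) : C(Square, ℝ) :=
  ⟨fun z => inner ℝ (ind z.2) (R z.1),
    (continuous_ind.comp continuous_snd).inner (hR.comp continuous_fst)⟩

/-- The norm bound makes the primitives Hölder-1/2 in space, and with the equation also in time,
uniformly along the ultrafilter. Pointwise convergence is then uniform. -/
theorem eventually_abs_logEta_sub_le {X : Type*} (U : Ultrafilter X) {p v : X → L2Square}
    {R : X → I → L2Space} {R' : I → L2Space} (hR' : Continuous R') {C₀ K : ℝ}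
    (hflow : ∀ᶠ x in (U : Filter X), IsFlow (p x) (v x) (R x))
    (h0 : ∀ᶠ x in (U : Filter X), ‖R x 0‖ ≤ C₀) (hK : ∀ᶠ x in (U : Filter X), ‖p x‖ ≤ K)
    (hR : ∀ t h, Tendsto (fun x => inner ℝ h (R x t)) U (𝓝 (inner ℝ h (R' t))))
    {ε : ℝ} (hε : 0 < ε) :
    ∀ᶠ x in (U : Filter X), ∀ z : Square,
      |inner ℝ (ind z.2) (R x z.1) - inner ℝ (ind z.2) (R' z.1)| ≤ ε := by
  obtain ⟨C, hC⟩ := eventually_norm_flow_le U hR' hflow h0 hK hR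
  have hK0 : 0 ≤ K := by
    obtain ⟨x, hx⟩ := hK.exists
    exact (norm_nonneg _).trans hx
  have hC0 : 0 ≤ C := by
    obtain ⟨x, hx⟩ := hC.exists
    exact (norm_nonneg _).trans (hx 0)
  refine eventually_forall_abs_sub_le (fun ε hε => ?_) (fun z : Square => hR z.1 (ind z.2)) hε
  set A := Real.exp C * K with hA
  have hA0 : 0 ≤ A := by positivity
  refine ⟨min ((ε / 2 / (C + 1)) ^ 2) ((ε / 2 / (A + 1)) ^ 2), by positivity, ?_⟩
  filter_upwards [hC, hflow, hK] with x h1 h2 h3 z z' hz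
  have hz1 : dist z.1 z'.1 < (ε / 2 / (A + 1)) ^ 2 :=
    (le_max_left _ _).trans_lt (hz.trans_le (min_le_right _ _))
  have hz2 : dist z.2 z'.2 < (ε / 2 / (C + 1)) ^ 2 :=
    (le_max_right _ _).trans_lt (hz.trans_le (min_le_left _ _))
  have h4 : |inner ℝ (ind z.2) (R x z.1) - inner ℝ (ind z'.2) (R x z.1)| ≤ ε / 2 := by
    refine (abs_inner_ind_sub_le _ _ _).trans ?_
    refine le_trans ?_ (sqrt_mul_le_of_lt hC0 (by positivity) hz2)
    gcongr
    exact h1 _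
  have hlip : ∀ s t : I, s ≤ t → ‖R x t - R x s‖ ≤ √(dist s t) * A := by
    intro s t hst
    have h5 := h2.norm_sub_le hst (B := C) fun τ _ _ y =>
      (le_abs_self _).trans ((abs_inner_ind_le y _).trans (h1 τ))
    have h6 : dist s t = (t : ℝ) - s := by
      rw [dist_comm]
      exact abs_of_nonneg (sub_nonneg.2 (show (s : ℝ) ≤ t from hst))
    rw [h6, mul_comm, hA]
    refine h5.trans ?_
    gcongr
  have h5 : |inner ℝ (ind z'.2) (R x z.1) - inner ℝ (ind z'.2) (R x z'.1)| ≤ ε / 2 := by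
    rw [← inner_sub_right]
    refine (abs_inner_ind_le _ _).trans (le_trans ?_
      (sqrt_mul_le_of_lt hA0 (by positivity) hz1))
    rcases le_total z.1 z'.1 with h | h
    · rw [norm_sub_rev]
      exact hlip _ _ h
    · rw [dist_comm]
      exact hlip _ _ h
  have := abs_sub_le (inner ℝ (ind z.2) (R x z.1)) (inner ℝ (ind z'.2) (R x z.1))
    (inner ℝ (ind z'.2) (R x z'.1))
  linarith

/-! ### Limits of curves -/

section Mul

variable {α : Type*} [MeasureSpace α] [TopologicalSpace α] [CompactSpace α]
  [OpensMeasurableSpace α]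

/-- The product of a continuous function and a square integrable function. -/
def mulLp (f : C(α, ℝ)) (u : Lp ℝ 2 (volume : Measure α)) : Lp ℝ 2 (volume : Measure α) :=
  (memLp_continuous_mul f u).toLp _

theorem coeFn_mulLp (f : C(α, ℝ)) (u : Lp ℝ 2 (volume : Measure α)) :
    mulLp f u =ᵐ[volume] fun z => f z * u z := (memLp_continuous_mul f u).coeFn_toLp

theorem inner_mulLp (f : C(α, ℝ)) (u v : Lp ℝ 2 (volume : Measure α)) :
    inner ℝ (mulLp f u) v = ∫ z, f z * v z * u z := by
  rw [real_inner_L2]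
  refine integral_congr_ae ?_
  filter_upwards [coeFn_mulLp f u] with z hz
  rw [hz]
  ring

theorem norm_mulLp_le (f : C(α, ℝ)) (u : Lp ℝ 2 (volume : Measure α)) :
    ‖mulLp f u‖ ≤ ‖f‖ * ‖u‖ := by
  refine Lp.norm_le_mul_norm_of_ae_le_mul ?_
  filter_upwards [coeFn_mulLp f u] with z hz
  rw [hz, norm_mul]
  gcongr
  exact f.norm_coe_le_norm z

theorem mulLp_sub (f g : C(α, ℝ)) (u : Lp ℝ 2 (volume : Measure α)) :
    mulLp (f - g) u = mulLp f u - mulLp g u := by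
  refine Lp.ext ?_
  filter_upwards [coeFn_mulLp (f - g) u, coeFn_mulLp f u, coeFn_mulLp g u,
    Lp.coeFn_sub (mulLp f u) (mulLp g u)] with z h1 h2 h3 h4
  rw [h1, h4, Pi.sub_apply, h2, h3, ContinuousMap.sub_apply, sub_mul]

/-- The integral of a product of a uniformly convergent factor and a weakly convergent one. -/
theorem tendsto_integral_mul {X : Type*} {l : Filter X} {E : X → C(α, ℝ)} {E' : C(α, ℝ)}
    (hE : Tendsto E l (𝓝 E')) {p : X → Lp ℝ 2 (volume : Measure α)}
    {p' : Lp ℝ 2 (volume : Measure α)} {K : ℝ} (hK : ∀ᶠ x in l, ‖p x‖ ≤ K)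
    (hp : ∀ g, Tendsto (fun x => inner ℝ g (p x)) l (𝓝 (inner ℝ g p')))
    (g : Lp ℝ 2 (volume : Measure α)) :
    Tendsto (fun x => ∫ z, E x z * p x z * g z) l (𝓝 (∫ z, E' z * p' z * g z)) := by
  simp only [← inner_mulLp]
  -- The continuous factor is moved onto the test function, where uniform convergence becomes
  -- convergence in norm.
  have h1 : Tendsto (fun x => inner ℝ (mulLp (E x - E') g) (p x)) l (𝓝 0) := by
    have h2 : Tendsto (fun x => ‖E x - E'‖ * ‖g‖ * K) l (𝓝 (0 * ‖g‖ * K)) :=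
      ((tendsto_iff_norm_sub_tendsto_zero.1 hE).mul_const _).mul_const _
    rw [zero_mul, zero_mul] at h2
    refine squeeze_zero_norm' (hK.mono fun x hx => ?_) h2
    refine (norm_inner_le_norm _ _).trans ?_
    gcongr
    exact norm_mulLp_le _ _
  have h3 := h1.add (hp (mulLp E' g))
  rw [zero_add] at h3
  refine h3.congr fun x => ?_
  rw [mulLp_sub, inner_sub_left]
  ring

end Mul

/-- The primitive in space of a square integrable function. -/
def primMap (r : L2Space) : C(I, ℝ) :=
  ⟨fun x => inner ℝ (ind x) r, continuous_ind.inner continuous_const⟩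

theorem continuous_primMap : Continuous primMap := by
  refine (LipschitzWith.of_dist_le' (K := 1) fun r r' => ?_).continuous
  rw [one_mul, ContinuousMap.dist_le dist_nonneg]
  intro x
  rw [dist_eq_norm r r', Real.dist_eq]
  change |inner ℝ (ind x) r - inner ℝ (ind x) r'| ≤ _
  rw [← inner_sub_right]
  exact abs_inner_ind_le _ _

/-- The exponential of a continuous function. -/
def expMap {α : Type*} [TopologicalSpace α] (f : C(α, ℝ)) : C(α, ℝ) :=
  (⟨Real.exp, Real.continuous_exp⟩ : C(ℝ, ℝ)).comp f

theorem continuous_expMap {α : Type*} [TopologicalSpace α] :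
    Continuous (expMap : C(α, ℝ) → C(α, ℝ)) := ContinuousMap.continuous_postcomp _

theorem eta_eq_expMap (r : L2Space) (x : I) : eta r x = expMap (primMap r) x := eta_L2 r x

/-- The class in `L²([0,1])` of a continuous function. -/
def toL2 (f : C(I, ℝ)) : L2Space := ContinuousMap.toLp 2 volume ℝ f

theorem continuous_toL2 : Continuous toL2 :=
  (ContinuousMap.toLp (E := ℝ) 2 (volume : Measure I) ℝ).continuous

theorem coeFn_toL2 (f : C(I, ℝ)) : toL2 f =ᵐ[volume] f := ContinuousMap.coeFn_toLp _ _

theorem phi_eq_primMap (r : L2Space) (x : I) :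
    phi r x = primMap (toL2 (expMap (primMap r))) x := by
  change _ = inner ℝ (ind x) (toL2 (expMap (primMap r)))
  rw [inner_ind, phi]
  refine integral_congr_ae (ae_restrict_of_ae ?_)
  filter_upwards [coeFn_toL2 (expMap (primMap r))] with y hy
  rw [hy, eta_eq_expMap]

theorem inner_ind_one (r : L2Space) : inner ℝ (ind 1) r = ∫ x, r x := by
  rw [real_inner_L2]
  refine integral_congr_ae ?_
  filter_upwards [coeFn_ind_one] with x hx
  rw [hx, one_mul]

theorem integral_mul_mul_ind_one (f g : I → ℝ) :
    ∫ x, f x * g x * ind 1 x = ∫ x, f x * g x := by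
  refine integral_congr_ae ?_
  filter_upwards [coeFn_ind_one] with x hx
  rw [hx, mul_one]

theorem mem_Q_iff (r : L2Space) : r ∈ Q ↔ inner ℝ (ind 1) r = 0 ∧
    inner ℝ (ind 1) (toL2 (expMap (primMap r))) = 1 := by
  rw [inner_ind_one, inner_ind_one, integral_congr_ae (coeFn_toL2 _)]
  simp only [Q, Set.mem_ofPred_eq, eta_eq_expMap]

/-- The inserted factor `ind 1`, equal to `1` almost everywhere, puts the constraints in the form
handled by `tendsto_integral_mul`. -/
theorem mem_cotangent_iff (r p : L2Space) : p ∈ cotangent r ↔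
    ∫ x, expMap (primMap r) x * p x * ind 1 x = 0 ∧
    ∫ x, (expMap (primMap r) * primMap (toL2 (expMap (primMap r)))) x * p x * ind 1 x = 0 := by
  rw [integral_mul_mul_ind_one, integral_mul_mul_ind_one]
  simp only [cotangent, Set.mem_ofPred_eq, eta_eq_expMap, phi_eq_primMap, ContinuousMap.mul_apply,
    mul_assoc]

theorem IsContinuousRep.eta_eq {u : L2Square} {R : I → L2Space} (h : IsContinuousRep u R) :
    ∀ᵐ z : Square, eta (fun x => u (z.1, x)) z.2 = Real.exp (inner ℝ (ind z.2) (R z.1)) := by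
  filter_upwards [ae_fst h.2] with z hz
  rw [← eta_L2, eta, eta, integral_congr_ae (ae_restrict_of_ae hz)]

/-- Pairing a value at time `t` with `h` amounts to pairing `(u, u̇)` with fixed elements of `L²` of
the square. -/
theorem tendsto_inner_evalAt {X : Type*} {l : Filter X} {u v : X → L2Square} {u' v' : L2Square}
    (hu : ∀ g, Tendsto (fun x => inner ℝ g (u x)) l (𝓝 (inner ℝ g u')))
    (hv : ∀ g, Tendsto (fun x => inner ℝ g (v x)) l (𝓝 (inner ℝ g v'))) (t : I) (h : L2Space) :
    Tendsto (fun x => inner ℝ h (evalAt t (u x) (v x))) l (𝓝 (inner ℝ h (evalAt t u' v'))) := by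
  have key : ∀ u v : L2Square, inner ℝ h (evalAt t u v) = inner ℝ (tensor (ind 1) h) u +
      inner ℝ (tensor subOne h) v + inner ℝ (tensor (ind t) h) v := fun u v => by
    rw [real_inner_comm, evalAt, initVal, inner_add_left, inner_add_left, inner_timeAvg_tensor,
      inner_timeAvg_tensor, inner_timeAvg_tensor, real_inner_comm, real_inner_comm _ v, real_inner_comm _ v]
  simp only [key]
  exact ((hu _).add (hv _)).add (hv _)

/-- The time-continuous representative of an element of `H¹`. -/
def H1.rep (p : H1) (t : I) : L2Space := evalAt t (H1.fn p) (H1.dot p)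

/-- The time-continuous representative of an element of `H²`. -/
def H2.rep (q : H2) (t : I) : L2Space := evalAt t (H2.fn q) (H2.dot q)

theorem H1.isContinuousRep (p : H1) : IsContinuousRep (H1.fn p) (H1.rep p) := isContinuousRep_evalAt p.2

theorem H2.isContinuousRep (q : H2) : IsContinuousRep (H2.fn q) (H2.rep q) := isContinuousRep_evalAt q.2.1

theorem IsCurve.eq_rep {p : H1} {q : H2} {P R : I → L2Space} (h : IsCurve p q P R) :
    P = (H1.rep p) ∧ R = (H2.rep q) :=
  ⟨h.rep_p.unique (H1.isContinuousRep p), h.rep_q.unique (H2.isContinuousRep q)⟩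

theorem isFlow_iff (p : H1) (q : H2) : IsFlow (H1.fn p) (H2.dot q) (H2.rep q) ↔
    ∀ᵐ z : Square, (H2.dot q) z = eta (fun u => (H2.fn q) (z.1, u)) z.2 * (H1.fn p) z := by
  constructor
  · intro h
    filter_upwards [h.ode, (H2.isContinuousRep q).eta_eq] with z h1 h2
    rw [h1, h2]
  · intro h
    refine ⟨fun s t => evalAt_sub s t _ _, ?_⟩
    filter_upwards [h, (H2.isContinuousRep q).eta_eq] with z h1 h2
    rw [h1, h2]

/-- Each nonlinear relation involves `q` only through its primitive in space, which converges
uniformly, and is linear in the weakly convergent `p` or does not involve it. -/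
theorem isCurve_of_tendsto {X : Type*} (U : Ultrafilter X) {p : X → H1} {q : X → H2} {p' : H1}
    {q' : H2} {K : ℝ}
    (hp : ∀ g, Tendsto (fun x => inner ℝ g (H1.fn (p x))) U (𝓝 (inner ℝ g (H1.fn p'))))
    (hpd : ∀ g, Tendsto (fun x => inner ℝ g (H1.dot (p x))) U (𝓝 (inner ℝ g (H1.dot p'))))
    (hq : ∀ g, Tendsto (fun x => inner ℝ g (H2.fn (q x))) U (𝓝 (inner ℝ g (H2.fn q'))))
    (hqd : ∀ g, Tendsto (fun x => inner ℝ g (H2.dot (q x))) U (𝓝 (inner ℝ g (H2.dot q'))))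
    (hK : ∀ᶠ x in (U : Filter X), ‖(H1.fn (p x))‖ ≤ K ∧ ‖(H1.dot (p x))‖ ≤ K) {q₀ : L2Space}
    (hc : ∀ᶠ x in (U : Filter X), IsCurve (p x) (q x) (H1.rep (p x)) (H2.rep (q x)) ∧ (H2.rep (q x)) 0 = q₀) :
    IsCurve p' q' (H1.rep p') (H2.rep q') := by
  have hP : ∀ t g, Tendsto (fun x => inner ℝ g ((H1.rep (p x)) t)) U (𝓝 (inner ℝ g ((H1.rep p') t))) :=
    tendsto_inner_evalAt hp hpd
  have hR : ∀ t g, Tendsto (fun x => inner ℝ g ((H2.rep (q x)) t)) U (𝓝 (inner ℝ g ((H2.rep q') t))) :=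
    tendsto_inner_evalAt hq hqd
  have hflow : ∀ᶠ x in (U : Filter X), IsFlow (H1.fn (p x)) (H2.dot (q x)) (H2.rep (q x)) :=
    hc.mono fun x hx => (isFlow_iff _ _).2 hx.1.ode
  have hunif : ∀ ε > 0, ∀ᶠ x in (U : Filter X), ∀ z : Square,
      |inner ℝ (ind z.2) ((H2.rep (q x)) z.1) - inner ℝ (ind z.2) ((H2.rep q') z.1)| ≤ ε := fun ε hε =>
    eventually_abs_logEta_sub_le U (H2.isContinuousRep q').1 hflow
      (hc.mono fun x hx => (congrArg norm hx.2).le) (hK.mono fun x hx => hx.1) hR hε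
  have hprim : ∀ t, Tendsto (fun x => expMap (primMap ((H2.rep (q x)) t))) U
      (𝓝 (expMap (primMap ((H2.rep q') t)))) := fun t => by
    refine (continuous_expMap.tendsto _).comp (Metric.tendsto_nhds.2 fun ε hε => ?_)
    filter_upwards [hunif (ε / 2) (by positivity)] with x hx
    refine lt_of_le_of_lt ((ContinuousMap.dist_le (by positivity)).2 fun y => hx (t, y)) ?_
    linarith
  have hlog : Tendsto (fun x => expMap (logEta (H2.rep (q x)) (H2.isContinuousRep (q x)).1)) U
      (𝓝 (expMap (logEta (H2.rep q') (H2.isContinuousRep q').1))) := by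
    refine (continuous_expMap.tendsto _).comp (Metric.tendsto_nhds.2 fun ε hε => ?_)
    filter_upwards [hunif (ε / 2) (by positivity)] with x hx
    refine lt_of_le_of_lt ((ContinuousMap.dist_le (by positivity)).2 hx) ?_
    linarith
  have hKt : ∀ t, ∀ᶠ x in (U : Filter X), ‖(H1.rep (p x)) t‖ ≤ K + 2 * K := fun t =>
    hK.mono fun x hx => (norm_evalAt_le t _ _).trans (by linarith [hx.1, hx.2])
  refine ⟨(H1.isContinuousRep p'), (H2.isContinuousRep q'), fun t => ?_, fun t => ?_,
    (isFlow_iff p' q').1 ⟨fun s t => evalAt_sub s t _ _, ?_⟩⟩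
  · rw [mem_Q_iff]
    constructor
    · refine tendsto_nhds_unique (hR t (ind 1)) (tendsto_const_nhds.congr' ?_)
      exact hc.mono fun x hx => ((mem_Q_iff _).1 (hx.1.mem_Q t)).1.symm
    · have h1 : Tendsto (fun x => inner ℝ (ind 1) (toL2 (expMap (primMap ((H2.rep (q x)) t))))) U
          (𝓝 (inner ℝ (ind 1) (toL2 (expMap (primMap ((H2.rep q') t)))))) :=
        tendsto_const_nhds.inner ((continuous_toL2.tendsto _).comp (hprim t))
      refine tendsto_nhds_unique h1 (tendsto_const_nhds.congr' ?_)
      exact hc.mono fun x hx => ((mem_Q_iff _).1 (hx.1.mem_Q t)).2.symm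
  · rw [mem_cotangent_iff]
    constructor
    · refine tendsto_nhds_unique (tendsto_integral_mul (hprim t) (hKt t) (hP t) (ind 1))
        (tendsto_const_nhds.congr' ?_)
      exact hc.mono fun x hx => ((mem_cotangent_iff _ _).1 (hx.1.mem_cotangent t)).1.symm
    · have h1 := (hprim t).mul (((continuous_primMap.comp continuous_toL2).tendsto _).comp
        (hprim t))
      refine tendsto_nhds_unique (tendsto_integral_mul h1 (hKt t) (hP t) (ind 1))
        (tendsto_const_nhds.congr' ?_)
      exact hc.mono fun x hx => ((mem_cotangent_iff _ _).1 (hx.1.mem_cotangent t)).2.symm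
  · have h1 : (H2.dot q') = mulLp (expMap (logEta (H2.rep q') (H2.isContinuousRep q').1)) (H1.fn p') := by
      refine ext_inner_left ℝ fun g => ?_
      rw [real_inner_comm (mulLp _ _), inner_mulLp]
      refine tendsto_nhds_unique (hqd g) ?_
      have h2 := tendsto_integral_mul hlog (hK.mono fun x hx => hx.1) hp g
      simp only [mul_right_comm _ _ (g _)] at h2 ⊢
      refine h2.congr' (hflow.mono fun x hx => ?_)
      change _ = inner ℝ g (H2.dot (q x))
      rw [real_inner_L2]
      refine integral_congr_ae ?_
      filter_upwards [hx.ode] with z hz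
      rw [hz]
      exact mul_right_comm _ _ _ |>.trans (mul_comm _ _)
    filter_upwards [coeFn_mulLp (expMap (logEta (H2.rep q') (H2.isContinuousRep q').1)) (H1.fn p')] with z hz
    rw [h1, hz]
    rfl

/-! ### Convergence in the space of relaxed curves -/

instance (w : RelaxedSpace) : IsFiniteMeasure w.μ :=
  inferInstanceAs (IsFiniteMeasure (w.2.2.1 : Measure Square))

instance (w : RelaxedSpace) : IsFiniteMeasure w.ν :=
  inferInstanceAs (IsFiniteMeasure (w.2.2.2 : Measure Square))

theorem RelaxedSpace.continuous_p (ℓ : H1 →L[ℝ] ℝ) : Continuous fun w : RelaxedSpace => ℓ w.p :=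
  (WeakBilin.eval_continuous (topDualPairing ℝ H1).flip ℓ).comp continuous_fst

theorem RelaxedSpace.continuous_q (ℓ : H2 →L[ℝ] ℝ) : Continuous fun w : RelaxedSpace => ℓ w.q :=
  (WeakBilin.eval_continuous (topDualPairing ℝ H2).flip ℓ).comp (continuous_fst.comp continuous_snd)

theorem RelaxedSpace.continuous_inner_p (g : L2Square) :
    Continuous fun w : RelaxedSpace => inner ℝ g (H1.fn w.p) :=
  RelaxedSpace.continuous_p ((innerSL ℝ g).comp
    ((ContinuousLinearMap.fst ℝ L2Square L2Square).comp H1.subtypeL))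

theorem RelaxedSpace.continuous_inner_dot_p (g : L2Square) :
    Continuous fun w : RelaxedSpace => inner ℝ g (H1.dot w.p) :=
  RelaxedSpace.continuous_p ((innerSL ℝ g).comp
    ((ContinuousLinearMap.snd ℝ L2Square L2Square).comp H1.subtypeL))

theorem RelaxedSpace.continuous_inner_q (g : L2Square) :
    Continuous fun w : RelaxedSpace => inner ℝ g (H2.fn w.q) :=
  RelaxedSpace.continuous_q ((innerSL ℝ g).comp
    ((ContinuousLinearMap.fst ℝ L2Square (L2Square × L2Square)).comp H2.subtypeL))

theorem RelaxedSpace.continuous_inner_dot_q (g : L2Square) :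
    Continuous fun w : RelaxedSpace => inner ℝ g (H2.dot w.q) :=
  RelaxedSpace.continuous_q ((innerSL ℝ g).comp
    ((ContinuousLinearMap.fst ℝ L2Square L2Square).comp
      ((ContinuousLinearMap.snd ℝ L2Square (L2Square × L2Square)).comp H2.subtypeL)))

theorem RelaxedSpace.continuous_integral_μ (f : C(Square, ℝ)) :
    Continuous fun w : RelaxedSpace => ∫ z, f z ∂w.μ :=
  (FiniteMeasure.continuous_integral_boundedContinuousFunction
    (BoundedContinuousFunction.mkOfCompact f)).comp
      (continuous_fst.comp (continuous_snd.comp continuous_snd))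

theorem RelaxedSpace.continuous_integral_ν (f : C(Square, ℝ)) :
    Continuous fun w : RelaxedSpace => ∫ z, f z ∂w.ν :=
  (FiniteMeasure.continuous_integral_boundedContinuousFunction
    (BoundedContinuousFunction.mkOfCompact f)).comp
      (continuous_snd.comp (continuous_snd.comp continuous_snd))

theorem norm_sq_le_of_sqMeasure_le {u : L2Square} {μ : Measure Square} [IsFiniteMeasure μ]
    (h : sqMeasure u ≤ μ) : ‖u‖ ^ 2 ≤ μ.real univ := by
  have h1 := integral_sqMeasure (aemeasurable_L2 u) 1
  have h2 : (sqMeasure u).real univ ≤ μ.real univ :=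
    ENNReal.toReal_mono (measure_ne_top _ _) (h univ)
  simp only [Pi.one_apply, integral_const, smul_eq_mul, mul_one, one_mul] at h1
  rwa [norm_sq_L2, ← h1]

/-- A limit of relaxed curves along an ultrafilter. -/
theorem exists_limit_relaxed {U : Ultrafilter RelaxedSpace} {w' : RelaxedSpace}
    (hU : (U : Filter RelaxedSpace) ≤ 𝓝 w') {q₀ : L2Space}
    {m : RelaxedSpace → I → FiniteMeasure I}
    (h : ∀ᶠ w in (U : Filter RelaxedSpace), IsCurve w.p w.q (H1.rep w.p) (H2.rep w.q) ∧
      H2.rep w.q 0 = q₀ ∧ IsRelaxation w.p w.μ w.ν ∧ IsDisintegration w.μ (m w)) :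
    IsCurve w'.p w'.q (H1.rep w'.p) (H2.rep w'.q) ∧ IsRelaxation w'.p w'.μ w'.ν ∧
      (∀ t a, (∀ᶠ w in (U : Filter RelaxedSpace), H1.rep w.p t = a) → H1.rep w'.p t = a) ∧
      (∀ t a, (∀ᶠ w in (U : Filter RelaxedSpace), H2.rep w.q t = a) → H2.rep w'.q t = a) ∧
      ∃ m' : I → FiniteMeasure I, IsDisintegration w'.μ m' ∧
        ∀ t (n : Measure I), (∀ᶠ w in (U : Filter RelaxedSpace), (m w t : Measure I) = n) →
          (m' t : Measure I) = n := by
  have hp := fun g => ((RelaxedSpace.continuous_inner_p g).tendsto w').mono_left hU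
  have hpd := fun g => ((RelaxedSpace.continuous_inner_dot_p g).tendsto w').mono_left hU
  have hq := fun g => ((RelaxedSpace.continuous_inner_q g).tendsto w').mono_left hU
  have hqd := fun g => ((RelaxedSpace.continuous_inner_dot_q g).tendsto w').mono_left hU
  have hμ := fun f => ((RelaxedSpace.continuous_integral_μ f).tendsto w').mono_left hU
  have hν := fun f => ((RelaxedSpace.continuous_integral_ν f).tendsto w').mono_left hU
  have hμ1 := hμ 1
  have hν1 := hν 1
  simp only [ContinuousMap.one_apply, integral_const, smul_eq_mul, mul_one] at hμ1 hν1
  obtain ⟨C, hC⟩ : ∃ C, ∀ᶠ w in (U : Filter RelaxedSpace),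
      w.μ.real univ ≤ C ∧ w.ν.real univ ≤ C := by
    refine ⟨max (w'.μ.real univ) (w'.ν.real univ) + 1, ?_⟩
    filter_upwards [hμ1.eventually_le_const (lt_add_one _), hν1.eventually_le_const (lt_add_one _)]
      with w h1 h2
    exact ⟨h1.trans (by gcongr; exact le_max_left _ _), h2.trans (by gcongr; exact le_max_right _ _)⟩
  -- Boundedness comes from `p² ≤ μ` and `ṗ² ≤ ν`; it does not follow from weak convergence along an
  -- ultrafilter.
  have hK : ∀ᶠ w in (U : Filter RelaxedSpace), ‖H1.fn w.p‖ ≤ √C ∧ ‖H1.dot w.p‖ ≤ √C := by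
    filter_upwards [hC, h] with w h1 h2
    exact ⟨Real.le_sqrt_of_sq_le ((norm_sq_le_of_sqMeasure_le h2.2.2.1.sq_le).trans h1.1),
      Real.le_sqrt_of_sq_le ((norm_sq_le_of_sqMeasure_le h2.2.2.1.sq_dot_le).trans h1.2)⟩
  obtain ⟨m', hm', hlim⟩ := exists_limit_disintegration U hμ hC
    (h.mono fun w hw => hw.2.2.1.exists_dominates) (h.mono fun w hw => hw.2.2.2)
  refine ⟨isCurve_of_tendsto U hp hpd hq hqd hK (h.mono fun w hw => ⟨hw.1, hw.2.1⟩),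
    isRelaxation_of_tendsto U hp hpd hμ hν (h.mono fun w hw => hw.2.2.1),
    fun t a ha => ?_, fun t a ha => ?_, m', hm', fun t n hn => ?_⟩
  · refine ext_inner_left ℝ fun g => tendsto_nhds_unique (tendsto_inner_evalAt hp hpd t g) ?_
    exact tendsto_const_nhds.congr' (ha.mono fun w hw => congrArg (inner ℝ g) hw.symm)
  · refine ext_inner_left ℝ fun g => tendsto_nhds_unique (tendsto_inner_evalAt hq hqd t g) ?_
    exact tendsto_const_nhds.congr' (ha.mono fun w hw => congrArg (inner ℝ g) hw.symm)
  · obtain ⟨w, hw⟩ := hn.exists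
    rw [← hw]
    refine congrArg _ (tendsto_nhds_unique (hlim t) (tendsto_const_nhds.congr' ?_))
    exact hn.mono fun x hx => Subtype.ext (hw.trans hx.symm)

/-! ### Closedness of the two sets of relaxed curves. -/

theorem isClosed_relaxedCurves0 (p₀ q₀ : L2Space) : IsClosed (relaxedCurves0 p₀ q₀) := by
  refine isClosed_iff_ultrafilter.2 fun w' U hU hmem => ?_
  have hmem' : ∀ᶠ w in (U : Filter RelaxedSpace), ∃ m : I → FiniteMeasure I,
      IsCurve w.p w.q (H1.rep w.p) (H2.rep w.q) ∧ H1.rep w.p 0 = p₀ ∧ H2.rep w.q 0 = q₀ ∧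
        IsRelaxation w.p w.μ w.ν ∧ IsDisintegration w.μ m ∧
        (m 0 : Measure I) = sqMeasure p₀ := by
    filter_upwards [hmem] with w ⟨⟨P, R, h1, h2, h3⟩, h4, m, h5, h6⟩
    obtain ⟨rfl, rfl⟩ := h1.eq_rep
    exact ⟨m, h1, h2, h3, h4, h5, h6⟩
  -- A disintegration is chosen for every curve, so that the paths form one family to be followed
  -- along the ultrafilter.
  obtain ⟨m, hm⟩ := hmem'.choice
  obtain ⟨h1, h2, h3, h4, m', h5, h6⟩ := exists_limit_relaxed hU
    (hm.mono fun w hw => ⟨hw.1, hw.2.2.1, hw.2.2.2.1, hw.2.2.2.2.1⟩)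
  exact ⟨⟨_, _, h1, h3 0 p₀ (hm.mono fun w hw => hw.2.1),
    h4 0 q₀ (hm.mono fun w hw => hw.2.2.1)⟩, h2, m', h5,
    h6 0 _ (hm.mono fun w hw => hw.2.2.2.2.2)⟩

theorem isClosed_relaxedCurves01 (p₀ q₀ p₁ q₁ : L2Space) :
    IsClosed (relaxedCurves01 p₀ q₀ p₁ q₁) := by
  refine isClosed_iff_ultrafilter.2 fun w' U hU hmem => ?_
  have hmem' : ∀ᶠ w in (U : Filter RelaxedSpace), ∃ m : I → FiniteMeasure I,
      IsCurve w.p w.q (H1.rep w.p) (H2.rep w.q) ∧ (H1.rep w.p 0 = p₀ ∧ H2.rep w.q 0 = q₀ ∧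
        H1.rep w.p 1 = p₁ ∧ H2.rep w.q 1 = q₁) ∧
        IsRelaxation w.p w.μ w.ν ∧ IsDisintegration w.μ m ∧
        (m 0 : Measure I) = sqMeasure p₀ ∧ (m 1 : Measure I) = sqMeasure p₁ := by
    filter_upwards [hmem] with w ⟨⟨P, R, h1, h2⟩, h4, m, h5, h6⟩
    obtain ⟨rfl, rfl⟩ := h1.eq_rep
    exact ⟨m, h1, h2, h4, h5, h6⟩
  obtain ⟨m, hm⟩ := hmem'.choice
  obtain ⟨h1, h2, h3, h4, m', h5, h6⟩ := exists_limit_relaxed hU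
    (hm.mono fun w hw => ⟨hw.1, hw.2.1.2.1, hw.2.2.1, hw.2.2.2.1⟩)
  exact ⟨⟨_, _, h1, h3 0 p₀ (hm.mono fun w hw => hw.2.1.1),
    h4 0 q₀ (hm.mono fun w hw => hw.2.1.2.1), h3 1 p₁ (hm.mono fun w hw => hw.2.1.2.2.1),
    h4 1 q₁ (hm.mono fun w hw => hw.2.1.2.2.2)⟩, h2, m', h5,
    h6 0 _ (hm.mono fun w hw => hw.2.2.2.2.1), h6 1 _ (hm.mono fun w hw => hw.2.2.2.2.2)⟩

end RelaxedCubics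

end

theorem mainTheorem10 (p₀ q₀ p₁ q₁ : RelaxedCubics.L2Space) :
    IsClosed (RelaxedCubics.relaxedCurves0 p₀ q₀) ∧
      IsClosed (RelaxedCubics.relaxedCurves01 p₀ q₀ p₁ q₁) :=
  ⟨RelaxedCubics.isClosed_relaxedCurves0 p₀ q₀, RelaxedCubics.isClosed_relaxedCurves01 p₀ q₀ p₁ q₁⟩
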